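/- **Model.** Let $a\ge 2$, $d\ge1$. For $i=1,\dots,a$ and $k=1,2,\dots$ let $X_{ik}=\mu_i+\epsilon_{ik}$ be independent $\mathbb R^d$-valued random vectors, where for fixed $i$ and $j$ the components $\epsilon_{ikj}$ ($k\ge1$) are identically distributed with mean $0$ and finite second moment, and $\operatorname{Var}(\epsilon_{ik})=\Sigma_i$ for all $k$. Sample sizes $n_1,\dots,n_a$ with $N=\sum_i n_i\to\infty$ satisfy $n_i/N\to\kappa_i\in(0,1]$. Put $\mu=(\mu_1^\top,\dots,\mu_a^\top)^\top$, $\overline X=(\overline X_{1\cdot}^\top,\dots,\overline X_{a\cdot}^\top)^\top$ with $\overline X_{i\cdot}=n_i^{-1}\sum_{k\le n_i}X_{ik}$, $\Sigma=\bigoplus_{i}\kappa_i^{-1}\Sigma_i$ and $\widehat\Sigma=N\bigoplus_i n_i^{-1}\widehat\Sigma_i$, with $\widehat\Sigma_i$ the empirical covariance matrix of $X_{i1},\dots,X_{in_i}$. Let $\widetilde\Sigma$ be an estimator with $\widetilde\Sigma\to\Sigma$ in probability. **Hypotheses.** Let $C=(C_1^\top,\dots,C_L^\top)^\top$ and $\beta=(\beta_1^\top,\dots,\beta_L^\top)^\top$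 with $L\ge1$, $C_\ell\in\mathbb R^{r_\ell\times ad}$, $\beta_\ell\in\mathbb R^{r_\ell}$. The global hypothesis is $\mathcal H_0:C\mu=\beta$, the local ones are $\mathcal H_0^{(\ell)}:C_\ell\mu=\beta_\ell$. **Quadratic forms.** Let $M(C_\ell,\cdot)$ be measurable functions with values in $\mathbb R^{r_\ell\times r_\ell}$, symmetric and positive semidefinite whenever the argument is, with $M(C_\ell,\widetilde\Sigma)\to M(C_\ell,\Sigma)$ and $M(C_\ell,\widehat\Sigma)\to M(C_\ell,\Sigma)$ in probability. Assume that for each $\ell$ the matrix $C_\ell^\top M(C_\ell,\Sigma)C_\ell\Sigma$ has a nonzero eigenvalue. Write $v_\ell(S)=2\operatorname{tr}([C_\ell^\top M(C_\ell,S)C_\ell S]^2)$ and $$Q_{N\ell}=N\,\frac{(C_\ell\overline X-\beta_\ell)^\top M(C_\ell,\widetilde\Sigma)(C_\ell\overline X-\beta_\ell)}{\sqrt{v_\ell(\widetilde\Sigma)}}\ \text{ if } v_\ell(\widetilde\Sigma)>0,\qquad Q_{N\ell}=0\ \text{ otherwise.}$$ **Monte-Carlo quantiles.** Given the data (and $\widetilde\Sigma$),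 let $Z_1,\dots,Z_B$ be i.i.d. $\mathcal N_{ad}(0,\widehat\Sigma)$ and, with $x/0:=0$ here, put $$Q^{MC,b}_\ell=v_\ell(\widehat\Sigma)^{-1/2}(C_\ell Z_b)^\top M(C_\ell,\widehat\Sigma)C_\ell Z_b.$$ For $\gamma\in[0,1)$ let $q_{\ell}(\gamma)$ be the empirical $(1-\gamma)$-quantile (generalized inverse of the empirical distribution function) of $Q^{MC,1}_\ell,\dots,Q^{MC,B}_\ell$. Let $\gamma_B$ be the largest $\gamma\in\{0,\frac1B,\dots,\frac{B-1}B\}$ with $$\frac1B\sum_{b=1}^B \mathbf 1\{\exists\,\ell:\ Q_\ell^{MC,b}>q_\ell(\gamma)\}\le\alpha ,$$ and set $q^{MC}_{\ell,B}=q_\ell(\gamma_B)$. **Claim.** Let $\alpha\in(0,1)$ and let $B_N\to\infty$ as $N\to\infty$ be any sequence. The test $$\varphi^{MC}_Q(N,B)=\max_{\ell=1,\dots,L}\mathbf 1\{Q_{N\ell}/q^{MC}_{\ell,B}>1\}$$ (with $0/0:=1$ and $x/0:=\infty$ for $x>0$) is of asymptotic level $\alpha$ for $\mathcal H_0$: if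 $C\mu=\beta$, then $$\lim_{N\to\infty}\mathbb E[\varphi^{MC}_Q(N,B_N)]=\alpha .$$ Moreover, it controls the family-wise error rate asymptotically in the strong sense: whatever $\mu$ is, for every set $\mathcal T\subset\{1,\dots,L\}$ of indices of true local hypotheses the following limit exists and satisfies $$\lim_{N\to\infty}\mathbb E\Big[\max_{\ell\in\mathcal T}\mathbf 1\{Q_{N\ell}/q^{MC}_{\ell,B_N}>1\}\Big]\le\alpha .$$ -/

import Mathlib

open MeasureTheory ProbabilityTheory Filter Topology Matrix

namespace QFMCT

noncomputable section

/-- Index set of the stacked mean vector: the pair `(i, j)` stands for component `j` of group `i`. -/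
abbrev Idx (a d : ℕ) : Type := Fin a × Fin d

/-- Row index set of the hypothesis matrix: row `k` of the block number `l`, which has `r l` rows. -/
abbrev Rows {L : ℕ} (r : Fin L → ℕ) : Type := (l : Fin L) × Fin (r l)

/-- A family of maps `(C, S) ↦ M(C, S)`, one for every number of rows of the hypothesis matrix `C`. -/
abbrev WeightFn (a d : ℕ) : Type :=
  (k : ℕ) → Matrix (Fin k) (Idx a d) ℝ → Matrix (Idx a d) (Idx a d) ℝ → Matrix (Fin k) (Fin k) ℝ

/-! ### Model -/

/-- The observations `X_{ik} = μ_i + ε_{ik}`. -/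
def obs {Ω : Type*} {a d : ℕ} (mean : Fin a → Fin d → ℝ) (eps : Fin a → ℕ → Ω → Fin d → ℝ)
    (i : Fin a) (k : ℕ) (ω : Ω) : Fin d → ℝ :=
  fun j => mean i j + eps i k ω j

/-- Stacked vector of group-wise vectors. -/
def stack {a d : ℕ} (x : Fin a → Fin d → ℝ) : Idx a d → ℝ := fun p => x p.1 p.2

/-- Direct sum (block diagonal matrix) of `a` square matrices of size `d`. -/
def directSum {a d : ℕ} (S : Fin a → Matrix (Fin d) (Fin d) ℝ) : Matrix (Idx a d) (Idx a d) ℝ :=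
  Matrix.of fun p q => if p.1 = q.1 then S p.1 p.2 q.2 else 0

/-- Mean vector of the first `n` observations of one group. -/
def groupMean {d : ℕ} (n : ℕ) (x : ℕ → Fin d → ℝ) : Fin d → ℝ :=
  fun j => (n : ℝ)⁻¹ * ∑ k ∈ Finset.range n, x k j

/-- Empirical covariance matrix of the first `n` observations of one group. -/
def groupCov {d : ℕ} (n : ℕ) (x : ℕ → Fin d → ℝ) : Matrix (Fin d) (Fin d) ℝ :=
  Matrix.of fun j j' => ((n : ℝ) - 1)⁻¹ *
    ∑ k ∈ Finset.range n, (x k j - groupMean n x j) * (x k j' - groupMean n x j')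

/-- Total sample size `N = n_1 + ... + n_a`. -/
def total {a : ℕ} (n : Fin a → ℕ) : ℕ := ∑ i, n i

/-- The pooled mean vector, with `x i k` the `k`-th observation in group `i`. -/
def pooledMean {a d : ℕ} (n : Fin a → ℕ) (x : Fin a → ℕ → Fin d → ℝ) : Idx a d → ℝ :=
  stack fun i => groupMean (n i) (x i)

/-- The empirical covariance matrix `N ⋅ ⨁ n_i⁻¹ Σ̂_i`. -/
def empCov {a d : ℕ} (n : Fin a → ℕ) (x : Fin a → ℕ → Fin d → ℝ) :
    Matrix (Idx a d) (Idx a d) ℝ :=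
  (total n : ℝ) • directSum fun i => (n i : ℝ)⁻¹ • groupCov (n i) (x i)

/-- The limiting covariance matrix `⨁ κ_i⁻¹ Σ_i`. -/
def limitCov {a d : ℕ} (κ : Fin a → ℝ) (Sg : Fin a → Matrix (Fin d) (Fin d) ℝ) :
    Matrix (Idx a d) (Idx a d) ℝ :=
  directSum fun i => (κ i)⁻¹ • Sg i

/-- Convergence in probability of random matrices to a fixed matrix (entrywise). -/
def TendstoInProb {Ω m m' : Type*} [MeasurableSpace Ω] (P : Measure Ω)
    (A : ℕ → Ω → Matrix m m' ℝ) (A₀ : Matrix m m' ℝ) : Prop :=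
  ∀ i j, TendstoInMeasure P (fun t ω => A t ω i j) atTop (fun _ => A₀ i j)

/-! ### Hypotheses -/

/-- The block `C_l` of the hypothesis matrix. -/
def blockC {a d L : ℕ} {r : Fin L → ℕ} (C : Matrix (Rows r) (Idx a d) ℝ) (l : Fin L) :
    Matrix (Fin (r l)) (Idx a d) ℝ :=
  Matrix.of fun k => C ⟨l, k⟩

/-- The block `β_l` of the right-hand side. -/
def blockβ {L : ℕ} {r : Fin L → ℕ} (β : Rows r → ℝ) (l : Fin L) : Fin (r l) → ℝ :=
  fun k => β ⟨l, k⟩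

/-- The global hypothesis `C μ = β`. -/
def GlobalNull {a d L : ℕ} {r : Fin L → ℕ} (C : Matrix (Rows r) (Idx a d) ℝ) (β : Rows r → ℝ)
    (mean : Fin a → Fin d → ℝ) : Prop :=
  C *ᵥ stack mean = β

/-- The `l`-th local hypothesis `C_l μ = β_l`. -/
def LocalNull {a d L : ℕ} {r : Fin L → ℕ} (C : Matrix (Rows r) (Idx a d) ℝ) (β : Rows r → ℝ)
    (mean : Fin a → Fin d → ℝ) (l : Fin L) : Prop :=
  blockC C l *ᵥ stack mean = blockβ β l

/-! ### Quadratic forms -/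

/-- `2 tr([Cᵀ M(C, S) C S]²)` -/
def quadVar {a d k : ℕ} (M : WeightFn a d) (C : Matrix (Fin k) (Idx a d) ℝ)
    (S : Matrix (Idx a d) (Idx a d) ℝ) : ℝ :=
  2 * ((Cᵀ * M k C S * C * S) ^ 2).trace

/-- The test statistic `Q_{Nl}` for the hypothesis `C μ = b`, with `xbar` the pooled mean vector and
`S` the covariance estimator; it is set to zero when the trace in the denominator is not positive. -/
def testStat {a d k : ℕ} (M : WeightFn a d) (C : Matrix (Fin k) (Idx a d) ℝ) (b : Fin k → ℝ)
    (N : ℕ) (xbar : Idx a d → ℝ) (S : Matrix (Idx a d) (Idx a d) ℝ) : ℝ :=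
  if 0 < quadVar M C S then
    (N : ℝ) * (((C *ᵥ xbar - b) ⬝ᵥ (M k C S *ᵥ (C *ᵥ xbar - b))) / √(quadVar M C S))
  else 0

/-- The Monte-Carlo quadratic form of a vector `z` simulated from `N(0, S)`. -/
def mcForm {a d k : ℕ} (M : WeightFn a d) (C : Matrix (Fin k) (Idx a d) ℝ)
    (S : Matrix (Idx a d) (Idx a d) ℝ) (z : EuclideanSpace ℝ (Idx a d)) : ℝ :=
  ((C *ᵥ z.ofLp) ⬝ᵥ (M k C S *ᵥ (C *ᵥ z.ofLp))) / √(quadVar M C S)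

/-! ### Quantiles with common adjusted local level -/

/-- Empirical distribution function of `y 0, ..., y (B-1)`. -/
def empCDF {B : ℕ} (y : Fin B → ℝ) (x : ℝ) : ℝ :=
  (Finset.univ.filter fun b => y b ≤ x).card / (B : ℝ)

/-- Empirical `p`-quantile: the generalized inverse of the empirical distribution function. -/
def empQuantile {B : ℕ} (y : Fin B → ℝ) (p : ℝ) : ℝ :=
  sInf {x : ℝ | p ≤ empCDF y x}

open Classical in
/-- Proportion of the replicates `Q^b = q b` that exceed, in at least one component `l`, the empirical
`(1 - γ)`-quantile of that component (estimated family-wise error rate at the local level `γ`). -/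
def estFWER {B L : ℕ} (q : Fin B → Fin L → ℝ) (γ : ℝ) : ℝ :=
  (Finset.univ.filter fun b => ∃ l, empQuantile (fun b' => q b' l) (1 - γ) < q b l).card / (B : ℝ)

open Classical in
/-- The numbers `k < B` for which the local level `k/B` has estimated family-wise error rate at most
`α` (for `B ≥ 1` and `α ≥ 0` this set contains `0`). -/
def admissible {B L : ℕ} (q : Fin B → Fin L → ℝ) (α : ℝ) : Finset ℕ :=
  (Finset.range B).filter fun k : ℕ => estFWER q ((k : ℝ) / (B : ℝ)) ≤ α

/-- The largest local level `γ ∈ {0, 1/B, ..., (B-1)/B}` whose estimated family-wise error rate is at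
most `α`. -/
def localLevel {B L : ℕ} (q : Fin B → Fin L → ℝ) (α : ℝ) : ℝ :=
  (((admissible q α).sup id : ℕ) : ℝ) / (B : ℝ)

/-- The critical value of component `l`: the empirical quantile at the common adjusted local level. -/
def critValue {B L : ℕ} (q : Fin B → Fin L → ℝ) (α : ℝ) (l : Fin L) : ℝ :=
  empQuantile (fun b => q b l) (1 - localLevel q α)

/-! ### The test -/

/-- `Q / q > 1` for a nonnegative critical value `q`, with the conventions `0 / 0 = 1` and
`Q / 0 = ∞` for `Q > 0`. -/
def RatioExceedsOne (Q q : ℝ) : Prop := if q = 0 then 0 < Q else 1 < Q / q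

open Classical in
/-- `max_{l ∈ T} 1{Q l / q l > 1}` (equal to `0` for empty `T`). -/
def maxReject {L : ℕ} (Q q : Fin L → ℝ) (T : Finset (Fin L)) : ℝ :=
  if ∃ l ∈ T, RatioExceedsOne (Q l) (q l) then 1 else 0

/-- `max_{l ∈ T} 1{Q_{Nl} / q_{l,B} > 1}` as a function of the observations `x`, the covariance
estimator `S` and the simulated vectors `z`, which are turned into Monte-Carlo quadratic forms with
the empirical covariance matrix. For `T = {1, ..., L}` this is the Monte-Carlo QFMCT. -/
def mcTest {a d L B : ℕ} {r : Fin L → ℕ} (M : WeightFn a d) (C : Matrix (Rows r) (Idx a d) ℝ)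
    (β : Rows r → ℝ) (α : ℝ) (n : Fin a → ℕ) (x : Fin a → ℕ → Fin d → ℝ)
    (S : Matrix (Idx a d) (Idx a d) ℝ) (z : Fin B → EuclideanSpace ℝ (Idx a d))
    (T : Finset (Fin L)) : ℝ :=
  maxReject
    (fun l => testStat M (blockC C l) (blockβ β l) (total n) (pooledMean n x) S)
    (critValue (fun b l => mcForm M (blockC C l) (empCov n x) (z b)) α)
    T

/-! ### Monte-Carlo sampling -/

/-- The σ-algebra generated by the observations `X_{ik}`, `k ≤ n_i`, and the estimator `S`. -/
abbrev dataSigma {Ω : Type*} {a d : ℕ} (n : Fin a → ℕ) (X : Fin a → ℕ → Ω → Fin d → ℝ)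
    (S : Ω → Matrix (Idx a d) (Idx a d) ℝ) : MeasurableSpace Ω :=
  MeasurableSpace.comap
    (fun ω => ((fun (i : Fin a) (k : Fin (n i)) => X i k ω, fun p q => S ω p q) :
      ((i : Fin a) → Fin (n i) → Fin d → ℝ) × (Idx a d → Idx a d → ℝ)))
    inferInstance

/-- The random variable `Z` has, given the σ-algebra `G`, the conditional distribution `ν ω`. -/
def HasCondLawGiven {Ω E : Type*} [MeasurableSpace Ω] [MeasurableSpace E] (P : Measure Ω)
    (G : MeasurableSpace Ω) (Z : Ω → E) (ν : Ω → Measure E) : Prop :=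
  ∀ s : Set E, MeasurableSet s →
    P[(Z ⁻¹' s).indicator (fun _ => (1 : ℝ)) | G] =ᵐ[P] fun ω => (ν ω).real s

end

end QFMCT

namespace QFMCT

/-! Everything is compared with quadratic forms in one standard normal vector `ξ`. Let `R` be the
square root of `Σ`. If a local hypothesis is true and all groups are nonempty, its statistic is
exactly a quadratic form in `√N (X̄ - μ)`, with a random matrix that converges in probability. The
central limit theorem (`ErrorModel.tendstoInDistribution`) and Slutsky's lemma give, jointly over
the true hypotheses, the limits `ξᵀ A_l ξ`, where `A_l` is `C_lᵀ M(C_l, Σ) C_l` multiplied by `R` on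
both sides and divided by the root of the trace term. Given the data, the simulated forms are of the
same type, with the empirical covariance matrix in place of `Σ`; their matrices converge to the same
`A_l`.

Let `F_T(y)` be the probability that `ξᵀ A_l ξ > y_l` for some `l` in `T` (`exceed`). The eigenvalue
condition makes every `A_l` nonzero, so the forms have no atoms and `F_T` is continuous in matrices
and thresholds. Since the normal law charges open sets, `F_T` drops strictly when all thresholds in
a nonempty `T` rise from nonnegative values. Hence the vector `x(u)` of `u`-quantiles is continuous
and increasing in `u`, and a Bonferroni bracket with the intermediate value theorem gives `u` with
`F(x(u)) = α` for the full index set.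

Chebyshev's inequality, applied conditionally on the data, makes the Monte-Carlo exceedance
frequency at any fixed threshold vector converge to `F_T`, however slowly `B` grows. By
monotonicity, frequencies at four threshold vectors already trap the selected local level and the
critical values (`critValue_mem_Icc`), so no uniform convergence of empirical distribution functions
is needed. Thus the critical values end up between `x(v)` and `x(w)` for all `v < u < w`, and the
rejection probability over `T` tends to `F_T(x(u))`. This is `α` for the full index set and at most
`α` for a subset. The critical values use only centred data, so false hypotheses do no harm.

Only the single components are identically distributed in `k`, not the error vectors. The central
limit theorem therefore goes through a Lindeberg remainder, and consistency of the covariances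
through a truncated weak law, both with bounds that involve one component at a time. -/

/-- Convergence in probability to a constant, in an arbitrary topological space and without
measurability assumptions. -/
def ConvProb {Ω E : Type*} [MeasurableSpace Ω] [TopologicalSpace E] (P : Measure Ω)
    (F : ℕ → Ω → E) (e : E) : Prop :=
  ∀ U ∈ 𝓝 e, Tendsto (fun t => P {ω | F t ω ∉ U}) atTop (𝓝 0)

/-! ### Convergence in probability to a constant -/

section ConvProb

variable {Ω E E' : Type*} [MeasurableSpace Ω] [TopologicalSpace E] [TopologicalSpace E']
  {P : Measure Ω}

/-- Events that fail only if one of two sequences of events with vanishing probability occurs. -/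
theorem tendsto_measure_zero_of_subset_union {A B D : ℕ → Set Ω}
    (h : ∀ᶠ t in atTop, A t ⊆ B t ∪ D t) (hB : Tendsto (fun t => P (B t)) atTop (𝓝 0))
    (hD : Tendsto (fun t => P (D t)) atTop (𝓝 0)) : Tendsto (fun t => P (A t)) atTop (𝓝 0) := by
  have hBD := hB.add hD
  rw [add_zero] at hBD
  refine tendsto_of_tendsto_of_tendsto_of_le_of_le' tendsto_const_nhds hBD
    (Eventually.of_forall fun _ => zero_le) ?_
  filter_upwards [h] with t ht using (measure_mono ht).trans (measure_union_le _ _)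

theorem tendsto_measure_zero_of_subset {A B : ℕ → Set Ω} (h : ∀ᶠ t in atTop, A t ⊆ B t)
    (hB : Tendsto (fun t => P (B t)) atTop (𝓝 0)) : Tendsto (fun t => P (A t)) atTop (𝓝 0) := by
  refine tendsto_of_tendsto_of_tendsto_of_le_of_le' tendsto_const_nhds hB
    (Eventually.of_forall fun _ => zero_le) ?_
  filter_upwards [h] with t ht using measure_mono ht

/-- The version relative to a set serves the matrix square root, whose continuity is available only
on the positive semidefinite cone; empirical covariance matrices always lie in it. -/
theorem ConvProb.comp_continuousWithinAt {F : ℕ → Ω → E} {e : E} {s : Set E} {f : E → E'}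
    (h : ConvProb P F e) (hs : ∀ t ω, F t ω ∈ s) (hf : ContinuousWithinAt f s e) :
    ConvProb P (fun t ω => f (F t ω)) (f e) := by
  intro U hU
  obtain ⟨V, hV, hVU⟩ := mem_nhdsWithin_iff_exists_mem_nhds_inter.1 (hf hU)
  refine tendsto_measure_zero_of_subset (Eventually.of_forall fun t ω hω => ?_) (h V hV)
  by_contra hc
  exact hω (hVU ⟨by simpa using hc, hs t ω⟩)

theorem ConvProb.comp_continuousAt {F : ℕ → Ω → E} {e : E} {f : E → E'}
    (h : ConvProb P F e) (hf : ContinuousAt f e) : ConvProb P (fun t ω => f (F t ω)) (f e) :=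
  h.comp_continuousWithinAt (s := Set.univ) (by simp) hf.continuousWithinAt

theorem ConvProb.prodMk {F : ℕ → Ω → E} {e : E} {F' : ℕ → Ω → E'} {e' : E'}
    (h : ConvProb P F e) (h' : ConvProb P F' e') :
    ConvProb P (fun t ω => (F t ω, F' t ω)) (e, e') := by
  intro U hU
  obtain ⟨V, hV, V', hV', hVU⟩ := mem_nhds_prod_iff.1 hU
  refine tendsto_measure_zero_of_subset_union (Eventually.of_forall fun t ω hω => ?_)
    (h V hV) (h' V' hV')
  by_contra hc
  simp only [Set.mem_union, Set.mem_ofPred_eq, not_or, not_not] at hc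
  exact hω (hVU ⟨hc.1, hc.2⟩)

theorem tendsto_measure_iUnion_zero {ι : Type*} [Fintype ι] {A : ι → ℕ → Set Ω}
    (h : ∀ i, Tendsto (fun t => P (A i t)) atTop (𝓝 0)) :
    Tendsto (fun t => P (⋃ i, A i t)) atTop (𝓝 0) := by
  have hs := tendsto_finsetSum (Finset.univ : Finset ι) fun i _ => h i
  rw [Finset.sum_const_zero] at hs
  refine tendsto_of_tendsto_of_tendsto_of_le_of_le tendsto_const_nhds hs
    (fun _ => zero_le) fun t => measure_iUnion_fintype_le P _

theorem ConvProb.pi {ι : Type*} [Fintype ι] {E : ι → Type*} [∀ i, TopologicalSpace (E i)]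
    {F : ℕ → Ω → (i : ι) → E i} {e : (i : ι) → E i}
    (h : ∀ i, ConvProb P (fun t ω => F t ω i) (e i)) : ConvProb P F e := by
  intro U hU
  rw [nhds_pi, Filter.mem_pi'] at hU
  obtain ⟨I, V, hV, hVU⟩ := hU
  refine tendsto_measure_zero_of_subset (Eventually.of_forall fun t ω hω => ?_)
    (tendsto_measure_iUnion_zero fun i => h i (V i) (hV i))
  by_contra hc
  simp only [Set.mem_iUnion, Set.mem_ofPred_eq, not_exists, not_not] at hc
  exact hω (hVU fun i _ => hc i)

theorem ConvProb.matrix {m m' : Type*} [Fintype m] [Fintype m'] {F : ℕ → Ω → Matrix m m' ℝ}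
    {e : Matrix m m' ℝ} (h : ∀ i j, ConvProb P (fun t ω => F t ω i j) (e i j)) : ConvProb P F e :=
  ConvProb.pi (E := fun _ => m' → ℝ) fun i => ConvProb.pi (E := fun _ => ℝ) fun j => h i j

theorem convProb_iff_tendstoInMeasure {E : Type*} [PseudoMetricSpace E] {F : ℕ → Ω → E} {e : E} :
    ConvProb P F e ↔ TendstoInMeasure P F atTop (fun _ => e) := by
  rw [tendstoInMeasure_iff_dist]
  constructor
  · intro h ε hε
    refine (h _ (Metric.ball_mem_nhds e hε)).congr fun t => ?_
    simp [Metric.mem_ball]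
  · intro h U hU
    obtain ⟨ε, hε, hεU⟩ := Metric.mem_nhds_iff.1 hU
    refine tendsto_measure_zero_of_subset (Eventually.of_forall fun t ω hω => ?_) (h ε hε)
    by_contra hc
    exact hω (hεU (by simpa [Metric.mem_ball] using hc))

theorem TendstoInProb.convProb {m m' : Type*} [Fintype m] [Fintype m']
    {F : ℕ → Ω → Matrix m m' ℝ} {e : Matrix m m' ℝ} (h : TendstoInProb P F e) : ConvProb P F e :=
  ConvProb.matrix fun i j => convProb_iff_tendstoInMeasure.2 (h i j)

theorem ConvProb.comp_tendsto {F : ℕ → Ω → E} {e : E} (h : ConvProb P F e) {u : ℕ → ℕ}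
    (hu : Tendsto u atTop atTop) : ConvProb P (fun t => F (u t)) e :=
  fun U hU => (h U hU).comp hu

theorem convProb_of_tendsto {f : ℕ → E} {e : E} (h : Tendsto f atTop (𝓝 e)) :
    ConvProb P (fun t _ => f t) e := by
  intro U hU
  refine tendsto_const_nhds.congr' ?_
  filter_upwards [h hU] with t ht
  have : {ω : Ω | f t ∉ U} = ∅ := by ext; simpa using ht
  rw [this, measure_empty]

theorem ConvProb.congr {F F' : ℕ → Ω → E} {e : E} (h : ConvProb P F e)
    (hF : ∀ᶠ t in atTop, ∀ ω, F t ω = F' t ω) : ConvProb P F' e := by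
  intro U hU
  refine (h U hU).congr' ?_
  filter_upwards [hF] with t ht
  simp_rw [ht]

theorem convProb_of_ae_tendsto [IsFiniteMeasure P] {F : ℕ → Ω → ℝ} {e : ℝ}
    (hF : ∀ t, Measurable (F t)) (h : ∀ᵐ ω ∂P, Tendsto (fun t => F t ω) atTop (𝓝 e)) :
    ConvProb P F e :=
  convProb_iff_tendstoInMeasure.2
    (tendstoInMeasure_of_tendsto_ae (fun t => (hF t).aestronglyMeasurable) h)

end ConvProb

/-! ### Lindeberg's theorem for characteristic functions -/

section Lindeberg

/-- For `|x| ≤ 1` the tail of the series is cubic; for `|x| ≥ 1` every term is bounded separately by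
a multiple of `x ^ 2`. The minimum keeps the remainder integrable under second moments only. -/
theorem norm_exp_mul_I_sub_taylor_le (x : ℝ) :
    ‖Complex.exp (x * Complex.I) - (1 + x * Complex.I - (x : ℂ) ^ 2 / 2)‖
      ≤ 4 * (x ^ 2 * min 1 |x|) := by
  rcases le_total |x| 1 with h | h
  · have hx : ‖(x * Complex.I : ℂ)‖ = |x| := by simp
    have := Complex.exp_bound (x := x * Complex.I) (by rw [hx]; exact h) (n := 3) (by norm_num)
    rw [hx] at this
    have e : ∑ m ∈ Finset.range 3, (x * Complex.I : ℂ) ^ m / (m.factorial : ℂ)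
        = 1 + x * Complex.I - (x : ℂ) ^ 2 / 2 := by
      simp [Finset.sum_range_succ, mul_pow]
      ring
    rw [e] at this
    refine this.trans ?_
    rw [min_eq_right h, ← sq_abs x]
    have h3 : 0 ≤ |x| ^ 3 := by positivity
    have h4 : |x| ^ 2 * |x| = |x| ^ 3 := by ring
    rw [h4]
    norm_num [Nat.factorial]
    linarith
  · rw [min_eq_left h, mul_one]
    have h1 : ‖Complex.exp (x * Complex.I)‖ = 1 := Complex.norm_exp_ofReal_mul_I x
    have h2 : ‖(1 + x * Complex.I - (x : ℂ) ^ 2 / 2 : ℂ)‖ ≤ 1 + |x| + x ^ 2 / 2 := by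
      refine (norm_sub_le _ _).trans (add_le_add ((norm_add_le _ _).trans (by simp)) (by simp))
    refine (norm_sub_le _ _).trans ?_
    rw [h1]
    have : |x| ^ 2 = x ^ 2 := sq_abs x
    nlinarith

variable {Ω : Type*} [MeasurableSpace Ω] {P : Measure Ω}

/-- The Lindeberg remainder `E[Y² min(1, |s Y|)]`. -/
noncomputable def lindeberg (P : Measure Ω) (Y : Ω → ℝ) (s : ℝ) : ℝ :=
  ∫ ω, Y ω ^ 2 * min 1 |s * Y ω| ∂P

theorem integrable_lindeberg {Y : Ω → ℝ} (hY : MemLp Y 2 P) (s : ℝ) :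
    Integrable (fun ω => Y ω ^ 2 * min 1 |s * Y ω|) P := by
  have h1 := hY.aestronglyMeasurable.aemeasurable
  refine hY.integrable_sq.mono' (AEMeasurable.aestronglyMeasurable (by fun_prop))
    (Eventually.of_forall fun ω => ?_)
  rw [Real.norm_of_nonneg (by positivity)]
  exact mul_le_of_le_one_right (by positivity) (min_le_left _ _)

theorem tendsto_lindeberg {Y : Ω → ℝ} (hY : MemLp Y 2 P) {s : ℕ → ℝ}
    (hs : Tendsto s atTop (𝓝 0)) : Tendsto (fun t => lindeberg P Y (s t)) atTop (𝓝 0) := by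
  have h0 : (0 : ℝ) = ∫ _ω, (0 : ℝ) ∂P := by simp
  rw [h0]
  refine tendsto_integral_of_dominated_convergence (fun ω => Y ω ^ 2)
    (fun t => (integrable_lindeberg hY (s t)).aestronglyMeasurable) hY.integrable_sq
    (fun t => Eventually.of_forall fun ω => ?_) (Eventually.of_forall fun ω => ?_)
  · rw [Real.norm_of_nonneg (by positivity)]
    exact mul_le_of_le_one_right (by positivity) (min_le_left _ _)
  · have hc : Continuous fun u : ℝ => Y ω ^ 2 * min 1 |u * Y ω| := by fun_prop
    simpa [Function.comp_def] using (hc.tendsto 0).comp hs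

/-- Integration of the pointwise Taylor bound at `s * Y`; centring removes the linear term. -/
theorem norm_charFun_sub_taylor_le [IsProbabilityMeasure P] {Y : Ω → ℝ} (hY : MemLp Y 2 P) (h0 : ∫ ω, Y ω ∂P = 0)
    (s : ℝ) :
    ‖charFun (P.map Y) s - (1 - ((s ^ 2 / 2 * ∫ ω, Y ω ^ 2 ∂P : ℝ) : ℂ))‖
      ≤ 4 * s ^ 2 * lindeberg P Y s := by
  have hm := hY.aestronglyMeasurable.aemeasurable
  have hi : Integrable Y P := hY.integrable (by norm_num)
  have hc : Integrable (fun ω => Complex.exp ((s * Y ω : ℝ) * Complex.I)) P := by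
    refine Integrable.of_bound (C := 1) (AEMeasurable.aestronglyMeasurable (by fun_prop)) ?_
    exact Eventually.of_forall fun ω => (Complex.norm_exp_ofReal_mul_I _).le
  have hp : Integrable (fun ω => (1 + (s * Y ω : ℝ) * Complex.I
      - ((s * Y ω : ℝ) : ℂ) ^ 2 / 2 : ℂ)) P := by
    refine ((integrable_const _).add ((hi.const_mul s).ofReal.mul_const _)).sub ?_
    have := (hY.integrable_sq.const_mul (s ^ 2 / 2)).ofReal (𝕜 := ℂ)
    refine this.congr (Eventually.of_forall fun ω => ?_)
    simp only [RCLike.ofReal_eq_complex_ofReal]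
    push_cast
    ring
  have e1 : charFun (P.map Y) s = ∫ ω, Complex.exp ((s * Y ω : ℝ) * Complex.I) ∂P := by
    rw [charFun_apply_real, integral_map hm (by fun_prop)]
    simp
  have e2 : (1 - ((s ^ 2 / 2 * ∫ ω, Y ω ^ 2 ∂P : ℝ) : ℂ))
      = ∫ ω, (1 + (s * Y ω : ℝ) * Complex.I - ((s * Y ω : ℝ) : ℂ) ^ 2 / 2 : ℂ) ∂P := by
    have h3 : (fun ω => (1 + (s * Y ω : ℝ) * Complex.I - ((s * Y ω : ℝ) : ℂ) ^ 2 / 2 : ℂ))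
        = fun ω => (1 + ((s * Y ω : ℝ) : ℂ) * Complex.I) - ((s ^ 2 / 2 * Y ω ^ 2 : ℝ) : ℂ) := by
      ext ω; push_cast; ring
    rw [h3, integral_sub ((integrable_const _).add ((hi.const_mul s).ofReal.mul_const _))
      (hY.integrable_sq.const_mul (s ^ 2 / 2)).ofReal, integral_add (integrable_const _)
      ((hi.const_mul s).ofReal.mul_const _), integral_mul_const]
    have h4 : ∫ ω, ((s * Y ω : ℝ) : ℂ) ∂P = 0 := by
      rw [integral_complex_ofReal, integral_const_mul, h0]; simp
    rw [h4, integral_complex_ofReal, integral_const_mul]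
    simp
  rw [e1, e2, ← integral_sub hc hp]
  refine (norm_integral_le_integral_norm _).trans ?_
  rw [lindeberg, ← integral_const_mul]
  refine integral_mono (hc.sub hp).norm ((integrable_lindeberg hY s).const_mul _) fun ω => ?_
  refine (norm_exp_mul_I_sub_taylor_le (s * Y ω)).trans (le_of_eq ?_)
  ring

/-- Factors are exchanged one at a time, and all the others have modulus at most one. -/
theorem norm_prod_sub_prod_le {ι : Type*} (I : Finset ι) (z w : ι → ℂ) (hz : ∀ i, ‖z i‖ ≤ 1)
    (hw : ∀ i, ‖w i‖ ≤ 1) : ‖∏ i ∈ I, z i - ∏ i ∈ I, w i‖ ≤ ∑ i ∈ I, ‖z i - w i‖ := by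
  classical
  induction I using Finset.induction_on with
  | empty => simp
  | insert i I hi ih =>
    rw [Finset.prod_insert hi, Finset.prod_insert hi, Finset.sum_insert hi]
    have e : z i * ∏ j ∈ I, z j - w i * ∏ j ∈ I, w j
        = (z i - w i) * ∏ j ∈ I, z j + w i * (∏ j ∈ I, z j - ∏ j ∈ I, w j) := by ring
    rw [e]
    refine (norm_add_le _ _).trans (add_le_add ?_ ?_)
    · rw [norm_mul, norm_prod]
      exact mul_le_of_le_one_right (norm_nonneg _)
        (Finset.prod_le_one (fun _ _ => norm_nonneg _) fun j _ => hz j)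
    · rw [norm_mul]
      exact (mul_le_of_le_one_left (norm_nonneg _) (hw i)).trans ih

/-- Characteristic function form of the Lindeberg central limit theorem, for rows built from a
sequence of centred variables with common variance. -/
theorem tendsto_prod_charFun [IsProbabilityMeasure P] {Y : ℕ → Ω → ℝ} (hY : ∀ k, MemLp (Y k) 2 P)
    (h0 : ∀ k, ∫ ω, Y k ω ∂P = 0) {v : ℝ} (hv : ∀ k, ∫ ω, Y k ω ^ 2 ∂P = v)
    {h : ℝ → ℝ} (hh : ∀ k s, lindeberg P (Y k) s ≤ h s) {n : ℕ → ℕ} {s : ℕ → ℝ} {c : ℝ}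
    (hs : Tendsto s atTop (𝓝 0)) (hhs : Tendsto (fun t => h (s t)) atTop (𝓝 0))
    (hns : Tendsto (fun t => (n t : ℝ) * s t ^ 2) atTop (𝓝 c)) :
    Tendsto (fun t => ∏ k ∈ Finset.range (n t), charFun (P.map (Y k)) (s t)) atTop
      (𝓝 (Complex.exp ((-(c * v / 2) : ℝ) : ℂ))) := by
  have hv0 : 0 ≤ v := hv 0 ▸ integral_nonneg fun ω => sq_nonneg _
  -- The comparison product consists of the normal characteristic functions with variance `v`, whose
  -- product is a single explicit exponential.
  have hlim : Tendsto (fun t => ∏ _k ∈ Finset.range (n t),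
      Complex.exp ((-(s t ^ 2 / 2 * v) : ℝ) : ℂ)) atTop
      (𝓝 (Complex.exp ((-(c * v / 2) : ℝ) : ℂ))) := by
    simp_rw [Finset.prod_const, Finset.card_range, ← Complex.exp_nat_mul]
    refine (Complex.continuous_exp.tendsto _).comp ?_
    have h1 : Tendsto (fun t => -((n t : ℝ) * s t ^ 2 * v / 2)) atTop (𝓝 (-(c * v / 2))) :=
      ((hns.mul_const v).div_const 2).neg
    refine ((Complex.continuous_ofReal.tendsto _).comp h1).congr fun t => ?_
    simp only [Function.comp]
    push_cast
    ring
  -- The sum of `n` equal error bounds: the Taylor error of each factor plus the error `(s ^ 2 * v /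
  -- 2) ^ 2` of replacing `1 - y` by `exp (-y)`, valid for `y ≤ 1`.
  have hbound : Tendsto (fun t => (n t : ℝ) * s t ^ 2 * (4 * h (s t)
      + s t ^ 2 * (v ^ 2 / 4))) atTop (𝓝 0) := by
    have := hns.mul ((hhs.const_mul 4).add ((hs.pow 2).mul_const (v ^ 2 / 4)))
    simpa using this
  have hsmall : ∀ᶠ t in atTop, s t ^ 2 / 2 * v ≤ 1 := by
    have : Tendsto (fun t => s t ^ 2 / 2 * v) atTop (𝓝 (0 ^ 2 / 2 * v)) :=
      ((hs.pow 2).div_const 2).mul_const v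
    have h1 : (0 : ℝ) ^ 2 / 2 * v < 1 := by norm_num
    exact (this.eventually_lt_const h1).mono fun t ht => ht.le
  have hdiff : Tendsto (fun t => ∏ k ∈ Finset.range (n t), charFun (P.map (Y k)) (s t)
      - ∏ _k ∈ Finset.range (n t), Complex.exp ((-(s t ^ 2 / 2 * v) : ℝ) : ℂ)) atTop (𝓝 0) := by
    refine squeeze_zero_norm' ?_ hbound
    filter_upwards [hsmall] with t ht
    have hm (k : ℕ) := (hY k).aestronglyMeasurable.aemeasurable
    refine (norm_prod_sub_prod_le _ _ _ (fun k => ?_) (fun k => ?_)).trans ?_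
    · have := Measure.isProbabilityMeasure_map (hm k)
      exact norm_charFun_le_one _
    · rw [Complex.norm_exp, Complex.ofReal_re, Real.exp_le_one_iff, neg_nonpos]
      positivity
    · refine (Finset.sum_le_card_nsmul _ _ (s t ^ 2 * (4 * h (s t) + s t ^ 2 * (v ^ 2 / 4)))
        fun k _ => ?_).trans (le_of_eq ?_)
      · have a1 := norm_charFun_sub_taylor_le (hY k) (h0 k) (s t)
        rw [hv k] at a1
        have a2 : ‖Complex.exp ((-(s t ^ 2 / 2 * v) : ℝ) : ℂ)
            - (1 - ((s t ^ 2 / 2 * v : ℝ) : ℂ))‖ ≤ (s t ^ 2 / 2 * v) ^ 2 := by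
          have b := Real.abs_exp_sub_one_sub_id_le (x := -(s t ^ 2 / 2 * v))
            (by rw [abs_neg, abs_of_nonneg (by positivity)]; exact ht)
          rw [neg_sq] at b
          refine le_trans (le_of_eq ?_) b
          rw [← Real.norm_eq_abs, ← Complex.norm_real]
          congr 1
          push_cast
          ring
        have a3 := norm_sub_le_norm_sub_add_norm_sub (charFun (P.map (Y k)) (s t))
          (1 - ((s t ^ 2 / 2 * v : ℝ) : ℂ)) (Complex.exp ((-(s t ^ 2 / 2 * v) : ℝ) : ℂ))
        rw [norm_sub_rev (1 - ((s t ^ 2 / 2 * v : ℝ) : ℂ))] at a3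
        have a4 := mul_le_mul_of_nonneg_left (hh k (s t)) (sq_nonneg (s t))
        nlinarith
      · simp; ring
  simpa using hdiff.add hlim

end Lindeberg

/-! ### The error model, growing group sizes and linear forms of the errors -/

/-- The assumptions on the errors of the model. -/
structure ErrorModel {Ω : Type*} [MeasurableSpace Ω] (P : Measure Ω) {a d : ℕ}
    (eps : Fin a → ℕ → Ω → Fin d → ℝ) (Sg : Fin a → Matrix (Fin d) (Fin d) ℝ) : Prop where
  meas : ∀ i k, Measurable (eps i k)
  indep : iIndepFun (fun (p : Fin a × ℕ) => eps p.1 p.2) P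
  ident : ∀ i k k' j, IdentDistrib (fun ω => eps i k ω j) (fun ω => eps i k' ω j) P P
  mean : ∀ i k j, ∫ ω, eps i k ω j ∂P = 0
  sq : ∀ i k j, MemLp (fun ω => eps i k ω j) 2 P
  cov : ∀ i k j j', covariance (fun ω => eps i k ω j) (fun ω => eps i k ω j') P = Sg i j j'

/-- Group sizes that grow proportionally. -/
structure GrowingSizes {a : ℕ} (n : ℕ → Fin a → ℕ) (κ : Fin a → ℝ) : Prop where
  pos : ∀ i, 0 < κ i
  total : Tendsto (fun t => QFMCT.total (n t)) atTop atTop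
  ratio : ∀ i, Tendsto (fun t => (n t i : ℝ) / (QFMCT.total (n t) : ℝ)) atTop (𝓝 (κ i))

theorem GrowingSizes.tendsto_real {a : ℕ} {n : ℕ → Fin a → ℕ} {κ : Fin a → ℝ}
    (h : GrowingSizes n κ) (i : Fin a) : Tendsto (fun t => (n t i : ℝ)) atTop atTop := by
  have h1 : Tendsto (fun t => (QFMCT.total (n t) : ℝ)) atTop atTop :=
    tendsto_natCast_atTop_atTop.comp h.total
  refine ((h.ratio i).pos_mul_atTop (h.pos i) h1).congr' ?_
  filter_upwards [h1.eventually_gt_atTop 0] with t ht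
  field_simp

theorem GrowingSizes.tendsto_group {a : ℕ} {n : ℕ → Fin a → ℕ} {κ : Fin a → ℝ}
    (h : GrowingSizes n κ) (i : Fin a) : Tendsto (fun t => n t i) atTop atTop :=
  tendsto_natCast_atTop_iff.1 (h.tendsto_real i)

theorem GrowingSizes.inv_ratio {a : ℕ} {n : ℕ → Fin a → ℕ} {κ : Fin a → ℝ}
    (h : GrowingSizes n κ) (i : Fin a) :
    Tendsto (fun t => (QFMCT.total (n t) : ℝ) * (n t i : ℝ)⁻¹) atTop (𝓝 (κ i)⁻¹) :=
  ((h.ratio i).inv₀ (h.pos i).ne').congr fun t => by rw [inv_div, div_eq_mul_inv]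

theorem directSum_quadratic {a d : ℕ} (S : Fin a → Matrix (Fin d) (Fin d) ℝ) (x : Idx a d → ℝ) :
    x ⬝ᵥ (directSum S *ᵥ x) = ∑ i, (fun j => x (i, j)) ⬝ᵥ (S i *ᵥ fun j => x (i, j)) := by
  simp only [dotProduct, mulVec, directSum, of_apply, Fintype.sum_prod_type]
  refine Finset.sum_congr rfl fun i _ => Finset.sum_congr rfl fun j _ => ?_
  congr 1
  rw [Finset.sum_eq_single i]
  · simp
  · intro i' _ hi
    simp [Ne.symm hi]
  · simp

theorem posSemidef_directSum {a d : ℕ} {S : Fin a → Matrix (Fin d) (Fin d) ℝ}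
    (hS : ∀ i, (S i).PosSemidef) : (directSum S).PosSemidef := by
  refine posSemidef_iff_dotProduct_mulVec.2 ⟨?_, fun x => ?_⟩
  · ext p q
    by_cases h : p.1 = q.1
    · have := congrFun (congrFun (hS q.1).isHermitian p.2) q.2
      simp only [conjTranspose_apply, star_trivial] at this
      simp [directSum, conjTranspose_apply, h, this]
    · simp [directSum, conjTranspose_apply, h, Ne.symm h]
  · rw [star_trivial, directSum_quadratic]
    exact Finset.sum_nonneg fun i _ => (posSemidef_iff_dotProduct_mulVec.1 (hS i)).2 _

section Linear

variable {Ω : Type*} [MeasurableSpace Ω] {P : Measure Ω} {a d : ℕ}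
  {eps : Fin a → ℕ → Ω → Fin d → ℝ} {Sg : Fin a → Matrix (Fin d) (Fin d) ℝ}

theorem ErrorModel.measurable_coord (h : ErrorModel P eps Sg) (i k j) :
    Measurable fun ω => eps i k ω j :=
  (measurable_pi_apply j).comp (h.meas i k)

theorem ErrorModel.memLp_linear (h : ErrorModel P eps Sg) (x : Fin d → ℝ) (i k) :
    MemLp (fun ω => x ⬝ᵥ eps i k ω) 2 P :=
  memLp_finsetSum _ fun j _ => (h.sq i k j).const_mul (x j)

theorem ErrorModel.integral_mul (h : ErrorModel P eps Sg) (i k j j') :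
    ∫ ω, eps i k ω j * eps i k ω j' ∂P = Sg i j j' := by
  rw [← h.cov i k j j', covariance]
  simp [h.mean]

theorem ErrorModel.integrable_mul (h : ErrorModel P eps Sg) (i k j j') :
    Integrable (fun ω => eps i k ω j * eps i k ω j') P :=
  (h.sq i k j).integrable_mul (h.sq i k j')

theorem ErrorModel.integral_linear_sq (h : ErrorModel P eps Sg) (x : Fin d → ℝ) (i k) :
    ∫ ω, (x ⬝ᵥ eps i k ω) ^ 2 ∂P = x ⬝ᵥ (Sg i *ᵥ x) := by
  have e : ∀ ω, (x ⬝ᵥ eps i k ω) ^ 2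
      = ∑ j, ∑ j', x j * x j' * (eps i k ω j * eps i k ω j') := by
    intro ω
    rw [_root_.sq, dotProduct, Finset.sum_mul_sum]
    refine Finset.sum_congr rfl fun j _ => Finset.sum_congr rfl fun j' _ => by ring
  simp_rw [e]
  rw [integral_finsetSum _ fun j _ => integrable_finsetSum _ fun j' _ =>
    (h.integrable_mul i k j j').const_mul _]
  simp only [dotProduct, mulVec]
  refine Finset.sum_congr rfl fun j _ => ?_
  rw [integral_finsetSum _ fun j' _ => (h.integrable_mul i k j j').const_mul _, Finset.mul_sum]
  refine Finset.sum_congr rfl fun j' _ => ?_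
  rw [integral_const_mul, h.integral_mul]
  ring

theorem ErrorModel.posSemidef (h : ErrorModel P eps Sg) (i) : (Sg i).PosSemidef := by
  refine posSemidef_iff_dotProduct_mulVec.2 ⟨?_, fun x => ?_⟩
  · ext j j'
    simp [conjTranspose_apply, ← h.cov i 0, covariance_comm]
  · rw [star_trivial, ← h.integral_linear_sq x i 0]
    exact integral_nonneg fun ω => sq_nonneg _

theorem ErrorModel.posSemidef_limitCov (h : ErrorModel P eps Sg) {κ : Fin a → ℝ}
    (hκ : ∀ i, 0 < κ i) : (limitCov κ Sg).PosSemidef :=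
  posSemidef_directSum fun i => (h.posSemidef i).smul (inv_nonneg.2 (hκ i).le)

/-- The sum is at most `d` times its largest summand in absolute value, and `y ^ 2 * min 1 |s * y|`
increases with `|y|`; so the term of the largest coordinate alone suffices. It reduces linear forms
to single components. -/
theorem sum_sq_mul_min_le (x : Fin d → ℝ) (s : ℝ) :
    (∑ j, x j) ^ 2 * min 1 |s * ∑ j, x j|
      ≤ ∑ j, (d * x j) ^ 2 * min 1 |s * (d * x j)| := by
  rcases Nat.eq_zero_or_pos d with rfl | hd
  · simp
  have : Nonempty (Fin d) := ⟨⟨0, hd⟩⟩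
  obtain ⟨m, hm⟩ := Finite.exists_max fun j => |x j|
  have h1 : |∑ j, x j| ≤ |d * x m| := by
    refine (Finset.abs_sum_le_sum_abs _ _).trans ?_
    refine (Finset.sum_le_card_nsmul _ _ |x m| fun j _ => hm j).trans (le_of_eq ?_)
    simp [abs_mul]
  have h2 : (∑ j, x j) ^ 2 * min 1 |s * ∑ j, x j| ≤ (d * x m) ^ 2 * min 1 |s * (d * x m)| := by
    refine mul_le_mul (sq_le_sq.2 h1) (min_le_min_left _ ?_) (by positivity) (by positivity)
    rw [abs_mul, abs_mul s]
    exact mul_le_mul_of_nonneg_left h1 (abs_nonneg s)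
  exact h2.trans (Finset.single_le_sum (f := fun j => (d * x j) ^ 2 * min 1 |s * (d * x j)|)
    (fun j _ => by positivity) (Finset.mem_univ m))

/-- A bound of the Lindeberg remainder of a linear form that does not depend on the observation. -/
theorem ErrorModel.lindeberg_le (h : ErrorModel P eps Sg) (x : Fin d → ℝ) (i k) (s : ℝ) :
    lindeberg P (fun ω => x ⬝ᵥ eps i k ω) s
      ≤ ∑ j, lindeberg P (fun ω => d * (x j * eps i 0 ω j)) s := by
  -- Observation `k` may be replaced by observation `0` only here, componentwise, since the linear
  -- form itself need not have the same law for all `k`.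
  have e : ∀ j, lindeberg P (fun ω => d * (x j * eps i 0 ω j)) s
      = lindeberg P (fun ω => d * (x j * eps i k ω j)) s := by
    intro j
    have := (h.ident i 0 k j).comp
      (u := fun y : ℝ => (d * (x j * y)) ^ 2 * min 1 |s * (d * (x j * y))|) (by fun_prop)
    exact this.integral_eq
  simp_rw [e]
  have hi : ∀ j, Integrable (fun ω => (d * (x j * eps i k ω j)) ^ 2
      * min 1 |s * (d * (x j * eps i k ω j))|) P :=
    fun j => integrable_lindeberg (((h.sq i k j).const_mul (x j)).const_mul d) s
  unfold lindeberg
  rw [← integral_finsetSum _ fun j _ => hi j]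
  exact integral_mono (integrable_lindeberg (h.memLp_linear x i k) s)
    (integrable_finsetSum _ fun j _ => hi j) fun ω => sum_sq_mul_min_le _ s

theorem ErrorModel.tendsto_lindeberg_bound (h : ErrorModel P eps Sg) (x : Fin d → ℝ) (i)
    {s : ℕ → ℝ} (hs : Tendsto s atTop (𝓝 0)) :
    Tendsto (fun t => ∑ j, lindeberg P (fun ω => d * (x j * eps i 0 ω j)) (s t))
      atTop (𝓝 0) := by
  have := tendsto_finsetSum (Finset.univ : Finset (Fin d)) fun j _ =>
    tendsto_lindeberg (((h.sq i 0 j).const_mul (x j)).const_mul d) hs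
  simpa using this

end Linear

/-! ### Central limit theorem for the stacked group means -/

section CentralLimit

variable {Ω : Type*} [MeasurableSpace Ω] {P : Measure Ω} [IsProbabilityMeasure P] {a d : ℕ}
  {eps : Fin a → ℕ → Ω → Fin d → ℝ} {Sg : Fin a → Matrix (Fin d) (Fin d) ℝ}

/-- The centred and scaled vector of group means. -/
noncomputable def scaledMean (n : Fin a → ℕ) (e : Fin a → ℕ → Fin d → ℝ) :
    EuclideanSpace ℝ (Idx a d) :=
  WithLp.toLp 2 fun p => √(total n : ℝ) * groupMean (n p.1) (e p.1) p.2

omit [IsProbabilityMeasure P] in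
theorem ErrorModel.measurable_scaledMean (h : ErrorModel P eps Sg) (n : Fin a → ℕ) :
    Measurable fun ω => scaledMean n fun i k => eps i k ω := by
  refine (WithLp.measurable_toLp 2 _).comp (measurable_pi_lambda _ fun p => ?_)
  refine Measurable.const_mul (Measurable.const_mul ?_ _) _
  exact Finset.measurable_sum _ fun k _ => h.measurable_coord p.1 k p.2

theorem inner_scaledMean (n : Fin a → ℕ) (e : Fin a → ℕ → Fin d → ℝ)
    (x : EuclideanSpace ℝ (Idx a d)) :
    inner ℝ (scaledMean n e) x = ∑ q ∈ (Finset.univ : Finset (Fin a)).sigma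
      (fun i => Finset.range (n i)), √(total n : ℝ) * (n q.1 : ℝ)⁻¹ *
        ((fun j => x.ofLp (q.1, j)) ⬝ᵥ e q.1 q.2) := by
  rw [Finset.sum_sigma, PiLp.inner_apply, Fintype.sum_prod_type]
  refine Finset.sum_congr rfl fun i _ => ?_
  simp only [scaledMean, groupMean, RCLike.inner_apply, conj_trivial, dotProduct, Finset.mul_sum]
  rw [Finset.sum_comm]
  refine Finset.sum_congr rfl fun k _ => Finset.sum_congr rfl fun j _ => by ring

omit [IsProbabilityMeasure P] in
-- The inner product with `x` is a sum of independent terms over all pairs `(i, k)`, each scaled by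
-- `√N / n_i`, so the characteristic function factorises.
theorem ErrorModel.charFun_scaledMean (h : ErrorModel P eps Sg) (n : Fin a → ℕ)
    (x : EuclideanSpace ℝ (Idx a d)) :
    charFun (P.map fun ω => scaledMean n fun i k => eps i k ω) x
      = ∏ i, ∏ k ∈ Finset.range (n i),
        charFun (P.map fun ω => (fun j => x.ofLp (i, j)) ⬝ᵥ eps i k ω)
          (√(total n : ℝ) * (n i : ℝ)⁻¹) := by
  set X : (q : (_ : Fin a) × ℕ) → Ω → ℝ := fun q ω => √(total n : ℝ) * (n q.1 : ℝ)⁻¹ *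
        ((fun j => x.ofLp (q.1, j)) ⬝ᵥ eps q.1 q.2 ω) with hX
  have hlin : ∀ (y : Fin d → ℝ) (i k), Measurable fun ω => y ⬝ᵥ eps i k ω := fun y i k =>
    Finset.measurable_sum _ fun j _ => (h.measurable_coord i k j).const_mul _
  have hXm : ∀ q, Measurable (X q) := fun q => (hlin _ q.1 q.2).const_mul _
  have hXi : iIndepFun X P := by
    have h1 : iIndepFun (fun q : (_ : Fin a) × ℕ => eps q.1 q.2) P :=
      h.indep.precomp (g := fun q : (_ : Fin a) × ℕ => (q.1, q.2))
        (fun q q' hq => by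
          obtain ⟨i, k⟩ := q
          obtain ⟨i', k'⟩ := q'
          simp only [Prod.mk.injEq] at hq
          rw [hq.1, hq.2])
    exact h1.comp (fun q y => √(total n : ℝ) * (n q.1 : ℝ)⁻¹ *
        ((fun j => x.ofLp (q.1, j)) ⬝ᵥ y)) fun q => by
          simp only [dotProduct]
          fun_prop
  have e1 : charFun (P.map fun ω => scaledMean n fun i k => eps i k ω) x
      = charFun (P.map fun ω => ∑ q ∈ (Finset.univ : Finset (Fin a)).sigma
      (fun i => Finset.range (n i)), X q ω) 1 := by
    rw [charFun_apply, charFun_apply_real, integral_map (h.measurable_scaledMean n).aemeasurable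
      (by fun_prop), integral_map (Finset.measurable_sum _ fun q _ => hXm q).aemeasurable
      (by fun_prop)]
    simp_rw [inner_scaledMean]
    simp [hX]
  rw [e1, iIndepFun.charFun_map_fun_finsetSum_eq_prod (fun q _ => (hXm q).aemeasurable)
    (hXi.restrict _)]
  rw [Finset.prod_apply, Finset.prod_sigma]
  refine Finset.prod_congr rfl fun i _ => Finset.prod_congr rfl fun k _ => ?_
  rw [charFun_map_mul_comp (hlin _ i k).aemeasurable, mul_one]

/-- The standard normal distribution on the space of vectors indexed by `ι`. -/
noncomputable abbrev stdNormal (ι : Type*) [Fintype ι] : Measure (ι → ℝ) :=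
  Measure.pi fun _ : ι => gaussianReal 0 1

open scoped MatrixOrder in
/-- The square root of a positive semidefinite matrix. -/
noncomputable def psdSqrt {ι : Type*} [Fintype ι] [DecidableEq ι] (S : Matrix ι ι ℝ) :
    Matrix ι ι ℝ := CFC.sqrt S

/-- Normal laws with different, even random, covariance matrices become images of one fixed law. All
later comparisons take place on that common space. -/
theorem multivariateGaussian_zero_eq_map {ι : Type*} [Fintype ι] [DecidableEq ι]
    (S : Matrix ι ι ℝ) : multivariateGaussian 0 S
      = (stdNormal ι).map fun x => WithLp.toLp 2 (psdSqrt S *ᵥ x) := by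
  rw [multivariateGaussian, ← map_pi_eq_stdGaussian, Measure.map_map (by fun_prop) (by fun_prop)]
  congr 1
  ext x : 1
  simp [Function.comp, psdSqrt, toEuclideanCLM_toLp]

theorem measurable_toLp_mulVec {ι : Type*} [Fintype ι] (R : Matrix ι ι ℝ) :
    Measurable fun x : ι → ℝ => WithLp.toLp 2 (R *ᵥ x) := by
  have : Continuous fun x : ι → ℝ => WithLp.toLp 2 (R *ᵥ x) :=
    (PiLp.continuous_toLp 2 _).comp (Continuous.matrix_mulVec continuous_const continuous_id)
  exact this.measurable

/-- Central limit theorem for the vector of group means. -/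
theorem ErrorModel.tendstoInDistribution (h : ErrorModel P eps Sg) {n : ℕ → Fin a → ℕ}
    {κ : Fin a → ℝ} (hn : GrowingSizes n κ) :
    TendstoInDistribution (fun t ω => scaledMean (n t) fun i k => eps i k ω) atTop
      (fun x => WithLp.toLp 2 (psdSqrt (limitCov κ Sg) *ᵥ x)) (fun _ => P)
      (stdNormal (Idx a d)) where
  forall_aemeasurable t := (h.measurable_scaledMean (n t)).aemeasurable
  aemeasurable_limit := (measurable_toLp_mulVec _).aemeasurable
  tendsto := by
    refine ProbabilityMeasure.tendsto_iff_tendsto_charFun.2 fun x => ?_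
    simp only [ProbabilityMeasure.coe_mk]
    rw [← multivariateGaussian_zero_eq_map, charFun_multivariateGaussian
      (h.posSemidef_limitCov hn.pos)]
    simp_rw [h.charFun_scaledMean]
    set s : Fin a → ℕ → ℝ := fun i t => √(total (n t) : ℝ) * (n t i : ℝ)⁻¹ with hs
    -- `n_i * s_i ^ 2 = N / n_i`; for an empty group both sides are zero by the convention for
    -- inverses.
    have h1 : ∀ i, Tendsto (fun t => (n t i : ℝ) * s i t ^ 2) atTop (𝓝 (κ i)⁻¹) := by
      intro i
      refine (hn.inv_ratio i).congr fun t => ?_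
      rw [hs, mul_pow, Real.sq_sqrt (Nat.cast_nonneg _)]
      rcases eq_or_ne (n t i : ℝ) 0 with h0 | h0
      · simp [h0]
      · field_simp
    have h2 : ∀ i, Tendsto (s i) atTop (𝓝 0) := by
      intro i
      have h3 : Tendsto (fun t => s i t ^ 2) atTop (𝓝 0) := by
        have := (h1 i).mul (tendsto_inv_atTop_zero.comp (hn.tendsto_real i))
        rw [mul_zero] at this
        refine this.congr' ?_
        filter_upwards [(hn.tendsto_real i).eventually_gt_atTop 0] with t ht
        simp only [Function.comp]
        field_simp
      have h4 := (Real.continuous_sqrt.tendsto 0).comp h3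
      rw [Real.sqrt_zero] at h4
      refine h4.congr fun t => ?_
      exact Real.sqrt_sq (by positivity)
    have h3 := tendsto_finsetProd (Finset.univ : Finset (Fin a)) fun i _ =>
      tendsto_prod_charFun (P := P) (fun k => h.memLp_linear (fun j => x.ofLp (i, j)) i k)
        (fun k => by
          simp only [dotProduct]
          rw [integral_finsetSum _ fun j _ => ((h.sq i k j).integrable (by norm_num)).const_mul _]
          simp [integral_const_mul, h.mean])
        (fun k => h.integral_linear_sq (fun j => x.ofLp (i, j)) i k)
        (fun k s => h.lindeberg_le (fun j => x.ofLp (i, j)) i k s)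
        (h2 i) (h.tendsto_lindeberg_bound _ i (h2 i)) (h1 i)
    convert h3 using 2
    rw [← Complex.exp_sum, limitCov, directSum_quadratic, inner_zero_right]
    congr 1
    simp only [smul_mulVec, dotProduct_smul, smul_eq_mul]
    push_cast
    rw [Finset.sum_neg_distrib, Finset.sum_div]
    ring

end CentralLimit

/-! ### Weak law of large numbers by truncation -/

section WeakLaw

variable {Ω : Type*} [MeasurableSpace Ω] {P : Measure Ω} [IsProbabilityMeasure P]

/-- Truncation of a real number at level `K`. -/
noncomputable def cutoff (K x : ℝ) : ℝ := if |x| ≤ K then x else 0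

theorem measurable_cutoff (K : ℝ) : Measurable (cutoff K) :=
  Measurable.ite (measurableSet_le (by fun_prop) measurable_const) measurable_id measurable_const

theorem abs_cutoff_le {K : ℝ} (hK : 0 ≤ K) (x : ℝ) : |cutoff K x| ≤ K := by
  unfold cutoff
  split_ifs with h
  · exact h
  · simpa using hK

/-- The part of `|x|` that is removed by the truncation at `K`. -/
noncomputable def excess (K x : ℝ) : ℝ := if K < |x| then |x| else 0

theorem measurable_excess (K : ℝ) : Measurable (excess K) :=
  Measurable.ite (measurableSet_lt measurable_const (by fun_prop)) (by fun_prop) measurable_const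

theorem abs_sub_cutoff (K x : ℝ) : |x - cutoff K x| = excess K x := by
  unfold cutoff excess
  by_cases h : |x| ≤ K
  · simp [h, not_lt.2 h]
  · simp [h, not_le.1 h]

theorem excess_nonneg (K x : ℝ) : 0 ≤ excess K x := by
  rw [← abs_sub_cutoff]; exact abs_nonneg _

theorem excess_le (K x : ℝ) : excess K x ≤ |x| := by
  unfold excess
  split_ifs
  · exact le_rfl
  · exact abs_nonneg x

/-- `|x * y|` is at most the larger of the two squares, and `excess K` is monotone in the absolute
value. Hence uniform integrability of products follows from that of the squared components. -/
theorem excess_mul_le (K x y : ℝ) : excess K (x * y) ≤ excess K (x ^ 2) + excess K (y ^ 2) := by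
  have key : ∀ u v : ℝ, |u| ≤ |v| → excess K (u * v) ≤ excess K (v ^ 2) := by
    intro u v h
    have h1 : |u * v| ≤ |v ^ 2| := by
      rw [abs_mul, abs_pow, sq]
      exact mul_le_mul_of_nonneg_right h (abs_nonneg v)
    unfold excess
    split_ifs with h2 h3 h3
    · exact h1
    · exact absurd (h2.trans_le h1) h3
    · exact abs_nonneg _
    · exact le_rfl
  rcases le_total |x| |y| with h | h
  · have := key x y h
    have := excess_nonneg K (x ^ 2)
    linarith
  · have := key y x h
    rw [mul_comm] at this
    have := excess_nonneg K (y ^ 2)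
    linarith

omit [IsProbabilityMeasure P] in
theorem integrable_excess {U : Ω → ℝ} (hU : Integrable U P) (K : ℝ) :
    Integrable (fun ω => excess K (U ω)) P := by
  refine hU.mono ((measurable_excess K).comp_aemeasurable
    hU.aestronglyMeasurable.aemeasurable).aestronglyMeasurable (Eventually.of_forall fun ω => ?_)
  rw [Real.norm_of_nonneg (excess_nonneg _ _)]
  exact excess_le _ _

omit [IsProbabilityMeasure P] in
theorem tendsto_integral_excess {U : Ω → ℝ} (hU : Integrable U P) :
    Tendsto (fun K : ℕ => ∫ ω, excess K (U ω) ∂P) atTop (𝓝 0) := by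
  have h0 : (0 : ℝ) = ∫ _ω, (0 : ℝ) ∂P := by simp
  rw [h0]
  refine tendsto_integral_of_dominated_convergence (fun ω => |U ω|)
    (fun K => (integrable_excess hU K).aestronglyMeasurable) hU.abs
    (fun K => Eventually.of_forall fun ω => ?_) (Eventually.of_forall fun ω => ?_)
  · rw [Real.norm_of_nonneg (excess_nonneg _ _)]
    exact excess_le _ _
  · refine tendsto_const_nhds.congr' ?_
    filter_upwards [tendsto_natCast_atTop_atTop.eventually_ge_atTop |U ω|] with K hK
    simp [excess, not_lt.2 hK]

/-- After truncation at `K`, the removed parts cost `h` on average and the shift of the mean costs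
another `h`. The centred truncated average has variance at most `K ^ 2 / n` by pairwise
independence, and `|y| ≤ δ + y ^ 2 / δ` turns this into a bound in mean. -/
theorem integral_abs_average_sub_le {U : ℕ → Ω → ℝ} (hm : ∀ k, Measurable (U k))
    (hi : ∀ k, Integrable (U k) P) (hind : Pairwise fun k k' => IndepFun (U k) (U k') P)
    {m : ℝ} (hU : ∀ k, ∫ ω, U k ω ∂P = m) {K h δ : ℝ} (hK : 0 ≤ K) (hδ : 0 < δ)
    (hh : ∀ k, ∫ ω, excess K (U k ω) ∂P ≤ h) {n : ℕ} (hn : 0 < n) :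
    ∫ ω, |(n : ℝ)⁻¹ * ∑ k ∈ Finset.range n, U k ω - m| ∂P
      ≤ 2 * h + δ + δ⁻¹ * ((n : ℝ)⁻¹ * K ^ 2) := by
  have hn' : (0 : ℝ) < n := Nat.cast_pos.2 hn
  set V : ℕ → Ω → ℝ := fun k ω => cutoff K (U k ω) with hV
  have hVm : ∀ k, Measurable (V k) := fun k => (measurable_cutoff K).comp (hm k)
  have hV2 : ∀ k, MemLp (V k) 2 P := fun k =>
    MemLp.of_bound (hVm k).aestronglyMeasurable K
      (Eventually.of_forall fun ω => abs_cutoff_le hK _)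
  have hVi : ∀ k, Integrable (V k) P := fun k => (hV2 k).integrable (by norm_num)
  have hvar : Var[fun ω => ∑ k ∈ Finset.range n, V k ω; P] ≤ n * K ^ 2 := by
    have e := IndepFun.variance_sum (X := V) (μ := P) (s := Finset.range n) (fun k _ => hV2 k)
      (fun k _ k' _ hk => (hind hk).comp (measurable_cutoff K) (measurable_cutoff K))
    have e2 : (∑ k ∈ Finset.range n, V k) = fun ω => ∑ k ∈ Finset.range n, V k ω := by
      ext ω; simp
    rw [e2] at e
    rw [e]
    refine (Finset.sum_le_card_nsmul _ _ (K ^ 2) fun k _ => ?_).trans (by simp)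
    refine (variance_le_expectation_sq (hVm k).aestronglyMeasurable).trans ?_
    calc ∫ ω, (V k ^ 2) ω ∂P ≤ ∫ _ω, K ^ 2 ∂P := by
          refine integral_mono (hV2 k).integrable_sq (integrable_const _) fun ω => ?_
          exact sq_le_sq' (abs_le.1 (abs_cutoff_le hK _)).1 (abs_le.1 (abs_cutoff_le hK _)).2
      _ = K ^ 2 := by simp
  have hSm : MemLp (fun ω => ∑ k ∈ Finset.range n, V k ω) 2 P :=
    memLp_finsetSum _ fun k _ => hV2 k
  set S : Ω → ℝ := fun ω => ∑ k ∈ Finset.range n, V k ω with hS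
  have hSD : MemLp (fun ω => S ω - ∫ ω', S ω' ∂P) 2 P := hSm.sub (memLp_const _)
  have hES : |(n : ℝ)⁻¹ * ∫ ω, S ω ∂P - m| ≤ h := by
    rw [integral_finsetSum _ fun k _ => hVi k]
    have e : (n : ℝ)⁻¹ * ∑ k ∈ Finset.range n, ∫ ω, V k ω ∂P - m
        = (n : ℝ)⁻¹ * ∑ k ∈ Finset.range n, (∫ ω, V k ω ∂P - m) := by
      rw [Finset.sum_sub_distrib, Finset.sum_const, Finset.card_range, nsmul_eq_mul]
      field_simp
    rw [e, abs_mul, abs_of_pos (inv_pos.2 hn'), inv_mul_le_iff₀ hn']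
    refine (Finset.abs_sum_le_sum_abs _ _).trans ?_
    refine (Finset.sum_le_card_nsmul _ _ h fun k _ => ?_).trans (by simp)
    rw [← hU k, ← integral_sub (hVi k) (hi k)]
    refine (abs_integral_le_integral_abs).trans (le_trans (le_of_eq ?_) (hh k))
    exact integral_congr_ae (Eventually.of_forall fun ω => by
      simp only [hV]; rw [abs_sub_comm, abs_sub_cutoff])
  have hpt : ∀ ω, |(n : ℝ)⁻¹ * ∑ k ∈ Finset.range n, U k ω - m|
      ≤ (n : ℝ)⁻¹ * ∑ k ∈ Finset.range n, excess K (U k ω)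
        + (δ + δ⁻¹ * ((n : ℝ)⁻¹ ^ 2 * (S ω - ∫ ω', S ω' ∂P) ^ 2)) + h := by
    intro ω
    have e : (n : ℝ)⁻¹ * ∑ k ∈ Finset.range n, U k ω - m
        = (n : ℝ)⁻¹ * ∑ k ∈ Finset.range n, (U k ω - V k ω)
          + (n : ℝ)⁻¹ * (S ω - ∫ ω', S ω' ∂P) + ((n : ℝ)⁻¹ * ∫ ω', S ω' ∂P - m) := by
      rw [Finset.sum_sub_distrib, hS]; ring
    rw [e]
    refine (abs_add_three _ _ _).trans (add_le_add (add_le_add ?_ ?_) hES)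
    · rw [abs_mul, abs_of_pos (inv_pos.2 hn')]
      refine mul_le_mul_of_nonneg_left ((Finset.abs_sum_le_sum_abs _ _).trans ?_)
        (inv_pos.2 hn').le
      exact Finset.sum_le_sum fun k _ => (abs_sub_cutoff _ _).le
    · rw [← mul_pow]
      set y := (n : ℝ)⁻¹ * (S ω - ∫ ω', S ω' ∂P)
      have h1 : 0 ≤ (|y| - δ) ^ 2 := sq_nonneg _
      have h2 : |y| ^ 2 = y ^ 2 := sq_abs y
      have h3 : |y| * δ ≤ δ ^ 2 + y ^ 2 := by nlinarith [abs_nonneg y, mul_nonneg (abs_nonneg y) hδ.le]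
      have h4 : δ + δ⁻¹ * y ^ 2 = (δ ^ 2 + y ^ 2) / δ := by field_simp
      rw [h4, le_div_iff₀ hδ]
      exact h3
  have hi1 : Integrable (fun ω => (n : ℝ)⁻¹ * ∑ k ∈ Finset.range n, excess K (U k ω)) P :=
    (integrable_finsetSum _ fun k _ => integrable_excess (hi k) K).const_mul _
  have hi2 : Integrable
      (fun ω => δ⁻¹ * ((n : ℝ)⁻¹ ^ 2 * (S ω - ∫ ω', S ω' ∂P) ^ 2)) P :=
    (hSD.integrable_sq.const_mul _).const_mul _
  refine (integral_mono (((integrable_finsetSum _ fun k _ => hi k).const_mul _).sub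
    (integrable_const _)).abs ((hi1.add ((integrable_const _).add hi2)).add (integrable_const _))
    hpt).trans ?_
  simp only [Pi.add_apply]
  have e := integral_add (hi1.add ((integrable_const δ).add hi2)) (integrable_const (μ := P) h)
  simp only [Pi.add_apply] at e
  rw [e]
  have e := integral_add hi1 ((integrable_const δ).add hi2)
  simp only [Pi.add_apply] at e
  rw [e, integral_add (integrable_const δ) hi2, integral_const_mul, integral_const_mul,
    integral_const_mul, integral_finsetSum _ fun k _ => integrable_excess (hi k) K,
    ← variance_eq_integral hSm.aestronglyMeasurable.aemeasurable]
  have b1 : (n : ℝ)⁻¹ * ∑ k ∈ Finset.range n, ∫ ω, excess K (U k ω) ∂P ≤ h := by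
    rw [inv_mul_le_iff₀ hn']
    exact (Finset.sum_le_card_nsmul _ _ h fun k _ => hh k).trans (by simp)
  have b2 : (n : ℝ)⁻¹ ^ 2 * Var[S; P] ≤ (n : ℝ)⁻¹ * K ^ 2 := by
    refine (mul_le_mul_of_nonneg_left hvar (by positivity)).trans (le_of_eq ?_)
    field_simp
  have b3 := mul_le_mul_of_nonneg_left b2 (inv_pos.2 hδ).le
  simp only [integral_const, probReal_univ, one_smul]
  linarith

/-- Weak law of large numbers for pairwise independent uniformly integrable variables with common
mean. -/
theorem convProb_average {U : ℕ → Ω → ℝ} (hm : ∀ k, Measurable (U k))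
    (hi : ∀ k, Integrable (U k) P) (hind : Pairwise fun k k' => IndepFun (U k) (U k') P)
    {m : ℝ} (hU : ∀ k, ∫ ω, U k ω ∂P = m) {h : ℕ → ℝ}
    (hh : ∀ (K : ℕ) k, ∫ ω, excess K (U k ω) ∂P ≤ h K) (hh0 : Tendsto h atTop (𝓝 0)) :
    ConvProb P (fun n ω => (n : ℝ)⁻¹ * ∑ k ∈ Finset.range n, U k ω) m := by
  have hint : ∀ n : ℕ, Integrable (fun ω => (n : ℝ)⁻¹ * ∑ k ∈ Finset.range n, U k ω - m) P :=
    fun n => ((integrable_finsetSum _ fun k _ => hi k).const_mul _).sub (integrable_const _)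
  have hL : Tendsto (fun n : ℕ => ∫ ω, |(n : ℝ)⁻¹ * ∑ k ∈ Finset.range n, U k ω - m| ∂P)
      atTop (𝓝 0) := by
    refine Metric.tendsto_atTop'.2 fun ε hε => ?_
    -- With `δ = ε / 3`, each of the three terms of the bound stays within `ε / 3`: `2 * h K` by
    -- this choice of `K`, the variance term for large `n`.
    obtain ⟨K, hK⟩ := (hh0.eventually_lt_const (show (0 : ℝ) < ε / 6 by positivity)).exists
    have h1 : Tendsto (fun n : ℕ => (ε / 3)⁻¹ * ((n : ℝ)⁻¹ * (K : ℝ) ^ 2)) atTop (𝓝 0) := by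
      have := ((tendsto_inv_atTop_zero.comp (tendsto_natCast_atTop_atTop (R := ℝ))).mul_const
        ((K : ℝ) ^ 2)).const_mul (ε / 3)⁻¹
      simpa using this
    obtain ⟨n₀, hn₀⟩ := eventually_atTop.1 (h1.eventually_lt_const
      (show (0 : ℝ) < ε / 3 by positivity))
    refine ⟨n₀, fun n hn => ?_⟩
    have b := integral_abs_average_sub_le hm hi hind hU (Nat.cast_nonneg K)
      (show (0 : ℝ) < ε / 3 by positivity) (hh K) (show 0 < n by omega)
    have b2 := hn₀ n hn.le
    rw [Real.dist_eq, sub_zero, abs_of_nonneg (integral_nonneg fun ω => abs_nonneg _)]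
    linarith
  rw [convProb_iff_tendstoInMeasure, tendstoInMeasure_iff_measureReal_norm]
  intro ε hε
  have hL' := hL.const_mul ε⁻¹
  rw [mul_zero] at hL'
  refine squeeze_zero (fun _ => measureReal_nonneg) (fun n => ?_) hL'
  have := mul_meas_ge_le_integral_of_nonneg (μ := P)
    (Eventually.of_forall fun ω => abs_nonneg _) (hint n).abs ε
  rw [le_inv_mul_iff₀ hε]
  simpa [Real.norm_eq_abs] using this

end WeakLaw

/-! ### Consistency of the empirical covariance matrix -/

section Covariance

variable {Ω : Type*} [MeasurableSpace Ω] {P : Measure Ω} [IsProbabilityMeasure P] {a d : ℕ}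
  {eps : Fin a → ℕ → Ω → Fin d → ℝ} {Sg : Fin a → Matrix (Fin d) (Fin d) ℝ}

/-- The products of two components share their mean but need not share their law, so a strong law
for identical distributions does not apply. The excess of the squares at observation `0` bounds that
of the products for every `k`. -/
theorem ErrorModel.convProb_average_mul (h : ErrorModel P eps Sg) (i j j') :
    ConvProb P (fun n ω => (n : ℝ)⁻¹ * ∑ k ∈ Finset.range n, eps i k ω j * eps i k ω j')
      (Sg i j j') := by
  have hsq : ∀ k j, Integrable (fun ω => eps i k ω j ^ 2) P := fun k j => (h.sq i k j).integrable_sq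
  refine convProb_average (h := fun K => ∫ ω, excess K (eps i 0 ω j ^ 2) ∂P
      + ∫ ω, excess K (eps i 0 ω j' ^ 2) ∂P)
    (fun k => (h.measurable_coord i k j).mul (h.measurable_coord i k j'))
    (fun k => h.integrable_mul i k j j') (fun k k' hk => ?_) (fun k => h.integral_mul i k j j')
    (fun K k => ?_) ?_
  · have hne : ((i, k) : Fin a × ℕ) ≠ (i, k') := fun he => hk (Prod.mk.inj he).2
    exact (h.indep.indepFun hne).comp (φ := fun y : Fin d → ℝ => y j * y j')
      (ψ := fun y : Fin d → ℝ => y j * y j') (by fun_prop) (by fun_prop)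
  · have e : ∀ j, ∫ ω, excess K (eps i 0 ω j ^ 2) ∂P = ∫ ω, excess K (eps i k ω j ^ 2) ∂P :=
      fun j => ((h.ident i 0 k j).comp (u := fun y : ℝ => excess K (y ^ 2))
        ((measurable_excess K).comp (by fun_prop))).integral_eq
    rw [e, e, ← integral_add (integrable_excess (hsq k j) K) (integrable_excess (hsq k j') K)]
    exact integral_mono (integrable_excess (h.integrable_mul i k j j') K)
      ((integrable_excess (hsq k j) K).add (integrable_excess (hsq k j') K))
      fun ω => excess_mul_le _ _ _
  · simpa using (tendsto_integral_excess (hsq 0 j)).add (tendsto_integral_excess (hsq 0 j'))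

theorem ErrorModel.convProb_average (h : ErrorModel P eps Sg) (i j) :
    ConvProb P (fun n ω => (n : ℝ)⁻¹ * ∑ k ∈ Finset.range n, eps i k ω j) 0 := by
  refine convProb_of_ae_tendsto (fun n => (Finset.measurable_sum _ fun k _ =>
    h.measurable_coord i k j).const_mul _) ?_
  have := strong_law_ae_real (μ := P) (fun k ω => eps i k ω j)
    ((h.sq i 0 j).integrable (by norm_num)) (fun k k' hk => ?_) (fun k => h.ident i k 0 j)
  · rw [h.mean] at this
    filter_upwards [this] with ω hω
    exact hω.congr fun n => by rw [div_eq_inv_mul]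
  · have hne : ((i, k) : Fin a × ℕ) ≠ (i, k') := fun he => hk (Prod.mk.inj he).2
    exact (h.indep.indepFun hne).comp (measurable_pi_apply j) (measurable_pi_apply j)

theorem groupMean_add {n : ℕ} (hn : 0 < n) (m : Fin d → ℝ) (e : ℕ → Fin d → ℝ) (j : Fin d) :
    groupMean n (fun k j => m j + e k j) j = m j + groupMean n e j := by
  have hn' : (n : ℝ) ≠ 0 := Nat.cast_ne_zero.2 hn.ne'
  simp only [groupMean, Finset.sum_add_distrib, Finset.sum_const, Finset.card_range, nsmul_eq_mul]
  field_simp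

/-- The expectation cancels, which leaves averages of errors and of their products, up to the factor
`n / (n - 1)`. -/
theorem groupCov_add {n : ℕ} (hn : 0 < n) (m : Fin d → ℝ) (e : ℕ → Fin d → ℝ) (j j' : Fin d) :
    groupCov n (fun k j => m j + e k j) j j' = ((n : ℝ) - 1)⁻¹ * n *
      ((n : ℝ)⁻¹ * ∑ k ∈ Finset.range n, e k j * e k j'
        - ((n : ℝ)⁻¹ * ∑ k ∈ Finset.range n, e k j) * ((n : ℝ)⁻¹ * ∑ k ∈ Finset.range n, e k j')) := by
  have hn' : (n : ℝ) ≠ 0 := Nat.cast_ne_zero.2 hn.ne'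
  simp only [groupCov, of_apply, groupMean_add hn]
  rw [mul_assoc]
  congr 1
  have e1 : ∀ k, (m j + e k j - (m j + groupMean n e j)) * (m j' + e k j' - (m j' + groupMean n e j'))
      = e k j * e k j' - groupMean n e j * e k j' - e k j * groupMean n e j'
        + groupMean n e j * groupMean n e j' := fun k => by ring
  rw [Finset.sum_congr rfl fun k _ => e1 k]
  rw [Finset.sum_add_distrib, Finset.sum_sub_distrib, Finset.sum_sub_distrib, ← Finset.mul_sum,
    ← Finset.sum_mul, Finset.sum_const, Finset.card_range, nsmul_eq_mul, groupMean, groupMean]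
  field_simp
  ring

theorem posSemidef_groupCov (n : ℕ) (x : ℕ → Fin d → ℝ) : (groupCov n x).PosSemidef := by
  refine posSemidef_iff_dotProduct_mulVec.2 ⟨?_, fun y => ?_⟩
  · ext j j'
    simp only [conjTranspose_apply, groupCov, of_apply, star_trivial]
    congr 1
    exact Finset.sum_congr rfl fun k _ => mul_comm _ _
  -- For `n = 0` the prefactor is `-1`, but the sum is empty; for `n = 1` the prefactor is `0⁻¹ =
  -- 0`.
  · rcases Nat.eq_zero_or_pos n with rfl | hn
    · simp [groupCov, mulVec, dotProduct]
    have e : star y ⬝ᵥ (groupCov n x *ᵥ y) = ((n : ℝ) - 1)⁻¹ *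
        ∑ k ∈ Finset.range n, (∑ j, y j * (x k j - groupMean n x j)) ^ 2 := by
      simp only [star_trivial, dotProduct, mulVec, groupCov, of_apply, _root_.sq, Finset.sum_mul_sum]
      simp only [Finset.mul_sum, Finset.sum_mul]
      conv_rhs => rw [Finset.sum_comm]
      refine Finset.sum_congr rfl fun j _ => ?_
      conv_rhs => rw [Finset.sum_comm]
      refine Finset.sum_congr rfl fun j' _ => Finset.sum_congr rfl fun k _ => by ring
    rw [e]
    have : (1 : ℝ) ≤ n := by exact_mod_cast hn
    exact mul_nonneg (inv_nonneg.2 (by linarith)) (Finset.sum_nonneg fun k _ => sq_nonneg _)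

theorem posSemidef_empCov (n : Fin a → ℕ) (x : Fin a → ℕ → Fin d → ℝ) :
    (empCov n x).PosSemidef :=
  (posSemidef_directSum fun i => (posSemidef_groupCov (n i) (x i)).smul
    (inv_nonneg.2 (Nat.cast_nonneg _))).smul (Nat.cast_nonneg _)

theorem ErrorModel.convProb_groupCov (h : ErrorModel P eps Sg) (mean : Fin a → Fin d → ℝ) (i j j') :
    ConvProb P (fun n ω => groupCov n (fun k => obs mean eps i k ω) j j') (Sg i j j') := by
  have h1 : Tendsto (fun n : ℕ => ((n : ℝ) - 1)⁻¹ * n) atTop (𝓝 1) := by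
    have := tendsto_natCast_div_add_atTop (𝕜 := ℝ) (-1)
    refine this.congr fun n => ?_
    rw [div_eq_inv_mul, sub_eq_add_neg]
  have h2 := (convProb_of_tendsto (P := P) h1).prodMk ((h.convProb_average_mul i j j').prodMk
    ((h.convProb_average i j).prodMk (h.convProb_average i j')))
  have h3 := h2.comp_continuousAt (f := fun z : ℝ × ℝ × ℝ × ℝ => z.1 * (z.2.1 - z.2.2.1 * z.2.2.2))
    (by fun_prop)
  simp only [mul_zero, sub_zero, one_mul] at h3
  refine h3.congr ?_
  filter_upwards [eventually_gt_atTop 0] with n hn ω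
  exact (groupCov_add hn (mean i) (fun k => eps i k ω) j j').symm

/-- Consistency of the empirical covariance matrix. -/
theorem ErrorModel.convProb_empCov (h : ErrorModel P eps Sg) (mean : Fin a → Fin d → ℝ)
    {n : ℕ → Fin a → ℕ} {κ : Fin a → ℝ} (hn : GrowingSizes n κ) :
    ConvProb P (fun t ω => empCov (n t) fun i k => obs mean eps i k ω) (limitCov κ Sg) := by
  refine ConvProb.matrix fun p q => ?_
  by_cases hpq : p.1 = q.1
  · have h1 := (convProb_of_tendsto (P := P) (hn.inv_ratio p.1)).prodMk
      ((h.convProb_groupCov mean p.1 p.2 q.2).comp_tendsto (hn.tendsto_group p.1))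
    have h2 := h1.comp_continuousAt (f := fun z : ℝ × ℝ => z.1 * z.2) (by fun_prop)
    simp only [limitCov, directSum, of_apply, hpq, if_true, Matrix.smul_apply, smul_eq_mul] at h2 ⊢
    refine h2.congr (Eventually.of_forall fun t ω => ?_)
    simp only [empCov, directSum, Matrix.smul_apply, of_apply, hpq, if_true, smul_eq_mul, mul_assoc]
  · have h1 := convProb_of_tendsto (P := P) (tendsto_const_nhds (x := (0 : ℝ)) (f := atTop))
    simp only [limitCov, directSum, of_apply, hpq, if_false]
    refine h1.congr (Eventually.of_forall fun t ω => ?_)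
    simp [empCov, directSum, hpq]

end Covariance

/-! ### Quadratic forms of a standard normal vector have no atoms -/

section QuadraticForms

variable {ι : Type*} [Fintype ι]

/-- The quadratic form of a matrix. -/
def quad (A : Matrix ι ι ℝ) (x : ι → ℝ) : ℝ := x ⬝ᵥ (A *ᵥ x)

theorem continuous_quad : Continuous fun p : Matrix ι ι ℝ × (ι → ℝ) => quad p.1 p.2 :=
  continuous_snd.dotProduct (continuous_fst.matrix_mulVec continuous_snd)

theorem continuous_quad_right (A : Matrix ι ι ℝ) : Continuous (quad A) :=
  continuous_quad.comp (by fun_prop : Continuous fun x : ι → ℝ => (A, x))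

theorem quad_smul (A : Matrix ι ι ℝ) (t : ℝ) (x : ι → ℝ) : quad A (t • x) = t ^ 2 * quad A x := by
  simp only [quad, mulVec_smul, smul_dotProduct, dotProduct_smul, smul_eq_mul]
  ring

theorem quad_nonneg {A : Matrix ι ι ℝ} (hA : A.PosSemidef) (x : ι → ℝ) : 0 ≤ quad A x := by
  have := (posSemidef_iff_dotProduct_mulVec.1 hA).2 x
  rwa [star_trivial] at this

theorem quad_single [DecidableEq ι] (A : Matrix ι ι ℝ) (i : ι) : quad A (Pi.single i 1) = A i i := by
  simp [quad]

theorem exists_diag_pos {A : Matrix ι ι ℝ} (hA : A.PosSemidef) (h0 : A ≠ 0) : ∃ i, 0 < A i i := by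
  by_contra! h
  exact h0 (hA.trace_eq_zero_iff.1 (Finset.sum_eq_zero fun i _ => (h i).antisymm hA.diag_nonneg))

instance isOpenPosMeasure_gaussianReal : (gaussianReal 0 1).IsOpenPosMeasure :=
  (gaussianReal_absolutelyContinuous' 0 one_ne_zero).isOpenPosMeasure

omit [Fintype ι] in
theorem measurable_update_fst_snd [DecidableEq ι] (i : ι) :
    Measurable fun p : (ι → ℝ) × ℝ => Function.update p.1 i p.2 := by
  refine measurable_pi_lambda _ fun j => ?_
  by_cases hj : j = i
  · subst hj; simpa using measurable_snd
  · simpa only [Function.update_of_ne hj] using! (measurable_pi_apply j).comp measurable_fst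

/-- Replacing one coordinate by an independent copy does not change the law. By Fubini, null sets
can then be tested along lines parallel to a coordinate axis. -/
theorem map_update_stdNormal [DecidableEq ι] (i : ι) :
    ((stdNormal ι).prod (gaussianReal 0 1)).map (fun p => Function.update p.1 i p.2)
      = stdNormal ι := by
  have hm := measurable_update_fst_snd i
  symm
  refine Measure.pi_eq fun s hs => ?_
  rw [Measure.map_apply hm (MeasurableSet.univ_pi hs)]
  have e : (fun p : (ι → ℝ) × ℝ => Function.update p.1 i p.2) ⁻¹' Set.univ.pi s
      = Set.univ.pi (Function.update s i Set.univ) ×ˢ s i := by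
    ext p
    simp only [Set.mem_preimage, Set.mem_pi, Set.mem_univ, true_implies, Set.mem_prod]
    constructor
    · intro h
      refine ⟨fun j => ?_, by simpa using h i⟩
      by_cases hj : j = i
      · subst hj; simp
      · simpa [Function.update_of_ne hj] using h j
    · rintro ⟨h, hi⟩ j
      by_cases hj : j = i
      · subst hj; simpa using hi
      · simpa [Function.update_of_ne hj] using h j
  rw [e, Measure.prod_prod, Measure.pi_pi, ← Finset.mul_prod_erase _ _ (Finset.mem_univ i),
    ← Finset.mul_prod_erase _ (fun j => gaussianReal 0 1 (s j)) (Finset.mem_univ i), mul_comm]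
  simp only [Function.update_self, measure_univ, one_mul]
  congr 1
  exact Finset.prod_congr rfl fun j hj => by rw [Function.update_of_ne (Finset.ne_of_mem_erase hj)]

/-- A nonzero positive semidefinite matrix has a diagonal entry `A i i > 0`. Along the `i`-th axis
the form is a polynomial with leading term `A i i * t ^ 2`, so each such line meets the level set in
finitely many points. -/
theorem measure_quad_eq {A : Matrix ι ι ℝ} (hA : A.PosSemidef) (h0 : A ≠ 0) (y : ℝ) :
    stdNormal ι {x | quad A x = y} = 0 := by
  classical
  obtain ⟨i, hi⟩ := exists_diag_pos hA h0
  have hs : MeasurableSet {x | quad A x = y} :=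
    (isClosed_eq (continuous_quad_right A) continuous_const).measurableSet
  have hm := measurable_update_fst_snd i
  rw [← map_update_stdNormal i, Measure.map_apply hm hs, Measure.measure_prod_null (hm hs)]
  refine Eventually.of_forall fun x => ?_
  have hna := nullSingletonClass_gaussianReal (μ := 0) (v := 1) one_ne_zero
  refine Set.Finite.measure_zero ?_ _
  set z := Function.update x i 0 with hz
  set b := z ⬝ᵥ (A *ᵥ Pi.single i 1) + Pi.single i 1 ⬝ᵥ (A *ᵥ z) with hb
  have e : ∀ t, quad A (Function.update x i t) = quad A z + b * t + A i i * t ^ 2 := by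
    intro t
    have e1 : Function.update x i t = z + t • Pi.single i 1 := by
      ext j
      by_cases hj : j = i
      · subst hj; simp [hz]
      · simp [hz, hj]
    rw [e1, ← quad_single A i, hb]
    simp only [quad, mulVec_add, mulVec_smul, add_dotProduct, dotProduct_add, smul_dotProduct,
      dotProduct_smul, smul_eq_mul]
    ring
  set p : Polynomial ℝ := Polynomial.C (A i i) * Polynomial.X ^ 2 + Polynomial.C b * Polynomial.X
    + Polynomial.C (quad A z - y) with hp
  have hp0 : p ≠ 0 := by
    intro h
    have := congrArg (fun q => Polynomial.coeff q 2) h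
    exact hi.ne' (by simpa [hp, Polynomial.coeff_X, Polynomial.coeff_C] using this)
  refine (Polynomial.finite_setOfPred_isRoot hp0).subset fun t ht => ?_
  have ht' : quad A (Function.update x i t) = y := ht
  rw [e] at ht'
  simp only [Set.mem_ofPred_eq, Polynomial.IsRoot, hp, Polynomial.eval_add, Polynomial.eval_mul,
    Polynomial.eval_C, Polynomial.eval_pow, Polynomial.eval_X]
  linarith

theorem ae_quad_ne {A : Matrix ι ι ℝ} (hA : A.PosSemidef) (h0 : A ≠ 0) (y : ℝ) :
    ∀ᵐ x ∂(stdNormal ι), quad A x ≠ y := by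
  rw [ae_iff]
  simpa using measure_quad_eq hA h0 y

end QuadraticForms

/-! ### Joint exceedance probabilities of the limit forms -/

section Exceed

variable {ι : Type*} [Fintype ι] {L : ℕ}

/-- The probability that one of the quadratic forms with index in `T` of a standard normal vector
exceeds its threshold. -/
noncomputable def exceed (A : Fin L → Matrix ι ι ℝ) (T : Finset (Fin L)) (y : Fin L → ℝ) : ℝ :=
  (stdNormal ι).real {x | ∃ l ∈ T, y l < quad (A l) x}

theorem isOpen_exceed (A : Fin L → Matrix ι ι ℝ) (T : Finset (Fin L)) (y : Fin L → ℝ) :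
    IsOpen {x | ∃ l ∈ T, y l < quad (A l) x} := by
  have : {x | ∃ l ∈ T, y l < quad (A l) x} = ⋃ l ∈ T, {x | y l < quad (A l) x} := by
    ext; simp
  rw [this]
  exact isOpen_biUnion fun l _ => isOpen_lt continuous_const (continuous_quad_right _)

/-- Almost surely no form equals its threshold. At such a point all finitely many strict comparisons
persist near `(A, y)`, so the indicators converge almost everywhere. -/
theorem continuousAt_exceed (T : Finset (Fin L)) {A : Fin L → Matrix ι ι ℝ} {y : Fin L → ℝ}
    (hA : ∀ l, (A l).PosSemidef) (h0 : ∀ l, A l ≠ 0) :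
    ContinuousAt (fun p : (Fin L → Matrix ι ι ℝ) × (Fin L → ℝ) => exceed p.1 T p.2) (A, y) := by
  have hfc : FirstCountableTopology (Matrix ι ι ℝ) :=
    inferInstanceAs (FirstCountableTopology (ι → ι → ℝ))
  refine (ENNReal.tendsto_toReal (measure_ne_top _ _)).comp ?_
  refine tendsto_measure_of_ae_tendsto_indicator_of_isFiniteMeasure _
    (isOpen_exceed A T y).measurableSet (fun p => (isOpen_exceed p.1 T p.2).measurableSet) ?_
  have hne : ∀ᵐ x ∂(stdNormal ι), ∀ l, quad (A l) x ≠ y l :=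
    ae_all_iff.2 fun l => ae_quad_ne (hA l) (h0 l) (y l)
  filter_upwards [hne] with x hx
  have hev : ∀ l, ∀ᶠ p : (Fin L → Matrix ι ι ℝ) × (Fin L → ℝ) in 𝓝 (A, y),
      (p.2 l < quad (p.1 l) x ↔ y l < quad (A l) x) := by
    intro l
    have c1 : Continuous fun p : (Fin L → Matrix ι ι ℝ) × (Fin L → ℝ) => quad (p.1 l) x :=
      continuous_quad.comp (g := fun q : Matrix ι ι ℝ × (ι → ℝ) => quad q.1 q.2)
        (f := fun p : (Fin L → Matrix ι ι ℝ) × (Fin L → ℝ) => (p.1 l, x))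
        (((continuous_apply l).comp continuous_fst).prodMk continuous_const)
    have c2 : Continuous fun p : (Fin L → Matrix ι ι ℝ) × (Fin L → ℝ) => p.2 l :=
      (continuous_apply l).comp continuous_snd
    rcases lt_or_gt_of_ne (hx l) with h | h
    · filter_upwards [c1.continuousAt.eventually_lt c2.continuousAt h] with p hp
      exact iff_of_false (not_lt.2 hp.le) (not_lt.2 h.le)
    · filter_upwards [c2.continuousAt.eventually_lt c1.continuousAt h] with p hp
      exact iff_of_true hp h
  filter_upwards [eventually_all.2 hev] with p hp
  simp only [hp]

theorem exceed_mono {A : Fin L → Matrix ι ι ℝ} {T T' : Finset (Fin L)} (hT : T ⊆ T')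
    (y : Fin L → ℝ) : exceed A T y ≤ exceed A T' y :=
  measureReal_mono fun _ ⟨l, hl, h⟩ => ⟨l, hT hl, h⟩

theorem exceed_anti {A : Fin L → Matrix ι ι ℝ} {T : Finset (Fin L)} {y y' : Fin L → ℝ}
    (hy : ∀ l ∈ T, y l ≤ y' l) : exceed A T y' ≤ exceed A T y :=
  measureReal_mono fun _ ⟨l, hl, h⟩ => ⟨l, hl, (hy l hl).trans_lt h⟩

theorem exceed_le_sum (A : Fin L → Matrix ι ι ℝ) (T : Finset (Fin L)) (y : Fin L → ℝ) :
    exceed A T y ≤ ∑ l ∈ T, exceed A {l} y := by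
  have : {x | ∃ l ∈ T, y l < quad (A l) x} = ⋃ l ∈ T, {x | ∃ l' ∈ ({l} : Finset (Fin L)),
      y l' < quad (A l') x} := by
    ext; simp
  rw [exceed, this]
  exact measureReal_biUnion_finset_le _ _

/-- Along a ray on which one form is positive, the maximum of `quad (A l) - m l` over `T` is
continuous, negative at the origin and nonnegative far out; a zero of it is the required point. -/
theorem exists_quad_mem_Ioo {A : Fin L → Matrix ι ι ℝ} (hA : ∀ l, (A l).PosSemidef)
    (h0 : ∀ l, A l ≠ 0) {T : Finset (Fin L)} (hT : T.Nonempty) {m : Fin L → ℝ}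
    (hm : ∀ l ∈ T, 0 < m l) :
    ∃ x, (∃ l ∈ T, quad (A l) x = m l) ∧ ∀ l ∈ T, quad (A l) x ≤ m l := by
  classical
  obtain ⟨l₀, hl₀⟩ := hT
  obtain ⟨i, hi⟩ := exists_diag_pos (hA l₀) (h0 l₀)
  set x₀ : ι → ℝ := Pi.single i 1
  have hx₀ : 0 < quad (A l₀) x₀ := by rw [quad_single]; exact hi
  set f : ℝ → ℝ := fun t => T.sup' ⟨l₀, hl₀⟩ fun l => quad (A l) (t • x₀) - m l with hf
  have hfc : Continuous f := by
    refine Continuous.finset_sup'_apply _ fun l _ => ?_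
    exact ((continuous_quad_right _).comp (by fun_prop)).sub continuous_const
  have hf0 : f 0 ≤ 0 := by
    refine Finset.sup'_le _ _ fun l hl => ?_
    rw [quad_smul]
    have := hm l hl
    linarith
  obtain ⟨t₁, ht₁0, ht₁⟩ : ∃ t : ℝ, 0 ≤ t ∧ m l₀ ≤ t ^ 2 * quad (A l₀) x₀ := by
    refine ⟨√(m l₀ / quad (A l₀) x₀), Real.sqrt_nonneg _, ?_⟩
    rw [Real.sq_sqrt (div_nonneg (hm l₀ hl₀).le hx₀.le)]
    field_simp
    exact le_rfl
  have hf1 : 0 ≤ f t₁ := by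
    refine le_trans ?_ (Finset.le_sup' (fun l => quad (A l) (t₁ • x₀) - m l) hl₀)
    rw [quad_smul]
    linarith
  obtain ⟨t, -, ht⟩ := intermediate_value_Icc ht₁0 hfc.continuousOn ⟨hf0, hf1⟩
  obtain ⟨l, hl, hle⟩ := Finset.exists_mem_eq_sup' ⟨l₀, hl₀⟩ fun l => quad (A l) (t • x₀) - m l
  refine ⟨t • x₀, ⟨l, hl, ?_⟩, fun l' hl' => ?_⟩
  · have : quad (A l) (t • x₀) - m l = 0 := by rw [← hle]; exact ht
    linarith
  · have : quad (A l') (t • x₀) - m l' ≤ 0 := by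
      rw [← ht]; exact Finset.le_sup' (fun l => quad (A l) (t • x₀) - m l) hl'
    linarith

/-- Midway between the two threshold vectors there is a point at which some `y l` is exceeded but no
`y' l`. The same holds on an open set, which has positive normal measure. -/
theorem exceed_strictAnti {A : Fin L → Matrix ι ι ℝ} (hA : ∀ l, (A l).PosSemidef)
    (h0 : ∀ l, A l ≠ 0) {T : Finset (Fin L)} (hT : T.Nonempty) {y y' : Fin L → ℝ}
    (hy0 : ∀ l ∈ T, 0 ≤ y l) (hy : ∀ l ∈ T, y l < y' l) : exceed A T y' < exceed A T y := by
  obtain ⟨x, ⟨l, hl, hxl⟩, hx⟩ := exists_quad_mem_Ioo hA h0 hT (m := fun l => (y l + y' l) / 2)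
    fun l hl => by have := hy0 l hl; have := hy l hl; linarith
  set W := {x | ∃ l ∈ T, y l < quad (A l) x} ∩ {x | ∀ l ∈ T, quad (A l) x < y' l} with hW
  have hWo : IsOpen W := by
    refine (isOpen_exceed A T y).inter ?_
    have : {x | ∀ l ∈ T, quad (A l) x < y' l} = ⋂ l ∈ T, {x | quad (A l) x < y' l} := by
      ext; simp
    rw [this]
    exact isOpen_biInter_finset fun l _ => isOpen_lt (continuous_quad_right _) continuous_const
  have hWne : W.Nonempty := by
    refine ⟨x, ⟨l, hl, ?_⟩, fun l' hl' => (hx l' hl').trans_lt ?_⟩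
    · have := hy l hl; linarith
    · have := hy l' hl'; linarith
  have hpos : 0 < (stdNormal ι).real W :=
    ENNReal.toReal_pos (hWo.measure_pos _ hWne).ne' (measure_ne_top _ _)
  have hdisj : Disjoint {x | ∃ l ∈ T, y' l < quad (A l) x} W := by
    rw [Set.disjoint_left]
    rintro x ⟨l, hl, h⟩ ⟨-, h'⟩
    exact lt_asymm h (h' l hl)
  have hun : exceed A T y' + (stdNormal ι).real W ≤ exceed A T y := by
    rw [exceed, ← measureReal_union hdisj hWo.measurableSet]
    refine measureReal_mono (Set.union_subset ?_ Set.inter_subset_left)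
    rintro x ⟨l, hl, h⟩
    exact ⟨l, hl, (hy l hl).trans h⟩
  linarith

theorem exceed_singleton_zero {A : Fin L → Matrix ι ι ℝ} (hA : ∀ l, (A l).PosSemidef)
    (h0 : ∀ l, A l ≠ 0) (l : Fin L) : exceed A {l} 0 = 1 := by
  rw [exceed, ← probReal_univ (μ := stdNormal ι)]
  refine measureReal_congr ?_
  have hne : ∀ᵐ x ∂(stdNormal ι), quad (A l) x ≠ 0 := ae_quad_ne (hA l) (h0 l) 0
  filter_upwards [hne] with x hx
  have : 0 < quad (A l) x := lt_of_le_of_ne (quad_nonneg (hA l) x) hx.symm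
  exact propext (iff_of_true ⟨l, by simp, this⟩ trivial)

theorem tendsto_exceed_singleton (A : Fin L → Matrix ι ι ℝ) (l : Fin L) :
    Tendsto (fun c : ℝ => exceed A {l} fun _ => c) atTop (𝓝 0) := by
  have hm : Measurable (quad (A l)) := (continuous_quad_right _).measurable
  have := Measure.isProbabilityMeasure_map (μ := stdNormal ι) hm.aemeasurable
  have h1 := (tendsto_cdf_atTop ((stdNormal ι).map (quad (A l)))).const_sub 1
  rw [sub_self] at h1
  refine h1.congr fun c => ?_
  rw [cdf_eq_real, ← probReal_compl_eq_one_sub measurableSet_Iic, map_measureReal_apply hm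
    measurableSet_Iic.compl, exceed]
  congr 1
  ext x
  simp

end Exceed

/-! ### Quantiles of the limit forms at a common level -/

section Quantiles

variable {ι : Type*} [Fintype ι] {L : ℕ}

/-- A function that picks, for levels in `(0, 1)`, the quantiles of the quadratic forms. -/
structure IsQuantileFn (A : Fin L → Matrix ι ι ℝ) (x : ℝ → Fin L → ℝ) : Prop where
  pos : ∀ u ∈ Set.Ioo (0 : ℝ) 1, ∀ l, 0 < x u l
  exceed_eq : ∀ u ∈ Set.Ioo (0 : ℝ) 1, ∀ l, exceed A {l} (x u) = 1 - u

variable {A : Fin L → Matrix ι ι ℝ}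

/-- The tail probability is continuous in the threshold, equals one at zero and vanishes at
infinity. As `1 - u < 1`, the threshold found is not zero. -/
theorem exists_isQuantileFn (hA : ∀ l, (A l).PosSemidef) (h0 : ∀ l, A l ≠ 0) :
    ∃ x, IsQuantileFn A x := by
  have key : ∀ u ∈ Set.Ioo (0 : ℝ) 1, ∀ l, ∃ c, 0 < c ∧ exceed A {l} (fun _ => c) = 1 - u := by
    intro u hu l
    have hc : Continuous fun c : ℝ => exceed A {l} fun _ => c := by
      refine continuous_iff_continuousAt.2 fun c => ?_
      exact (continuousAt_exceed {l} (y := fun _ => c) hA h0).comp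
        (f := fun c : ℝ => ((A, fun _ => c) : (Fin L → Matrix ι ι ℝ) × (Fin L → ℝ)))
        (by fun_prop)
    obtain ⟨c₁, hc₁, hc₁0⟩ := (((tendsto_exceed_singleton A l).eventually_lt_const
      (show 0 < 1 - u by linarith [hu.2])).and (eventually_ge_atTop 0)).exists
    have h1 : exceed A {l} (fun _ => (0 : ℝ)) = 1 := exceed_singleton_zero hA h0 l
    obtain ⟨c, hc, hce⟩ := intermediate_value_Icc' hc₁0 hc.continuousOn
      (show 1 - u ∈ Set.Icc _ _ from ⟨hc₁.le, by rw [h1]; linarith [hu.1]⟩)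
    refine ⟨c, lt_of_le_of_ne hc.1 fun h => ?_, hce⟩
    rw [← h] at hce
    simp only at hce
    rw [h1] at hce
    linarith [hu.1]
  choose! x hx using key
  exact ⟨x, fun u hu l => (hx u hu l).1, fun u hu l => by
    rw [← (hx u hu l).2]; simp [exceed]⟩

variable {x : ℝ → Fin L → ℝ}

theorem IsQuantileFn.strictMono (hx : IsQuantileFn A x) {u u' : ℝ} (hu : u ∈ Set.Ioo (0 : ℝ) 1)
    (hu' : u' ∈ Set.Ioo (0 : ℝ) 1) (h : u < u') (l) : x u l < x u' l := by
  by_contra! hle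
  have := exceed_anti (A := A) (T := {l}) (y := x u') (y' := x u) (by simpa using hle)
  rw [hx.exceed_eq u hu, hx.exceed_eq u' hu'] at this
  linarith

theorem IsQuantileFn.continuousOn (hx : IsQuantileFn A x) (hA : ∀ l, (A l).PosSemidef)
    (h0 : ∀ l, A l ≠ 0) : ContinuousOn x (Set.Ioo 0 1) := by
  refine continuousOn_pi.2 fun l => ?_
  intro u hu
  refine ContinuousAt.continuousWithinAt ?_
  have hstrict : ∀ c c' : ℝ, 0 ≤ c → c < c' →
      exceed A {l} (fun _ => c') < exceed A {l} fun _ => c := fun c c' h1 h2 =>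
    exceed_strictAnti hA h0 (Finset.singleton_nonempty l) (fun _ _ => h1) fun _ _ => h2
  have hdep : ∀ v, exceed A {l} (x v) = exceed A {l} fun _ => x v l := fun v => by simp [exceed]
  have hIoo : ∀ᶠ v in 𝓝 u, v ∈ Set.Ioo (0 : ℝ) 1 := isOpen_Ioo.mem_nhds hu
  refine tendsto_order.2 ⟨fun c hc => ?_, fun c hc => ?_⟩
  -- Strict decrease of the tail holds only from nonnegative thresholds; a negative `c` lies below
  -- every quantile anyway.
  · rcases lt_or_ge c 0 with hc0 | hc0
    · filter_upwards [hIoo] with v hv using hc0.trans (hx.pos v hv l)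
    · have h1 := hstrict c _ hc0 hc
      rw [← hdep, hx.exceed_eq u hu] at h1
      have h2 : ∀ᶠ v in 𝓝 u, 1 - v < exceed A {l} fun _ => c :=
        (continuous_const.sub continuous_id).continuousAt.eventually_lt_const h1
      filter_upwards [h2, hIoo] with v hv hv'
      by_contra! hle
      have := exceed_anti (A := A) (T := {l}) (y := x v) (y' := fun _ => c) (by simpa using hle)
      rw [hx.exceed_eq v hv'] at this
      linarith
  · have h1 := hstrict _ c (hx.pos u hu l).le hc
    rw [← hdep, hx.exceed_eq u hu] at h1
    have h2 : ∀ᶠ v in 𝓝 u, exceed A {l} (fun _ => c) < 1 - v :=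
      (continuous_const.sub continuous_id).continuousAt.eventually_const_lt h1
    filter_upwards [h2, hIoo] with v hv hv'
    by_contra! hle
    have := exceed_anti (A := A) (T := {l}) (y := fun _ => c) (y' := x v) (by simpa using hle)
    rw [hx.exceed_eq v hv'] at this
    linarith

theorem IsQuantileFn.continuousOn_exceed (hx : IsQuantileFn A x) (hA : ∀ l, (A l).PosSemidef)
    (h0 : ∀ l, A l ≠ 0) (T : Finset (Fin L)) :
    ContinuousOn (fun u => exceed A T (x u)) (Set.Ioo 0 1) := by
  intro u hu
  exact (continuousAt_exceed T (y := x u) hA h0).comp_continuousWithinAt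
    (f := fun u => ((A, x u) : (Fin L → Matrix ι ι ℝ) × (Fin L → ℝ)))
    (continuousWithinAt_const.prodMk (hx.continuousOn hA h0 u hu))

theorem IsQuantileFn.exceed_lt (hx : IsQuantileFn A x) (hA : ∀ l, (A l).PosSemidef)
    (h0 : ∀ l, A l ≠ 0) {T : Finset (Fin L)} (hT : T.Nonempty) {u u' : ℝ}
    (hu : u ∈ Set.Ioo (0 : ℝ) 1) (hu' : u' ∈ Set.Ioo (0 : ℝ) 1) (h : u < u') :
    exceed A T (x u') < exceed A T (x u) :=
  exceed_strictAnti hA h0 hT (fun l _ => (hx.pos u hu l).le)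
    fun l _ => hx.strictMono hu hu' h l

/-- The local level at which the family-wise error rate of the limit equals `α`. -/
theorem IsQuantileFn.exists_exceed_eq (hx : IsQuantileFn A x) (hA : ∀ l, (A l).PosSemidef)
    (h0 : ∀ l, A l ≠ 0) (hL : 1 ≤ L) {α : ℝ} (hα : α ∈ Set.Ioo (0 : ℝ) 1) :
    ∃ u ∈ Set.Ioo (0 : ℝ) 1, exceed A Finset.univ (x u) = α := by
  have hL' : (1 : ℝ) ≤ L := by exact_mod_cast hL
  have hd : α / L ≤ α := div_le_self hα.1.le hL'
  have hd0 : 0 < α / L := div_pos hα.1 (by linarith)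
  have h1 : (1 - α) ∈ Set.Ioo (0 : ℝ) 1 := ⟨by linarith [hα.2], by linarith [hα.1]⟩
  have h2 : (1 - α / L) ∈ Set.Ioo (0 : ℝ) 1 := ⟨by linarith [hα.2], by linarith⟩
  have hsub : Set.Icc (1 - α) (1 - α / L) ⊆ Set.Ioo 0 1 := fun u hu =>
    ⟨h1.1.trans_le hu.1, hu.2.trans_lt h2.2⟩
  -- Bonferroni bracket: at local level `α` one component alone reaches `α`, while at local level `α
  -- / L` the union bound stays below it.
  have b1 : α ≤ exceed A Finset.univ (x (1 - α)) := by
    have := exceed_mono (A := A) (Finset.subset_univ {(⟨0, hL⟩ : Fin L)}) (x (1 - α))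
    rw [hx.exceed_eq _ h1] at this
    linarith
  have b2 : exceed A Finset.univ (x (1 - α / L)) ≤ α := by
    refine (exceed_le_sum _ _ _).trans (le_of_eq ?_)
    rw [Finset.sum_congr rfl fun l _ => hx.exceed_eq _ h2 l]
    simp only [Finset.sum_const, Finset.card_univ, Fintype.card_fin, nsmul_eq_mul]
    field_simp
    ring
  obtain ⟨u, hu, hue⟩ := intermediate_value_Icc' (by linarith)
    ((hx.continuousOn_exceed hA h0 Finset.univ).mono hsub) ⟨b2, b1⟩
  exact ⟨u, hsub hu, hue⟩

end Quantiles

/-! ### Matrices of the statistics and of the simulated forms -/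

section FormMatrices

variable {ι κ : Type*} [Fintype ι] [DecidableEq ι] [Fintype κ]

theorem posSemidef_psdSqrt (S : Matrix ι ι ℝ) : (psdSqrt S).PosSemidef := by
  open scoped MatrixOrder in exact (CFC.sqrt_nonneg S).posSemidef

theorem psdSqrt_mul_self {S : Matrix ι ι ℝ} (hS : S.PosSemidef) : psdSqrt S * psdSqrt S = S := by
  open scoped MatrixOrder in exact CFC.sqrt_mul_sqrt_self S hS.nonneg

theorem transpose_psdSqrt (S : Matrix ι ι ℝ) : (psdSqrt S)ᵀ = psdSqrt S := by
  simpa [conjTranspose_eq_transpose_of_trivial] using (posSemidef_psdSqrt S).isHermitian.eq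

theorem continuousOn_psdSqrt : ContinuousOn (psdSqrt : Matrix ι ι ℝ → Matrix ι ι ℝ)
    {S | S.PosSemidef} := by
  open scoped MatrixOrder Matrix.Norms.L2Operator in
  have h : ContinuousOn (CFC.sqrt : Matrix ι ι ℝ → Matrix ι ι ℝ) {S | 0 ≤ S} :=
    CFC.continuousOn_sqrt
  refine h.mono fun S hS => ?_
  open scoped MatrixOrder in exact nonneg_iff_posSemidef.2 hS

theorem psdSqrt_of_not_posSemidef {S : Matrix ι ι ℝ} (hS : ¬ S.PosSemidef) : psdSqrt S = 0 := by
  open scoped MatrixOrder in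
  exact CFC.sqrt_of_not_nonneg fun h => hS (nonneg_iff_posSemidef.1 h)

/-- The denominator `2 tr([Cᵀ m C S]²)` of a quadratic form with weight matrix `m`. -/
def formVar (C : Matrix κ ι ℝ) (m : Matrix κ κ ℝ) (S : Matrix ι ι ℝ) : ℝ :=
  2 * ((Cᵀ * m * C * S) ^ 2).trace

/-- The matrix of the test statistic as a quadratic form of the scaled mean vector. -/
noncomputable def dataMat (C : Matrix κ ι ℝ) (m : Matrix κ κ ℝ) (S : Matrix ι ι ℝ) :
    Matrix ι ι ℝ :=
  if 0 < formVar C m S then (√(formVar C m S))⁻¹ • (Cᵀ * m * C) else 0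

/-- The matrix of the simulated quadratic form as a quadratic form of a standard normal vector. -/
noncomputable def mcMat (C : Matrix κ ι ℝ) (m : Matrix κ κ ℝ) (S : Matrix ι ι ℝ) :
    Matrix ι ι ℝ :=
  (√(formVar C m S))⁻¹ • (psdSqrt S * (Cᵀ * m * C) * psdSqrt S)

omit [DecidableEq ι] in
theorem quad_transpose_mul_mul (C : Matrix κ ι ℝ) (m : Matrix κ κ ℝ) (w : ι → ℝ) :
    quad (Cᵀ * m * C) w = (C *ᵥ w) ⬝ᵥ (m *ᵥ (C *ᵥ w)) := by
  rw [quad, Matrix.mul_assoc, ← mulVec_mulVec, ← mulVec_mulVec, dotProduct_mulVec,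
    vecMul_transpose]

omit [DecidableEq ι] in
theorem quad_smul_left (c : ℝ) (A : Matrix ι ι ℝ) (w : ι → ℝ) : quad (c • A) w = c * quad A w := by
  simp [quad, smul_mulVec]

theorem quad_psdSqrt_conj (S K : Matrix ι ι ℝ) (x : ι → ℝ) :
    quad (psdSqrt S * K * psdSqrt S) x = quad K (psdSqrt S *ᵥ x) := by
  rw [quad, quad, Matrix.mul_assoc, ← mulVec_mulVec, ← mulVec_mulVec, dotProduct_mulVec,
    ← mulVec_transpose, transpose_psdSqrt]

theorem posSemidef_mcMat (C : Matrix κ ι ℝ) {m : Matrix κ κ ℝ} (S : Matrix ι ι ℝ)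
    (hm : m.PosSemidef) : (mcMat C m S).PosSemidef := by
  have h1 := hm.conjTranspose_mul_mul_same C
  have h2 := h1.conjTranspose_mul_mul_same (psdSqrt S)
  rw [(posSemidef_psdSqrt S).isHermitian.eq] at h2
  rw [conjTranspose_eq_transpose_of_trivial] at h2
  exact h2.smul (inv_nonneg.2 (Real.sqrt_nonneg _))

/-- With `R = psdSqrt S`, one has `(K * S) ^ 2 = K * R * (R * K * R) * R`. If the middle factor
vanished, `K * S` would be nilpotent and could not have a nonzero eigenvalue. -/
theorem psdSqrt_conj_ne_zero {K S : Matrix ι ι ℝ} (hS : S.PosSemidef)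
    (h : ∃ ev : ℝ, ev ≠ 0 ∧ Module.End.HasEigenvalue (Matrix.toLin' (K * S)) ev) :
    psdSqrt S * K * psdSqrt S ≠ 0 := by
  intro h0
  obtain ⟨ev, hev, he⟩ := h
  obtain ⟨v, hv⟩ := he.exists_hasEigenvector
  have h1 : (K * S) *ᵥ v = ev • v := by simpa using hv.apply_eq_smul
  have h2 : (K * S) * (K * S) = 0 := by
    have : (K * S) * (K * S) = K * psdSqrt S * (psdSqrt S * K * psdSqrt S) * psdSqrt S := by
      nth_rewrite 1 2 [← psdSqrt_mul_self hS]
      simp only [Matrix.mul_assoc]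
    rw [this, h0]
    simp
  have h3 : (ev * ev) • v = 0 := by
    rw [← smul_smul, ← h1, ← mulVec_smul, ← h1, mulVec_mulVec, h2, zero_mulVec]
  rcases smul_eq_zero.1 h3 with h4 | h4
  · exact hev (mul_self_eq_zero.1 h4)
  · exact hv.2 h4

/-- By cyclicity the trace is that of `Y ^ 2` with the symmetric matrix `Y = psdSqrt S * K * psdSqrt
S`, that is, the squared Frobenius norm of a nonzero matrix. -/
theorem formVar_pos {C : Matrix κ ι ℝ} {m : Matrix κ κ ℝ} {S : Matrix ι ι ℝ} (hm : m.PosSemidef)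
    (hS : S.PosSemidef) (h : ∃ ev : ℝ, ev ≠ 0 ∧
      Module.End.HasEigenvalue (Matrix.toLin' (Cᵀ * m * C * S)) ev) : 0 < formVar C m S := by
  have h0 := psdSqrt_conj_ne_zero hS h
  set K := Cᵀ * m * C with hK
  set Y := psdSqrt S * K * psdSqrt S with hY
  have hYt : Yᴴ = Y := by
    have h1 := hm.conjTranspose_mul_mul_same C
    have h2 := h1.conjTranspose_mul_mul_same (psdSqrt S)
    rw [(posSemidef_psdSqrt S).isHermitian.eq, conjTranspose_eq_transpose_of_trivial] at h2
    exact h2.isHermitian.eq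
  have e : ((K * S) ^ 2).trace = (Yᴴ * Y).trace := by
    rw [hYt, pow_two, hY]
    have e1 : (K * S) * (K * S) = (K * psdSqrt S * psdSqrt S * K * psdSqrt S) * psdSqrt S := by
      nth_rewrite 1 2 [← psdSqrt_mul_self hS]
      simp only [Matrix.mul_assoc]
    rw [e1, trace_mul_comm]
    simp only [Matrix.mul_assoc]
  have hne : (Yᴴ * Y).trace ≠ 0 := fun h => h0 (trace_conjTranspose_mul_self_eq_zero_iff.1 h)
  have hnn : 0 ≤ (Yᴴ * Y).trace := (posSemidef_conjTranspose_mul_self Y).trace_nonneg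
  rw [formVar, e]
  have := lt_of_le_of_ne hnn hne.symm
  linarith

theorem mcMat_ne_zero {C : Matrix κ ι ℝ} {m : Matrix κ κ ℝ} {S : Matrix ι ι ℝ} (hm : m.PosSemidef)
    (hS : S.PosSemidef) (h : ∃ ev : ℝ, ev ≠ 0 ∧
      Module.End.HasEigenvalue (Matrix.toLin' (Cᵀ * m * C * S)) ev) : mcMat C m S ≠ 0 :=
  smul_ne_zero (inv_ne_zero (Real.sqrt_pos.2 (formVar_pos hm hS h)).ne')
    (psdSqrt_conj_ne_zero hS h)

/-- This links the two sides of the test: at the limiting covariance matrix, statistics and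
simulated forms are the same functions of the standard normal vector. -/
theorem quad_dataMat_psdSqrt {C : Matrix κ ι ℝ} {m : Matrix κ κ ℝ} {S : Matrix ι ι ℝ}
    (hv : 0 < formVar C m S) (x : ι → ℝ) :
    quad (dataMat C m S) (psdSqrt S *ᵥ x) = quad (mcMat C m S) x := by
  rw [dataMat, if_pos hv, mcMat, quad_smul_left, quad_smul_left, quad_psdSqrt_conj]

theorem continuous_formVar (C : Matrix κ ι ℝ) :
    Continuous fun p : Matrix κ κ ℝ × Matrix ι ι ℝ => formVar C p.1 p.2 := by
  unfold formVar
  fun_prop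

theorem continuousAt_inv_sqrt_formVar {C : Matrix κ ι ℝ} {m : Matrix κ κ ℝ} {S : Matrix ι ι ℝ}
    (hv : 0 < formVar C m S) : ContinuousAt
      (fun p : Matrix κ κ ℝ × Matrix ι ι ℝ => (√(formVar C p.1 p.2))⁻¹) (m, S) :=
  ContinuousAt.inv₀ (f := fun p : Matrix κ κ ℝ × Matrix ι ι ℝ => √(formVar C p.1 p.2))
    (continuous_formVar C).sqrt.continuousAt (Real.sqrt_pos.2 hv).ne'

theorem continuousAt_dataMat {C : Matrix κ ι ℝ} {m : Matrix κ κ ℝ} {S : Matrix ι ι ℝ}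
    (hv : 0 < formVar C m S) :
    ContinuousAt (fun p : Matrix κ κ ℝ × Matrix ι ι ℝ => dataMat C p.1 p.2) (m, S) := by
  have h2 : ContinuousAt (fun p : Matrix κ κ ℝ × Matrix ι ι ℝ => Cᵀ * p.1 * C) (m, S) :=
    Continuous.continuousAt (by fun_prop)
  refine ((continuousAt_inv_sqrt_formVar hv).smul h2).congr ?_
  filter_upwards [(continuous_formVar C).continuousAt.eventually_const_lt hv] with p hp
  rw [dataMat, if_pos hp]
  rfl

theorem continuousWithinAt_mcMat {C : Matrix κ ι ℝ} {m : Matrix κ κ ℝ} {S : Matrix ι ι ℝ}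
    (hS : S.PosSemidef) (hv : 0 < formVar C m S) :
    ContinuousWithinAt (fun p : Matrix κ κ ℝ × Matrix ι ι ℝ => mcMat C p.1 p.2)
      {p | p.2.PosSemidef} (m, S) := by
  have hs : ContinuousWithinAt (fun p : Matrix κ κ ℝ × Matrix ι ι ℝ => psdSqrt p.2)
      {p | p.2.PosSemidef} (m, S) :=
    (continuousOn_psdSqrt S hS).comp (f := fun p : Matrix κ κ ℝ × Matrix ι ι ℝ => p.2)
      continuous_snd.continuousWithinAt fun p hp => hp
  have h2 : Continuous fun q : Matrix ι ι ℝ × Matrix κ κ ℝ => q.1 * (Cᵀ * q.2 * C) * q.1 := by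
    fun_prop
  have h3 : ContinuousWithinAt (fun p : Matrix κ κ ℝ × Matrix ι ι ℝ =>
      psdSqrt p.2 * (Cᵀ * p.1 * C) * psdSqrt p.2) {p | p.2.PosSemidef} (m, S) :=
    h2.continuousAt.comp_continuousWithinAt
      (f := fun p : Matrix κ κ ℝ × Matrix ι ι ℝ => (psdSqrt p.2, p.1))
      (hs.prodMk continuous_fst.continuousWithinAt)
  exact (continuousAt_inv_sqrt_formVar hv).continuousWithinAt.smul h3

/-- The square root is continuous on the closed positive semidefinite cone and has the default value
zero outside it. -/
theorem measurable_psdSqrt : Measurable fun S : ι → ι → ℝ => fun i j => psdSqrt (of S) i j := by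
  classical
  have hcl : IsClosed {S : ι → ι → ℝ | (of S).PosSemidef} := by
    have e : {S : ι → ι → ℝ | (of S).PosSemidef}
        = {S | ∀ i j, S j i = S i j} ∩ {S | ∀ x, 0 ≤ x ⬝ᵥ (of S *ᵥ x)} := by
      ext S
      simp only [Set.mem_inter_iff, Set.mem_ofPred_eq, posSemidef_iff_dotProduct_mulVec,
        star_trivial, IsHermitian]
      refine and_congr ⟨fun h i j => ?_, fun h => ?_⟩ Iff.rfl
      · simpa using congrFun (congrFun h i) j
      · ext i j; simpa using h i j
    rw [e]
    refine IsClosed.inter ?_ ?_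
    · simp only [Set.ofPred_forall]
      exact isClosed_iInter fun i => isClosed_iInter fun j => isClosed_eq (by fun_prop) (by fun_prop)
    · simp only [Set.ofPred_forall]
      refine isClosed_iInter fun x => isClosed_le continuous_const ?_
      simp only [dotProduct, mulVec, of_apply]
      fun_prop
  have h1 : ContinuousOn (fun S : ι → ι → ℝ => fun i j => psdSqrt (of S) i j)
      {S | (of S).PosSemidef} :=
    continuousOn_psdSqrt.comp (f := fun S : ι → ι → ℝ => of S) (continuous_id).continuousOn
      fun S hS => hS
  have h2 := h1.measurable_piecewise (g := fun _ => 0) continuousOn_const hcl.measurableSet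
  convert h2 using 1
  ext S i j
  by_cases hS : S ∈ {S : ι → ι → ℝ | (of S).PosSemidef}
  · rw [Set.piecewise_eq_of_mem _ _ _ hS]
  · rw [Set.piecewise_eq_of_notMem _ _ _ hS, psdSqrt_of_not_posSemidef hS]
    rfl

end FormMatrices

/-! ### Statistics as quadratic forms -/

section Statistics

variable {a d k : ℕ}

theorem mcForm_eq_quad (M : WeightFn a d) (C : Matrix (Fin k) (Idx a d) ℝ)
    (S : Matrix (Idx a d) (Idx a d) ℝ) (x : Idx a d → ℝ) :
    mcForm M C S (WithLp.toLp 2 (psdSqrt S *ᵥ x)) = quad (mcMat C (M k C S) S) x := by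
  rw [mcMat, quad_smul_left, quad_psdSqrt_conj, quad_transpose_mul_mul, mcForm, div_eq_inv_mul]
  rfl

theorem testStat_eq_quad (M : WeightFn a d) {C : Matrix (Fin k) (Idx a d) ℝ} {b : Fin k → ℝ}
    {m : Idx a d → ℝ} (hb : C *ᵥ m = b) (N : ℕ) (xbar : Idx a d → ℝ)
    (S : Matrix (Idx a d) (Idx a d) ℝ) :
    testStat M C b N xbar S = quad (dataMat C (M k C S) S) (√(N : ℝ) • (xbar - m)) := by
  have e : quadVar M C S = formVar C (M k C S) S := rfl
  rw [testStat, dataMat, e]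
  split_ifs with h
  · rw [quad_smul, Real.sq_sqrt (Nat.cast_nonneg _), quad_smul_left, quad_transpose_mul_mul,
      mulVec_sub C, hb, div_eq_inv_mul]
  · simp [quad]

end Statistics

/-! ### Empirical quantiles and the selected local level -/

section EmpiricalQuantiles

variable {B L : ℕ}

theorem empCDF_mono (y : Fin B → ℝ) {x x' : ℝ} (h : x ≤ x') : empCDF y x ≤ empCDF y x' := by
  unfold empCDF
  gcongr

theorem empCDF_nonneg (y : Fin B → ℝ) (x : ℝ) : 0 ≤ empCDF y x := by
  unfold empCDF
  positivity

theorem exists_empCDF_eq_one (hB : 0 < B) (y : Fin B → ℝ) : ∃ x, empCDF y x = 1 := by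
  refine ⟨∑ b, |y b|, ?_⟩
  have : (Finset.univ.filter fun b => y b ≤ ∑ b, |y b|) = Finset.univ := by
    refine Finset.filter_true_of_mem fun b _ => (le_abs_self _).trans ?_
    exact Finset.single_le_sum (f := fun b => |y b|) (fun _ _ => abs_nonneg _) (Finset.mem_univ b)
  rw [empCDF, this, Finset.card_univ, Fintype.card_fin]
  exact div_self (Nat.cast_ne_zero.2 hB.ne')

theorem bddBelow_le_empCDF (y : Fin B → ℝ) {p : ℝ} (hp : 0 < p) :
    BddBelow {x | p ≤ empCDF y x} := by
  refine ⟨-∑ b, |y b|, fun x (hx : p ≤ empCDF y x) => ?_⟩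
  by_contra! h
  have : (Finset.univ.filter fun b => y b ≤ x) = ∅ := by
    refine Finset.filter_false_of_mem fun b _ => not_le.2 (h.trans_le ?_)
    have := Finset.single_le_sum (f := fun b => |y b|) (fun _ _ => abs_nonneg _) (Finset.mem_univ b)
    have := neg_abs_le (y b)
    linarith
  rw [empCDF, this] at hx
  simp at hx
  linarith

/-- `p ≤ 1` makes the set under the infimum nonempty, so the infimum is not the default value. -/
theorem le_empQuantile (hB : 0 < B) (y : Fin B → ℝ) {p x : ℝ} (hp : p ≤ 1) (h : empCDF y x < p) :
    x ≤ empQuantile y p := by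
  obtain ⟨z, hz⟩ := exists_empCDF_eq_one hB y
  refine le_csInf ⟨z, by rw [Set.mem_ofPred_eq, hz]; exact hp⟩ fun x' (hx' : p ≤ empCDF y x') => ?_
  by_contra! hlt
  exact absurd (hx'.trans (empCDF_mono y hlt.le)) (not_le.2 h)

theorem empQuantile_le (y : Fin B → ℝ) {p x : ℝ} (hp : 0 < p) (h : p ≤ empCDF y x) :
    empQuantile y p ≤ x :=
  csInf_le (bddBelow_le_empCDF y hp) h

open Classical in
/-- Proportion of the replicates that exceed one of the thresholds with index in `T`. -/
noncomputable def exceedFreq (q : Fin B → Fin L → ℝ) (T : Finset (Fin L)) (x : Fin L → ℝ) : ℝ :=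
  (Finset.univ.filter fun b => ∃ l ∈ T, x l < q b l).card / (B : ℝ)

theorem empCDF_eq_one_sub_exceedFreq (hB : 0 < B) (q : Fin B → Fin L → ℝ) (l : Fin L)
    (x : Fin L → ℝ) : empCDF (fun b => q b l) (x l) = 1 - exceedFreq q {l} x := by
  classical
  have hB' : (B : ℝ) ≠ 0 := Nat.cast_ne_zero.2 hB.ne'
  have h := Finset.card_filter_add_card_filter_not (s := (Finset.univ : Finset (Fin B)))
    (fun b => q b l ≤ x l)
  simp only [not_le, Finset.card_univ, Fintype.card_fin] at h
  have h' : ((Finset.univ.filter fun b => q b l ≤ x l).card : ℝ)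
      + ((Finset.univ.filter fun b => x l < q b l).card : ℝ) = B := by exact_mod_cast h
  unfold empCDF exceedFreq
  simp only [Finset.mem_singleton, exists_eq_left]
  field_simp
  linarith

theorem estFWER_le (q : Fin B → Fin L → ℝ) {γ : ℝ} {x : Fin L → ℝ}
    (h : ∀ l, x l ≤ empQuantile (fun b => q b l) (1 - γ)) :
    estFWER q γ ≤ exceedFreq q Finset.univ x := by
  classical
  unfold estFWER exceedFreq
  refine div_le_div_of_nonneg_right (Nat.cast_le.2 (Finset.card_le_card ?_)) (Nat.cast_nonneg _)
  intro b hb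
  simp only [Finset.mem_filter, Finset.mem_univ, true_and] at hb ⊢
  exact hb.imp fun l hl => (h l).trans_lt hl

theorem le_estFWER (q : Fin B → Fin L → ℝ) {γ : ℝ} {x : Fin L → ℝ}
    (h : ∀ l, empQuantile (fun b => q b l) (1 - γ) ≤ x l) :
    exceedFreq q Finset.univ x ≤ estFWER q γ := by
  classical
  unfold estFWER exceedFreq
  refine div_le_div_of_nonneg_right (Nat.cast_le.2 (Finset.card_le_card ?_)) (Nat.cast_nonneg _)
  intro b hb
  simp only [Finset.mem_filter, Finset.mem_univ, true_and] at hb ⊢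
  exact hb.imp fun l hl => (h l).trans_lt hl

/-- Bounds for the critical values, from bounds for exceedance frequencies at four thresholds. -/
theorem critValue_mem_Icc (hB : 0 < B) (q : Fin B → Fin L → ℝ) {α v w w' : ℝ}
    (hw0 : 0 < w) (hw1 : w < 1) (hww : w + (B : ℝ)⁻¹ ≤ w') {xa xb xc xd : Fin L → ℝ}
    (ha : ∀ l, 1 - exceedFreq q {l} xa < v) (hb : ∀ l, v ≤ 1 - exceedFreq q {l} xb)
    (hb' : α < exceedFreq q Finset.univ xb) (hc : ∀ l, 1 - exceedFreq q {l} xc < w)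
    (hc' : exceedFreq q Finset.univ xc ≤ α) (hd : ∀ l, w' ≤ 1 - exceedFreq q {l} xd) (l : Fin L) :
    critValue q α l ∈ Set.Icc (xa l) (xd l) := by
  have hB' : (0 : ℝ) < B := Nat.cast_pos.2 hB
  simp_rw [← empCDF_eq_one_sub_exceedFreq hB] at ha hb hc hd
  -- The largest grid level not above `1 - w`; its quantile order `1 - k₀ / B` lies in `[w, w + 1 /
  -- B]`, hence below `w'`.
  set k₀ := ⌊(1 - w) * B⌋₊ with hk₀
  have hk₀le : (k₀ : ℝ) ≤ (1 - w) * B := Nat.floor_le (by nlinarith)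
  have hk₀lt : (1 - w) * B < k₀ + 1 := Nat.lt_floor_add_one _
  have hk₀B : k₀ < B := by
    have : (k₀ : ℝ) < B := by nlinarith
    exact_mod_cast this
  have hk₀p : w ≤ 1 - (k₀ : ℝ) / B := by
    rw [le_sub_comm, div_le_iff₀ hB']
    exact hk₀le
  have hk₀p' : 1 - (k₀ : ℝ) / B ≤ w' := by
    refine le_trans ?_ hww
    rw [sub_le_comm, le_div_iff₀ hB', sub_mul, add_mul, inv_mul_cancel₀ hB'.ne']
    linarith
  have hk₀n : (0 : ℝ) ≤ (k₀ : ℝ) / B := by positivity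
  -- At this level the quantiles lie above `xc`, where the joint exceedance frequency is already at
  -- most `α`. So the selected level `K / B` is at least `k₀ / B`.
  have hmem : k₀ ∈ admissible q α := by
    classical
    refine Finset.mem_filter.2 ⟨Finset.mem_range.2 hk₀B, ?_⟩
    refine (estFWER_le q (x := xc) fun l => ?_).trans hc'
    exact le_empQuantile hB _ (by linarith) ((hc l).trans_le hk₀p)
  obtain ⟨K, hK, hKe⟩ := Finset.exists_mem_eq_sup (admissible q α) ⟨k₀, hmem⟩ id
  have hk₀K : k₀ ≤ K := by
    have := Finset.le_sup (f := id) hmem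
    rw [hKe] at this
    exact this
  have hKmem := Finset.mem_filter.1 hK
  have hKB : (K : ℝ) < B := by exact_mod_cast Finset.mem_range.1 hKmem.1
  have hloc : localLevel q α = (K : ℝ) / B := by
    rw [localLevel, hKe]; rfl
  have hp0 : 0 < 1 - (K : ℝ) / B := by
    rw [sub_pos, div_lt_one hB']; exact hKB
  have hKn : (0 : ℝ) ≤ (K : ℝ) / B := by positivity
  have hKk : (k₀ : ℝ) / B ≤ (K : ℝ) / B := by gcongr
  -- Otherwise the quantiles at the selected level would lie below `xb`, where the joint frequency
  -- is above `α`, and the level would not be admissible.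
  have hvp : v < 1 - (K : ℝ) / B := by
    by_contra! hle
    refine absurd (hb'.trans_le (le_estFWER q (γ := (K : ℝ) / B) fun l => ?_)) (not_lt.2 hKmem.2)
    exact empQuantile_le _ hp0 (hle.trans (hb l))
  rw [critValue, hloc]
  exact ⟨le_empQuantile hB _ (by linarith) ((ha l).trans hvp),
    empQuantile_le _ hp0 (by linarith [hd l])⟩

end EmpiricalQuantiles

/-! ### Measurability of critical values and test statistics -/

section Measurability

variable {B L : ℕ}

theorem measurable_card_filter {X : Type*} [MeasurableSpace X] (p : Fin B → X → Prop)
    [∀ x, DecidablePred fun b => p b x] (hp : ∀ b, MeasurableSet {x | p b x}) :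
    Measurable fun x => ((Finset.univ.filter fun b => p b x).card : ℝ) := by
  classical
  have e : (fun x => ((Finset.univ.filter fun b => p b x).card : ℝ))
      = fun x => ∑ b, {x | p b x}.indicator (fun _ => (1 : ℝ)) x := by
    ext x
    rw [Finset.card_filter]
    push_cast
    refine Finset.sum_congr rfl fun b _ => ?_
    by_cases h : p b x <;> simp [h, Set.indicator]
  rw [e]
  exact Finset.measurable_sum _ fun b _ => measurable_const.indicator (hp b)

theorem measurable_empCDF (x : ℝ) : Measurable fun y : Fin B → ℝ => empCDF y x :=
  (measurable_card_filter (fun b (y : Fin B → ℝ) => y b ≤ x)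
    fun b => measurableSet_le (measurable_pi_apply b) measurable_const).div_const _

/-- For `0 < p ≤ 1` the event that the quantile is below `c` is a countable union over rational
thresholds. For other `p` the set under the infimum is the whole line or empty, and the value is
constant. -/
theorem measurable_empQuantile (p : ℝ) : Measurable fun y : Fin B → ℝ => empQuantile y p := by
  rcases Nat.eq_zero_or_pos B with rfl | hB
  · exact Subsingleton.measurable
  rcases le_or_gt p 0 with hp | hp
  · have e : (fun y : Fin B → ℝ => empQuantile y p) = fun _ => sInf Set.univ := by
      ext y
      rw [empQuantile]
      congr 1
      exact Set.eq_univ_of_forall fun x => hp.trans (empCDF_nonneg y x)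
    rw [e]
    exact measurable_const
  rcases le_or_gt p 1 with hp1 | hp1
  · refine measurable_of_Iio fun c => ?_
    have e : (fun y : Fin B → ℝ => empQuantile y p) ⁻¹' Set.Iio c
        = ⋃ r : ℚ, ⋃ _ : (r : ℝ) < c, {y | p ≤ empCDF y r} := by
      ext y
      simp only [Set.mem_preimage, Set.mem_Iio, Set.mem_iUnion, Set.mem_ofPred_eq, exists_prop]
      constructor
      · intro h
        obtain ⟨z, hz⟩ := exists_empCDF_eq_one hB y
        obtain ⟨x, hx, hxc⟩ := exists_lt_of_csInf_lt
          (⟨z, by rw [Set.mem_ofPred_eq, hz]; exact hp1⟩ : {x | p ≤ empCDF y x}.Nonempty) h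
        obtain ⟨r, hr1, hr2⟩ := exists_rat_btwn hxc
        exact ⟨r, hr2, le_trans hx (empCDF_mono y hr1.le)⟩
      · rintro ⟨r, hr, h⟩
        exact (empQuantile_le y hp h).trans_lt hr
    rw [e]
    exact MeasurableSet.iUnion fun r => MeasurableSet.iUnion fun _ =>
      measurableSet_le measurable_const (measurable_empCDF _)
  · have e : (fun y : Fin B → ℝ => empQuantile y p) = fun _ => sInf ∅ := by
      ext y
      rw [empQuantile]
      congr 1
      refine Set.eq_empty_of_forall_notMem fun x (hx : p ≤ empCDF y x) => ?_
      obtain ⟨z, hz⟩ := exists_empCDF_eq_one hB y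
      have h1 := empCDF_mono y (le_max_left x z)
      have h2 := empCDF_mono y (le_max_right x z)
      have h3 : empCDF y (max x z) ≤ 1 := by
        unfold empCDF
        refine div_le_one_of_le₀ ?_ (Nat.cast_nonneg _)
        exact_mod_cast (Finset.card_filter_le _ _).trans (by simp)
      linarith
    rw [e]
    exact measurable_const

theorem measurable_coord_quantile (p : ℝ) (l : Fin L) :
    Measurable fun q : Fin B → Fin L → ℝ => empQuantile (fun b => q b l) p :=
  (measurable_empQuantile p).comp (by fun_prop)

theorem measurable_estFWER (γ : ℝ) : Measurable fun q : Fin B → Fin L → ℝ => estFWER q γ := by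
  classical
  refine (measurable_card_filter (fun b (q : Fin B → Fin L → ℝ) =>
    ∃ l, empQuantile (fun b' => q b' l) (1 - γ) < q b l) fun b => ?_).div_const _
  simp only [Set.ofPred_exists]
  exact MeasurableSet.iUnion fun l =>
    measurableSet_lt (measurable_coord_quantile _ l) (by fun_prop)

theorem measurable_exceedFreq (T : Finset (Fin L)) (x : Fin L → ℝ) :
    Measurable fun q : Fin B → Fin L → ℝ => exceedFreq q T x := by
  classical
  refine (measurable_card_filter (fun b (q : Fin B → Fin L → ℝ) =>
    ∃ l ∈ T, x l < q b l) fun b => ?_).div_const _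
  simp only [Set.ofPred_exists]
  refine MeasurableSet.iUnion fun l => ?_
  by_cases hl : l ∈ T
  · simp only [hl, true_and]
    exact measurableSet_lt measurable_const (by fun_prop)
  · simp [hl]

theorem measurable_sup_admissible (α : ℝ) :
    Measurable fun q : Fin B → Fin L → ℝ => (admissible q α).sup id := by
  classical
  have key : ∀ n : ℕ, Measurable fun q : Fin B → Fin L → ℝ =>
      ((Finset.range n).filter fun k : ℕ => estFWER q ((k : ℝ) / (B : ℝ)) ≤ α).sup id := by
    intro n
    induction n with
    | zero => simp
    | succ n ih =>
      have e : (fun q : Fin B → Fin L → ℝ => ((Finset.range (n + 1)).filter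
          fun k : ℕ => estFWER q ((k : ℝ) / (B : ℝ)) ≤ α).sup id)
          = fun q => if estFWER q ((n : ℝ) / (B : ℝ)) ≤ α then
            max n (((Finset.range n).filter fun k : ℕ =>
              estFWER q ((k : ℝ) / (B : ℝ)) ≤ α).sup id)
            else ((Finset.range n).filter fun k : ℕ =>
              estFWER q ((k : ℝ) / (B : ℝ)) ≤ α).sup id := by
        ext q
        rw [Finset.range_add_one, Finset.filter_insert]
        split_ifs
        · rw [Finset.sup_insert]; rfl
        · rfl
      rw [e]
      exact Measurable.ite (measurableSet_le (measurable_estFWER _) measurable_const)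
        (measurable_const.max ih) ih
  convert key B
  simp [admissible]

/-- The order of the quantile is random but takes countably many values, so measurability for each
fixed order is enough. -/
theorem measurable_critValue (α : ℝ) (l : Fin L) :
    Measurable fun q : Fin B → Fin L → ℝ => critValue q α l := by
  have h : Measurable fun p : ℕ × (Fin B → Fin L → ℝ) =>
      empQuantile (fun b => p.2 b l) (1 - (p.1 : ℝ) / (B : ℝ)) := by
    refine measurable_from_prod_countable_right fun k => ?_
    simpa only using measurable_coord_quantile (1 - (k : ℝ) / (B : ℝ)) l
  have h2 : Measurable fun q : Fin B → Fin L → ℝ => ((admissible q α).sup id, q) :=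
    (measurable_sup_admissible α).prodMk measurable_id
  simpa only [Function.comp_def, critValue, localLevel] using! h.comp h2

theorem measurableSet_ratioExceedsOne {X : Type*} [MeasurableSpace X] {Q q : X → ℝ}
    (hQ : Measurable Q) (hq : Measurable q) : MeasurableSet {x | RatioExceedsOne (Q x) (q x)} := by
  have e : {x | RatioExceedsOne (Q x) (q x)}
      = ({x | q x = 0} ∩ {x | 0 < Q x}) ∪ ({x | q x = 0}ᶜ ∩ {x | 1 < Q x / q x}) := by
    ext x
    by_cases h : q x = 0 <;> simp [RatioExceedsOne, h]
  have h0 : MeasurableSet {x | q x = 0} := hq (measurableSet_singleton 0)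
  rw [e]
  exact (h0.inter (measurableSet_lt measurable_const hQ)).union
    (h0.compl.inter (measurableSet_lt measurable_const (hQ.div hq)))

theorem integral_maxReject {Ω : Type*} [MeasurableSpace Ω] (P : Measure Ω) {Q q : Ω → Fin L → ℝ}
    (hQ : ∀ l, Measurable fun ω => Q ω l) (hq : ∀ l, Measurable fun ω => q ω l)
    (T : Finset (Fin L)) : ∫ ω, maxReject (Q ω) (q ω) T ∂P
      = P.real {ω | ∃ l ∈ T, RatioExceedsOne (Q ω l) (q ω l)} := by
  classical
  have hm : MeasurableSet {ω | ∃ l ∈ T, RatioExceedsOne (Q ω l) (q ω l)} := by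
    have e : {ω | ∃ l ∈ T, RatioExceedsOne (Q ω l) (q ω l)}
        = ⋃ l ∈ T, {ω | RatioExceedsOne (Q ω l) (q ω l)} := by ext; simp
    rw [e]
    exact T.measurableSet_biUnion fun l _ => measurableSet_ratioExceedsOne (hQ l) (hq l)
  rw [← integral_indicator_one hm]
  refine integral_congr_ae (Eventually.of_forall fun ω => ?_)
  simp only [maxReject, Set.indicator, Set.mem_ofPred_eq, Pi.one_apply]

end Measurability

section Measurability

variable {ι κ : Type*} [Fintype ι] [DecidableEq ι] [Fintype κ]

theorem measurable_formVar {X : Type*} [MeasurableSpace X] (C : Matrix κ ι ℝ)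
    {m : X → κ → κ → ℝ} {S : X → ι → ι → ℝ} (hm : Measurable m) (hS : Measurable S) :
    Measurable fun x => formVar C (of (m x)) (of (S x)) := by
  obtain ⟨g, hg, e⟩ : ∃ g : (κ → κ → ℝ) × (ι → ι → ℝ) → ℝ, Continuous g ∧
      ∀ p q, formVar C (of p) (of q) = g (p, q) :=
    ⟨_, continuous_formVar C, fun _ _ => rfl⟩
  simp_rw [e]
  exact hg.measurable.comp (hm.prodMk hS)

theorem measurable_sandwich {X : Type*} [MeasurableSpace X]
    {m : X → κ → κ → ℝ} {y : X → κ → ℝ} (hm : Measurable m) (hy : Measurable y) :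
    Measurable fun x => y x ⬝ᵥ (of (m x) *ᵥ y x) := by
  have h : Continuous fun p : (κ → κ → ℝ) × (κ → ℝ) => p.2 ⬝ᵥ (of p.1 *ᵥ p.2) :=
    continuous_quad (ι := κ)
  exact h.measurable.comp (hm.prodMk hy)

omit [DecidableEq ι] in
theorem measurable_mulVec_const {X : Type*} [MeasurableSpace X] (C : Matrix κ ι ℝ)
    {y : X → ι → ℝ} (hy : Measurable y) : Measurable fun x => C *ᵥ y x :=
  (Continuous.matrix_mulVec continuous_const continuous_id).measurable.comp hy

variable {a d k : ℕ} {X : Type*} [MeasurableSpace X]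

theorem measurable_mcForm {M : WeightFn a d} {C : Matrix (Fin k) (Idx a d) ℝ}
    (hM : ∀ u v, Measurable fun S : Idx a d → Idx a d → ℝ => M k C (of S) u v)
    {S : X → Idx a d → Idx a d → ℝ} {z : X → EuclideanSpace ℝ (Idx a d)} (hS : Measurable S)
    (hz : Measurable z) : Measurable fun x => mcForm M C (of (S x)) (z x) := by
  have hm : Measurable fun x => fun u v => M k C (of (S x)) u v :=
    measurable_pi_lambda _ fun u => measurable_pi_lambda _ fun v => (hM u v).comp hS
  have hy : Measurable fun x => C *ᵥ (z x).ofLp :=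
    measurable_mulVec_const C ((WithLp.measurable_ofLp 2 _).comp hz)
  exact (measurable_sandwich hm hy).div (measurable_formVar C hm hS).sqrt

theorem measurable_testStat {M : WeightFn a d} {C : Matrix (Fin k) (Idx a d) ℝ}
    (hM : ∀ u v, Measurable fun S : Idx a d → Idx a d → ℝ => M k C (of S) u v) (b : Fin k → ℝ)
    (N : ℕ) {S : X → Idx a d → Idx a d → ℝ} {z : X → Idx a d → ℝ} (hS : Measurable S)
    (hz : Measurable z) : Measurable fun x => testStat M C b N (z x) (of (S x)) := by
  have hm : Measurable fun x => fun u v => M k C (of (S x)) u v :=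
    measurable_pi_lambda _ fun u => measurable_pi_lambda _ fun v => (hM u v).comp hS
  have hy : Measurable fun x => C *ᵥ z x - b := (measurable_mulVec_const C hz).sub_const b
  have hv := measurable_formVar C hm hS
  exact Measurable.ite (measurableSet_lt measurable_const hv)
    (((measurable_sandwich hm hy).div hv.sqrt).const_mul _) measurable_const

end Measurability

/-! ### Conditionally normal samples and Chebyshev's inequality -/

section ConditionalSampling

variable {Ω : Type*} [mΩ : MeasurableSpace Ω] {P : Measure Ω} [IsProbabilityMeasure P]
  {ι : Type*} [Fintype ι] [DecidableEq ι] {B : ℕ}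

/-- The normal sample with covariance matrix `S` obtained from a standard normal sample. -/
noncomputable def gaussSample (S : Matrix ι ι ℝ) (ζ : Fin B → ι → ℝ) :
    Fin B → EuclideanSpace ℝ ι :=
  fun b => WithLp.toLp 2 (psdSqrt S *ᵥ ζ b)

theorem measurable_gaussSample (S : Matrix ι ι ℝ) :
    Measurable (gaussSample S : (Fin B → ι → ℝ) → _) :=
  measurable_pi_lambda _ fun b => (measurable_toLp_mulVec _).comp (measurable_pi_apply b)

theorem map_gaussSample (S : Matrix ι ι ℝ) :
    (Measure.pi fun _ : Fin B => stdNormal ι).map (gaussSample S)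
      = Measure.pi fun _ : Fin B => multivariateGaussian 0 S := by
  have h := Measure.pi_map_pi (μ := fun _ : Fin B => stdNormal ι)
    (f := fun _ (x : ι → ℝ) => (WithLp.toLp 2 (psdSqrt S *ᵥ x) : EuclideanSpace ℝ ι))
    (hμ := fun _ => by rw [← multivariateGaussian_zero_eq_map]; infer_instance)
    fun _ => (measurable_toLp_mulVec _).aemeasurable
  simp_rw [← multivariateGaussian_zero_eq_map] at h
  exact h

theorem measurable_gaussSample_prod {X : Type*} [MeasurableSpace X] {S : X → ι → ι → ℝ}
    (hS : Measurable S) :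
    Measurable fun p : X × (Fin B → ι → ℝ) => gaussSample (of (S p.1)) p.2 := by
  refine measurable_pi_lambda _ fun b => (WithLp.measurable_toLp 2 _).comp ?_
  have hR : Measurable fun p : X × (Fin B → ι → ℝ) => fun i j => psdSqrt (of (S p.1)) i j :=
    measurable_psdSqrt.comp (hS.comp measurable_fst)
  have hc : Continuous fun q : (ι → ι → ℝ) × (ι → ℝ) => of q.1 *ᵥ q.2 :=
    Continuous.matrix_mulVec (A := fun q : (ι → ι → ℝ) × (ι → ℝ) => of q.1)
      continuous_fst continuous_snd
  exact hc.measurable.comp (hR.prodMk ((measurable_pi_apply b).comp measurable_snd))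

/-- The joint distribution of the covariance matrix and of the sample that is, given the data,
normal with this covariance matrix. -/
theorem HasCondLawGiven.map_eq {Ω : Type*} {G : MeasurableSpace Ω} [mΩ : MeasurableSpace Ω]
    {P : Measure Ω} [IsProbabilityMeasure P] (hG : G ≤ mΩ) {S : Ω → ι → ι → ℝ}
    (hS : Measurable[G] S) {Z : Ω → Fin B → EuclideanSpace ℝ ι} (hZm : Measurable Z)
    (hZ : HasCondLawGiven P G Z
      fun ω => Measure.pi fun _ : Fin B => multivariateGaussian 0 (of (S ω))) :
    P.map (fun ω => (S ω, Z ω)) = (P.prod (Measure.pi fun _ : Fin B => stdNormal ι)).map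
      fun p => (S p.1, gaussSample (of (S p.1)) p.2) := by
  have hS' : Measurable S := hS.mono hG le_rfl
  have hm : Measurable fun p : Ω × (Fin B → ι → ℝ) => (S p.1, gaussSample (of (S p.1)) p.2) :=
    (hS'.comp measurable_fst).prodMk (measurable_gaussSample_prod hS')
  have := Measure.isProbabilityMeasure_map (μ := P) (hS'.prodMk hZm).aemeasurable
  refine Measure.ext_prod fun {s t} hs ht => ?_
  rw [Measure.map_apply (hS'.prodMk hZm) (hs.prod ht), Measure.map_apply hm (hs.prod ht),
    Measure.prod_apply (hm (hs.prod ht))]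
  rw [← ENNReal.toReal_eq_toReal_iff' (measure_ne_top _ _)]
  swap
  · refine ((lintegral_mono fun ω => prob_le_one).trans_lt ?_).ne
    simp
  rw [← integral_toReal (measurable_measure_prodMk_left (hm (hs.prod ht))).aemeasurable
    (Eventually.of_forall fun ω => measure_lt_top _ _)]
  -- On a rectangle the section is empty unless `S ω ∈ s`, and then has the conditional probability
  -- of `t`. As `S` is measurable for the conditioning σ-algebra, integration over `S ⁻¹' s`
  -- recovers the joint law.
  have e : ∀ ω, ((Measure.pi fun _ : Fin B => stdNormal ι) (Prod.mk ω ⁻¹'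
      ((fun p : Ω × (Fin B → ι → ℝ) => (S p.1, gaussSample (of (S p.1)) p.2)) ⁻¹' s ×ˢ t))).toReal
      = (S ⁻¹' s).indicator (fun ω => (Measure.pi fun _ : Fin B =>
        multivariateGaussian 0 (of (S ω))).real t) ω := by
    intro ω
    by_cases h : ω ∈ S ⁻¹' s
    · rw [Set.indicator_of_mem h, ← map_gaussSample, measureReal_def,
        Measure.map_apply (measurable_gaussSample _) ht]
      congr 2
      ext ζ
      simpa using fun _ => h
    · rw [Set.indicator_of_notMem h]
      have : Prod.mk ω ⁻¹' ((fun p : Ω × (Fin B → ι → ℝ) =>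
          (S p.1, gaussSample (of (S p.1)) p.2)) ⁻¹' s ×ˢ t) = ∅ := by
        ext ζ
        simpa using fun (h' : S ω ∈ s) => absurd h' h
      rw [this]
      simp
  simp_rw [e]
  rw [integral_indicator (hS' hs)]
  rw [setIntegral_congr_ae (hS' hs) ((hZ t ht).mono fun ω hω _ => hω.symm),
    setIntegral_condExp hG ((integrable_const _).indicator (hZm ht)) (hS hs),
    setIntegral_indicator (hZm ht)]
  simp [measureReal_def, Set.mk_preimage_prod]

/-- Chebyshev's inequality for an empirical frequency. -/
theorem measure_abs_freq_sub_ge_le {X : Type*} [MeasurableSpace X] (ν : Measure X)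
    [IsProbabilityMeasure ν] {E : Set X} (hE : MeasurableSet E) [DecidablePred (· ∈ E)]
    (hB : 0 < B) {ε : ℝ} (hε : 0 < ε) :
    (Measure.pi fun _ : Fin B => ν)
      {ζ | ε ≤ |((Finset.univ.filter fun b => ζ b ∈ E).card : ℝ) / B - ν.real E|}
      ≤ ENNReal.ofReal ((B : ℝ)⁻¹ / ε ^ 2) := by
  classical
  have hB' : (0 : ℝ) < B := Nat.cast_pos.2 hB
  set ind : X → ℝ := E.indicator fun _ => 1 with hind
  have hindm : Measurable ind := measurable_const.indicator hE
  have hind2 : MemLp ind 2 ν := MemLp.of_bound hindm.aestronglyMeasurable 1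
    (Eventually.of_forall fun x => by by_cases h : x ∈ E <;> simp [hind, h])
  set S : (Fin B → X) → ℝ := ∑ b, fun ζ => ind (ζ b) with hS
  have hfreq : (fun ζ : Fin B → X => ((Finset.univ.filter fun b => ζ b ∈ E).card : ℝ) / B)
      = fun ζ => (B : ℝ)⁻¹ * S ζ := by
    ext ζ
    rw [Finset.card_filter, div_eq_inv_mul, hS, Finset.sum_apply]
    push_cast
    congr 1
    exact Finset.sum_congr rfl fun b _ => by by_cases h : ζ b ∈ E <;> simp [hind, h]
  have hev : ∀ b : Fin B, MemLp (fun ζ : Fin B → X => ind (ζ b)) 2 (Measure.pi fun _ => ν) :=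
    fun b => hind2.comp_measurePreserving (measurePreserving_eval (fun _ : Fin B => ν) b)
  have hSL : MemLp S 2 (Measure.pi fun _ : Fin B => ν) := by
    have := memLp_finsetSum' Finset.univ fun b _ => hev b
    exact this
  have hmean : ∫ ζ, (B : ℝ)⁻¹ * S ζ ∂(Measure.pi fun _ : Fin B => ν) = ν.real E := by
    rw [integral_const_mul, hS]
    simp only [Finset.sum_apply]
    rw [integral_finsetSum _ fun b _ => (hev b).integrable (by norm_num)]
    have : ∀ b : Fin B, ∫ ζ, ind (ζ b) ∂(Measure.pi fun _ : Fin B => ν) = ν.real E := by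
      intro b
      rw [integral_comp_eval (μ := fun _ : Fin B => ν) (i := b) (f := ind)
        hindm.aestronglyMeasurable, hind]
      exact integral_indicator_one hE
    simp_rw [this]
    simp only [Finset.sum_const, Finset.card_univ, Fintype.card_fin, nsmul_eq_mul]
    field_simp
  have hvar : Var[fun ζ => (B : ℝ)⁻¹ * S ζ; Measure.pi fun _ : Fin B => ν] ≤ (B : ℝ)⁻¹ := by
    rw [variance_const_mul, hS, variance_sum_pi fun _ => hind2]
    have h1 : Var[ind; ν] ≤ 1 := by
      refine (variance_le_expectation_sq hindm.aestronglyMeasurable).trans ?_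
      calc ∫ x, (ind ^ 2) x ∂ν ≤ ∫ _x, (1 : ℝ) ∂ν := by
            refine integral_mono hind2.integrable_sq (integrable_const _) fun x => ?_
            by_cases h : x ∈ E <;> simp [hind, h]
        _ = 1 := by simp
    simp only [Finset.sum_const, Finset.card_univ, Fintype.card_fin, nsmul_eq_mul]
    have : (B : ℝ)⁻¹ ^ 2 * (B * Var[ind; ν]) = (B : ℝ)⁻¹ * Var[ind; ν] := by field_simp
    rw [this]
    exact mul_le_of_le_one_right (inv_pos.2 hB').le h1
  have h := meas_ge_le_variance_div_sq (hSL.const_mul (B : ℝ)⁻¹) hε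
  rw [hmean] at h
  refine le_trans (le_of_eq ?_) (h.trans (ENNReal.ofReal_le_ofReal (by gcongr)))
  congr 1
  ext ζ
  have := congrFun hfreq ζ
  simp only [Set.mem_ofPred_eq, this]

end ConditionalSampling

/-! ### Convergence of the Monte-Carlo exceedance frequencies -/

section Frequencies

variable {Ω : Type*} [mΩ : MeasurableSpace Ω] {P : Measure Ω} [IsProbabilityMeasure P] {a d L : ℕ}
  {r : Fin L → ℕ}

/-- The Monte-Carlo quadratic forms of all hypotheses. -/
noncomputable def mcForms {B : ℕ} (M : WeightFn a d) (C : Matrix (Rows r) (Idx a d) ℝ)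
    (S : Matrix (Idx a d) (Idx a d) ℝ) (z : Fin B → EuclideanSpace ℝ (Idx a d)) :
    Fin B → Fin L → ℝ :=
  fun b l => mcForm M (blockC C l) S (z b)

theorem measurable_mcForms {B : ℕ} {X : Type*} [MeasurableSpace X] {M : WeightFn a d}
    {C : Matrix (Rows r) (Idx a d) ℝ}
    (hM : ∀ l u v, Measurable fun S : Idx a d → Idx a d → ℝ => M (r l) (blockC C l) (of S) u v)
    {S : X → Idx a d → Idx a d → ℝ} {z : X → Fin B → EuclideanSpace ℝ (Idx a d)}
    (hS : Measurable S) (hz : Measurable z) :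
    Measurable fun x => mcForms M C (of (S x)) (z x) :=
  measurable_pi_lambda _ fun b => measurable_pi_lambda _ fun l =>
    measurable_mcForm (hM l) hS ((measurable_pi_apply b).comp hz)

/-- The matrices of the Monte-Carlo quadratic forms. -/
noncomputable def mcMats (M : WeightFn a d) (C : Matrix (Rows r) (Idx a d) ℝ)
    (S : Matrix (Idx a d) (Idx a d) ℝ) : Fin L → Matrix (Idx a d) (Idx a d) ℝ :=
  fun l => mcMat (blockC C l) (M (r l) (blockC C l) S) S

theorem exceedFreq_mcForms_gaussSample {B : ℕ} (M : WeightFn a d)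
    (C : Matrix (Rows r) (Idx a d) ℝ) (S : Matrix (Idx a d) (Idx a d) ℝ)
    (ζ : Fin B → Idx a d → ℝ) (T : Finset (Fin L)) (x : Fin L → ℝ)
    [DecidablePred (· ∈ {x' | ∃ l ∈ T, x l < quad (mcMats M C S l) x'})] :
    exceedFreq (mcForms M C S (gaussSample S ζ)) T x
      = ((Finset.univ.filter fun b => ζ b ∈
        {x' | ∃ l ∈ T, x l < quad (mcMats M C S l) x'}).card : ℝ) / B := by
  classical
  unfold exceedFreq mcForms gaussSample
  simp_rw [mcForm_eq_quad]
  refine congrArg (fun m : ℕ => (m : ℝ) / B) (congrArg Finset.card (Finset.ext fun b => ?_))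
  rw [Finset.mem_filter, Finset.mem_filter]
  exact Iff.rfl

/-- The Monte-Carlo exceedance frequencies converge in probability to the exceedance probabilities
of the limit distribution. -/
theorem convProb_exceedFreq {M : WeightFn a d} {C : Matrix (Rows r) (Idx a d) ℝ}
    (hM : ∀ l u v, Measurable fun S : Idx a d → Idx a d → ℝ => M (r l) (blockC C l) (of S) u v)
    {G : ℕ → MeasurableSpace Ω} (hG : ∀ t, G t ≤ mΩ) {S : ℕ → Ω → Idx a d → Idx a d → ℝ}
    (hS : ∀ t, Measurable[G t] (S t)) {B : ℕ → ℕ} (hB : Tendsto B atTop atTop)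
    {Z : (t : ℕ) → Ω → Fin (B t) → EuclideanSpace ℝ (Idx a d)} (hZm : ∀ t, Measurable (Z t))
    (hZ : ∀ t, HasCondLawGiven P (G t) (Z t)
      fun ω => Measure.pi fun _ : Fin (B t) => multivariateGaussian 0 (of (S t ω)))
    {A : Fin L → Matrix (Idx a d) (Idx a d) ℝ}
    (hA : ∀ l, (A l).PosSemidef) (h0 : ∀ l, A l ≠ 0)
    (hconv : ConvProb P (fun t ω => mcMats M C (of (S t ω))) A) (T : Finset (Fin L))
    (x : Fin L → ℝ) :
    ConvProb P (fun t ω => exceedFreq (mcForms M C (of (S t ω)) (Z t ω)) T x) (exceed A T x) := by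
  classical
  rw [convProb_iff_tendstoInMeasure, tendstoInMeasure_iff_norm]
  intro ε hε
  have hcont : ContinuousAt (fun A' => exceed A' T x) A :=
    (continuousAt_exceed T (y := x) hA h0).comp (f := fun A' => (A', x)) (by fun_prop)
  set U : Set (Fin L → Matrix (Idx a d) (Idx a d) ℝ) :=
    {A' | |exceed A' T x - exceed A T x| < ε / 2} with hU
  have hUn : U ∈ 𝓝 A := by
    have := Metric.tendsto_nhds.1 hcont (ε / 2) (by positivity)
    filter_upwards [this] with A' hA'
    simpa [hU, Real.dist_eq] using hA'
  have hbound : ∀ t, 0 < B t → P {ω | ε ≤ ‖exceedFreq (mcForms M C (of (S t ω)) (Z t ω)) T x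
      - exceed A T x‖} ≤ P {ω | mcMats M C (of (S t ω)) ∉ U}
        + ENNReal.ofReal ((B t : ℝ)⁻¹ / (ε / 2) ^ 2) := by
    intro t hBt
    have hS' : Measurable (S t) := (hS t).mono (hG t) le_rfl
    set D : Set ((Idx a d → Idx a d → ℝ) × (Fin (B t) → EuclideanSpace ℝ (Idx a d))) :=
      {p | ε ≤ ‖exceedFreq (mcForms M C (of p.1) p.2) T x - exceed A T x‖} with hD
    have hDm : MeasurableSet D := by
      refine measurableSet_le measurable_const (Measurable.norm (Measurable.sub_const ?_ _))
      exact (measurable_exceedFreq T x).comp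
        (measurable_mcForms hM measurable_fst measurable_snd)
    have hm : Measurable fun p : Ω × (Fin (B t) → Idx a d → ℝ) =>
        (S t p.1, gaussSample (of (S t p.1)) p.2) :=
      (hS'.comp measurable_fst).prodMk (measurable_gaussSample_prod hS')
    -- Only the joint law of covariance matrix and sample matters, so the sample may be built from
    -- standard normal vectors independent of the data; Fubini then freezes the matrix.
    have e1 : P {ω | ε ≤ ‖exceedFreq (mcForms M C (of (S t ω)) (Z t ω)) T x - exceed A T x‖}
        = ∫⁻ ω, (Measure.pi fun _ : Fin (B t) => stdNormal (Idx a d))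
          {ζ | ε ≤ ‖exceedFreq (mcForms M C (of (S t ω)) (gaussSample (of (S t ω)) ζ)) T x
            - exceed A T x‖} ∂P := by
      have h1 := congrArg (fun μ : Measure _ => μ D)
        (HasCondLawGiven.map_eq (hG t) (hS t) (hZm t) (hZ t))
      rw [Measure.map_apply (hS'.prodMk (hZm t)) hDm, Measure.map_apply hm hDm,
        Measure.prod_apply (hm hDm)] at h1
      exact h1
    rw [e1]
    -- A measurable hull, which lets the bad event enter an integral. Off it, `ε / 2` is spent on
    -- the change of matrices and `ε / 2` on Chebyshev's bound, which is uniform in the frozen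
    -- matrix.
    set W := toMeasurable P {ω | mcMats M C (of (S t ω)) ∉ U}
    have hle : ∀ ω, (Measure.pi fun _ : Fin (B t) => stdNormal (Idx a d))
          {ζ | ε ≤ ‖exceedFreq (mcForms M C (of (S t ω)) (gaussSample (of (S t ω)) ζ)) T x
            - exceed A T x‖}
        ≤ W.indicator (fun _ => 1) ω + ENNReal.ofReal ((B t : ℝ)⁻¹ / (ε / 2) ^ 2) := by
      intro ω
      by_cases hω : mcMats M C (of (S t ω)) ∈ U
      · refine le_trans ?_ le_add_self
        refine le_trans (measure_mono fun ζ hζ => ?_) (measure_abs_freq_sub_ge_le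
          (stdNormal (Idx a d)) (isOpen_exceed (mcMats M C (of (S t ω))) T x).measurableSet hBt
          (show 0 < ε / 2 by positivity))
        simp only [Set.mem_ofPred_eq] at hζ ⊢
        rw [exceedFreq_mcForms_gaussSample, Real.norm_eq_abs] at hζ
        have h2 : |exceed (mcMats M C (of (S t ω))) T x - exceed A T x| < ε / 2 := hω
        rw [exceed] at h2
        have h3 := abs_sub_le (((Finset.univ.filter fun b => ζ b ∈
          {x' | ∃ l ∈ T, x l < quad (mcMats M C (of (S t ω)) l) x'}).card : ℝ) / (B t))
          ((stdNormal (Idx a d)).real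
            {x' | ∃ l ∈ T, x l < quad (mcMats M C (of (S t ω)) l) x'}) (exceed A T x)
        simp only [Set.mem_ofPred_eq] at hζ h2 h3 ⊢
        linarith
      · have : ω ∈ W := subset_toMeasurable P _ hω
        rw [Set.indicator_of_mem this]
        exact prob_le_one.trans le_self_add
    refine (lintegral_mono hle).trans ?_
    rw [lintegral_add_right _ measurable_const, lintegral_indicator (measurableSet_toMeasurable _ _)]
    simp
  have hlim : Tendsto (fun t => P {ω | mcMats M C (of (S t ω)) ∉ U}
      + ENNReal.ofReal ((B t : ℝ)⁻¹ / (ε / 2) ^ 2)) atTop (𝓝 0) := by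
    have h1 : Tendsto (fun t => (B t : ℝ)⁻¹ / (ε / 2) ^ 2) atTop (𝓝 0) := by
      have := (tendsto_inv_atTop_zero.comp ((tendsto_natCast_atTop_atTop (R := ℝ)).comp
        hB)).div_const ((ε / 2) ^ 2)
      simpa using this
    have h2 := (hconv U hUn).add (ENNReal.tendsto_ofReal h1)
    simpa using h2
  refine tendsto_of_tendsto_of_tendsto_of_le_of_le' tendsto_const_nhds hlim
    (Eventually.of_forall fun _ => zero_le) ?_
  filter_upwards [hB.eventually_gt_atTop 0] with t ht using hbound t ht

end Frequencies

/-! ### Events of probability tending to one -/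

section HighProbability

variable {Ω : Type*} [MeasurableSpace Ω] {P : Measure Ω}

/-- Events whose probability tends to one, without measurability assumptions. -/
def WithHighProb (P : Measure Ω) (A : ℕ → Ω → Prop) : Prop :=
  Tendsto (fun t => P {ω | ¬ A t ω}) atTop (𝓝 0)

theorem WithHighProb.and {A A' : ℕ → Ω → Prop} (h : WithHighProb P A) (h' : WithHighProb P A') :
    WithHighProb P fun t ω => A t ω ∧ A' t ω :=
  tendsto_measure_zero_of_subset_union
    (Eventually.of_forall fun _ _ hω => not_and_or.1 hω) h h'

theorem WithHighProb.forall {ι : Type*} [Fintype ι] {A : ι → ℕ → Ω → Prop}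
    (h : ∀ i, WithHighProb P (A i)) : WithHighProb P fun t ω => ∀ i, A i t ω :=
  tendsto_measure_zero_of_subset (Eventually.of_forall fun t ω hω => by
    simpa using hω) (tendsto_measure_iUnion_zero (A := fun i t => {ω | ¬ A i t ω}) h)

theorem WithHighProb.mono {A A' : ℕ → Ω → Prop} (h : WithHighProb P A)
    (hA : ∀ᶠ t in atTop, ∀ ω, A t ω → A' t ω) : WithHighProb P A' :=
  tendsto_measure_zero_of_subset (hA.mono fun _ ht ω hω h' => hω (ht ω h')) h

theorem ConvProb.withHighProb {E : Type*} [TopologicalSpace E] {F : ℕ → Ω → E} {e : E}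
    (h : ConvProb P F e) {p : E → Prop} (hp : ∀ᶠ x in 𝓝 e, p x) :
    WithHighProb P fun t ω => p (F t ω) :=
  h _ hp

end HighProbability

/-! ### Limits of critical values and of rejection probabilities -/

section CriticalValues

variable {Ω : Type*} [MeasurableSpace Ω] {P : Measure Ω} {ι : Type*} [Fintype ι] {L : ℕ}
  {A : Fin L → Matrix ι ι ℝ} {x : ℝ → Fin L → ℝ}

/-- The critical values lie between any two values of the quantile function of the limit around
the local level at which the family-wise error rate of the limit equals `α`. -/
theorem withHighProb_critValue_mem_Icc (hL : 1 ≤ L) (hA : ∀ l, (A l).PosSemidef)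
    (h0 : ∀ l, A l ≠ 0) (hx : IsQuantileFn A x) {B : ℕ → ℕ} (hB : Tendsto B atTop atTop)
    {q : (t : ℕ) → Ω → Fin (B t) → Fin L → ℝ}
    (hq : ∀ T y, ConvProb P (fun t ω => exceedFreq (q t ω) T y) (exceed A T y)) {α u v w : ℝ}
    (hα : exceed A Finset.univ (x u) = α) (hu : u ∈ Set.Ioo (0 : ℝ) 1) (hv : v ∈ Set.Ioo 0 u)
    (hw : w ∈ Set.Ioo u 1) :
    WithHighProb P fun t ω => ∀ l, critValue (q t ω) α l ∈ Set.Icc (x v l) (x w l) := by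
  have hne : (Finset.univ : Finset (Fin L)).Nonempty := ⟨⟨0, hL⟩, Finset.mem_univ _⟩
  -- The levels satisfy `v < v₁ < v₂ < u < w₁ < w₂ < w₃ < w`. Quantile thresholds are taken at `v`,
  -- `v₂`, `w₁`, `w`; the levels `v₁`, `w₂`, `w₃` separate them with room for random error, and the
  -- gap from `w₂` to `w₃` absorbs the grid width `1 / B`.
  obtain ⟨v₂, hv₂, hv₂u⟩ := exists_between hv.2
  obtain ⟨v₁, hv₁, hv₁₂⟩ := exists_between hv₂
  obtain ⟨w₁, hw₁, hw₁w⟩ := exists_between hw.1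
  obtain ⟨w₂, hw₂, hw₂w⟩ := exists_between hw₁w
  obtain ⟨w₃, hw₃, hw₃w⟩ := exists_between hw₂w
  have hv0 := hv.1
  have hw1 := hw.2
  have mv : v ∈ Set.Ioo (0 : ℝ) 1 := ⟨hv0, by linarith [hu.2]⟩
  have mv₂ : v₂ ∈ Set.Ioo (0 : ℝ) 1 := ⟨by linarith, by linarith [hu.2]⟩
  have mw₁ : w₁ ∈ Set.Ioo (0 : ℝ) 1 := ⟨by linarith [hu.1], by linarith⟩
  have mw : w ∈ Set.Ioo (0 : ℝ) 1 := ⟨by linarith [hu.1], hw1⟩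
  have ea : WithHighProb P fun t ω => ∀ l, 1 - exceedFreq (q t ω) {l} (x v) < v₁ :=
    WithHighProb.forall fun l => (hq {l} (x v)).withHighProb (p := fun z => 1 - z < v₁) <| by
      refine (by fun_prop : Continuous fun z : ℝ => 1 - z).continuousAt.eventually_lt_const ?_
      rw [hx.exceed_eq v mv]; linarith
  have eb : WithHighProb P fun t ω => ∀ l, v₁ < 1 - exceedFreq (q t ω) {l} (x v₂) :=
    WithHighProb.forall fun l => (hq {l} (x v₂)).withHighProb (p := fun z => v₁ < 1 - z) <| by
      refine (by fun_prop : Continuous fun z : ℝ => 1 - z).continuousAt.eventually_const_lt ?_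
      rw [hx.exceed_eq v₂ mv₂]; linarith
  have ec : WithHighProb P fun t ω => ∀ l, 1 - exceedFreq (q t ω) {l} (x w₁) < w₂ :=
    WithHighProb.forall fun l => (hq {l} (x w₁)).withHighProb (p := fun z => 1 - z < w₂) <| by
      refine (by fun_prop : Continuous fun z : ℝ => 1 - z).continuousAt.eventually_lt_const ?_
      rw [hx.exceed_eq w₁ mw₁]; linarith
  have ed : WithHighProb P fun t ω => ∀ l, w₃ < 1 - exceedFreq (q t ω) {l} (x w) :=
    WithHighProb.forall fun l => (hq {l} (x w)).withHighProb (p := fun z => w₃ < 1 - z) <| by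
      refine (by fun_prop : Continuous fun z : ℝ => 1 - z).continuousAt.eventually_const_lt ?_
      rw [hx.exceed_eq w mw]; linarith
  have eb' : WithHighProb P fun t ω => α < exceedFreq (q t ω) Finset.univ (x v₂) :=
    (hq Finset.univ (x v₂)).withHighProb
      (eventually_gt_nhds (hα ▸ hx.exceed_lt hA h0 hne mv₂ hu hv₂u))
  have ec' : WithHighProb P fun t ω => exceedFreq (q t ω) Finset.univ (x w₁) < α :=
    (hq Finset.univ (x w₁)).withHighProb
      (eventually_lt_nhds (hα ▸ hx.exceed_lt hA h0 hne hu mw₁ hw₁))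
  have hBinv : ∀ᶠ t in atTop, (B t : ℝ)⁻¹ < w₃ - w₂ :=
    (tendsto_inv_atTop_zero.comp ((tendsto_natCast_atTop_atTop (R := ℝ)).comp
      hB)).eventually_lt_const (sub_pos.2 hw₃)
  refine (ea.and (eb.and (ec.and (ed.and (eb'.and ec'))))).mono ?_
  filter_upwards [hBinv, hB.eventually_gt_atTop 0] with t ht hBt ω ⟨ha, hb, hc, hd, hb', hc'⟩
  exact critValue_mem_Icc hBt (q t ω) (by linarith [hu.1]) (by linarith) (by linarith) ha
    (fun l => (hb l).le) hb' hc hc'.le fun l => (hd l).le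

/-- Asymptotic rejection probability of a test with critical values that converge in probability to
quantiles of the limit distribution. -/
theorem tendsto_measureReal_exists_ratioExceedsOne [IsProbabilityMeasure P]
    (hA : ∀ l, (A l).PosSemidef) (h0 : ∀ l, A l ≠ 0) (hx : IsQuantileFn A x)
    {Q c : ℕ → Ω → Fin L → ℝ} {T : Finset (Fin L)}
    (hQ : ∀ y : Fin L → ℝ, Tendsto (fun t => P.real {ω | ∃ l ∈ T, y l < Q t ω l}) atTop
      (𝓝 (exceed A T y))) {u : ℝ} (hu : u ∈ Set.Ioo (0 : ℝ) 1)
    (hc : ∀ v ∈ Set.Ioo 0 u, ∀ w ∈ Set.Ioo u 1,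
      WithHighProb P fun t ω => ∀ l, c t ω l ∈ Set.Icc (x v l) (x w l)) :
    Tendsto (fun t => P.real {ω | ∃ l ∈ T, RatioExceedsOne (Q t ω l) (c t ω l)}) atTop
      (𝓝 (exceed A T (x u))) := by
  have hcont : ContinuousAt (fun u => exceed A T (x u)) u :=
    (hx.continuousOn_exceed hA h0 T).continuousAt (Ioo_mem_nhds hu.1 hu.2)
  have hpos : ∀ v ∈ Set.Ioo 0 u, ∀ l, 0 < x v l := fun v hv =>
    hx.pos v ⟨hv.1, hv.2.trans hu.2⟩
  -- The critical values are positive with high probability, so the conventions for division by zero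
  -- have no effect in the limit.
  have hiff : ∀ {z y : ℝ}, 0 < y → (RatioExceedsOne z y ↔ y < z) := fun {z y} hy => by
    rw [RatioExceedsOne, if_neg hy.ne', one_lt_div hy]
  have hbad : ∀ v ∈ Set.Ioo 0 u, ∀ w ∈ Set.Ioo u 1, Tendsto (fun t => P.real
      {ω | ¬ ∀ l, c t ω l ∈ Set.Icc (x v l) (x w l)}) atTop (𝓝 0) := fun v hv w hw =>
    (ENNReal.tendsto_toReal ENNReal.zero_ne_top).comp (hc v hv w hw)
  -- Each inequality needs only one sharp end of the bracket; these are arbitrary choices for the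
  -- other end.
  have hlow : u / 2 ∈ Set.Ioo 0 u := ⟨by linarith [hu.1], by linarith [hu.1]⟩
  have hupp : (u + 1) / 2 ∈ Set.Ioo u 1 := ⟨by linarith [hu.2], by linarith [hu.2]⟩
  refine tendsto_order.2 ⟨fun b hb => ?_, fun b hb => ?_⟩
  · obtain ⟨w, ⟨hbw, hw1⟩, hw⟩ := (((hcont.eventually_const_lt hb).and
      (Iio_mem_nhds hu.2)).filter_mono (nhdsWithin_le_nhds (s := Set.Ioi u))
        |>.and self_mem_nhdsWithin).exists
    have hlim := (hQ (x w)).sub (hbad _ hlow w ⟨hw, hw1⟩)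
    rw [sub_zero] at hlim
    filter_upwards [hlim.eventually_const_lt hbw] with t ht
    refine ht.trans_le (sub_le_iff_le_add.2 ((measureReal_mono ?_).trans
      (measureReal_union_le _ _)))
    rintro ω ⟨l, hl, hlt⟩
    by_cases hω : ∀ l, c t ω l ∈ Set.Icc (x (u / 2) l) (x w l)
    · exact Or.inl ⟨l, hl, (hiff ((hpos _ hlow l).trans_le (hω l).1)).2 ((hω l).2.trans_lt hlt)⟩
    · exact Or.inr hω
  · obtain ⟨v, ⟨hbv, hv0⟩, hv⟩ := (((hcont.eventually_lt_const hb).and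
      (Ioi_mem_nhds hu.1)).filter_mono (nhdsWithin_le_nhds (s := Set.Iio u))
        |>.and self_mem_nhdsWithin).exists
    have hlim := (hQ (x v)).add (hbad v ⟨hv0, hv⟩ _ hupp)
    rw [add_zero] at hlim
    filter_upwards [hlim.eventually_lt_const hbv] with t ht
    refine lt_of_le_of_lt ((measureReal_mono ?_).trans (measureReal_union_le _ _)) ht
    rintro ω ⟨l, hl, hr⟩
    by_cases hω : ∀ l, c t ω l ∈ Set.Icc (x v l) (x ((u + 1) / 2) l)
    · exact Or.inl ⟨l, hl,
        (hω l).1.trans_lt ((hiff ((hpos v ⟨hv0, hv⟩ l).trans_le (hω l).1)).1 hr)⟩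
    · exact Or.inr hω

end CriticalValues

/-! ### Joint limit of the test statistics -/

section TestStatistics

variable {Ω : Type*} [MeasurableSpace Ω] {P : Measure Ω} [IsProbabilityMeasure P] {a d L : ℕ}

theorem frontier_exists_lt_subset (T : Finset (Fin L)) (y : Fin L → ℝ) :
    frontier {z : Fin L → ℝ | ∃ l ∈ T, y l < z l} ⊆ {z | ∃ l ∈ T, z l = y l} := by
  have hop : IsOpen {z : Fin L → ℝ | ∃ l ∈ T, y l < z l} := by
    have : {z : Fin L → ℝ | ∃ l ∈ T, y l < z l} = ⋃ l ∈ T, {z | y l < z l} := by ext; simp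
    rw [this]
    exact isOpen_biUnion fun l _ => isOpen_lt continuous_const (continuous_apply l)
  have hcl : IsClosed {z : Fin L → ℝ | ∃ l ∈ T, y l ≤ z l} := by
    have : {z : Fin L → ℝ | ∃ l ∈ T, y l ≤ z l} = ⋃ l ∈ T, {z | y l ≤ z l} := by ext; simp
    rw [this]
    exact T.finite_toSet.isClosed_biUnion fun l _ => isClosed_le continuous_const (continuous_apply l)
  intro z hz
  rw [frontier, hop.interior_eq] at hz
  have hsub : {z : Fin L → ℝ | ∃ l ∈ T, y l < z l} ⊆ {z | ∃ l ∈ T, y l ≤ z l} := by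
    rintro z ⟨l, hl, h⟩
    exact ⟨l, hl, h.le⟩
  obtain ⟨l, hl, hle⟩ := closure_minimal hsub hcl hz.1
  exact ⟨l, hl, le_antisymm (not_lt.1 fun h => hz.2 ⟨l, hl, h⟩) hle⟩

/-- Limit distribution of quadratic forms of the scaled mean vector with random matrices. -/
theorem ErrorModel.tendsto_measureReal_exists_lt_quad {eps : Fin a → ℕ → Ω → Fin d → ℝ}
    {Sg : Fin a → Matrix (Fin d) (Fin d) ℝ} (h : ErrorModel P eps Sg) {n : ℕ → Fin a → ℕ}
    {κ : Fin a → ℝ} (hn : GrowingSizes n κ) {D : ℕ → Ω → Fin L → Idx a d → Idx a d → ℝ}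
    (hDm : ∀ t, Measurable (D t)) {D₀ : Fin L → Idx a d → Idx a d → ℝ} (hD : ConvProb P D D₀)
    {A : Fin L → Matrix (Idx a d) (Idx a d) ℝ} (hA : ∀ l, (A l).PosSemidef) (h0 : ∀ l, A l ≠ 0)
    (hDA : ∀ l x, quad (of (D₀ l)) (psdSqrt (limitCov κ Sg) *ᵥ x) = quad (A l) x)
    (T : Finset (Fin L)) (y : Fin L → ℝ) :
    Tendsto (fun t => P.real {ω | ∃ l ∈ T, y l < quad (of (D t ω l))
      (scaledMean (n t) fun i k => eps i k ω).ofLp}) atTop (𝓝 (exceed A T y)) := by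
  set g : EuclideanSpace ℝ (Idx a d) × (Fin L → Idx a d → Idx a d → ℝ) → Fin L → ℝ :=
    fun p l => quad (of (p.2 l)) p.1.ofLp with hg
  have hgc : Continuous g := by
    refine continuous_pi fun l => ?_
    have hc : Continuous fun p : EuclideanSpace ℝ (Idx a d) × (Fin L → Idx a d → Idx a d → ℝ) =>
        ((of (p.2 l), p.1.ofLp) : Matrix (Idx a d) (Idx a d) ℝ × (Idx a d → ℝ)) :=
      Continuous.prodMk ((continuous_apply l).comp continuous_snd)
        ((PiLp.continuous_ofLp 2 _).comp continuous_fst)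
    exact continuous_quad.comp hc
  -- Slutsky's lemma for the scaled mean and all random matrices together, which preserves the
  -- dependence between the statistics.
  have hdist := (h.tendstoInDistribution hn).continuous_comp_prodMk_of_tendstoInMeasure_const hgc
    (convProb_iff_tendstoInMeasure.1 hD) fun t => (hDm t).aemeasurable
  have hE : MeasurableSet {z : Fin L → ℝ | ∃ l ∈ T, y l < z l} := by
    have : {z : Fin L → ℝ | ∃ l ∈ T, y l < z l} = ⋃ l ∈ T, {z | y l < z l} := by ext; simp
    rw [this]
    exact T.measurableSet_biUnion fun l _ => measurableSet_lt measurable_const (measurable_pi_apply l)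
  have hE' : MeasurableSet {z : Fin L → ℝ | ∃ l ∈ T, z l = y l} := by
    have : {z : Fin L → ℝ | ∃ l ∈ T, z l = y l} = ⋃ l ∈ T, {z | z l = y l} := by ext; simp
    rw [this]
    exact T.measurableSet_biUnion fun l _ => measurableSet_eq_fun (measurable_pi_apply l) measurable_const
  have hlim := ProbabilityMeasure.tendsto_measure_of_null_frontier_of_tendsto' hdist.tendsto
    (E := {z : Fin L → ℝ | ∃ l ∈ T, y l < z l}) (by
      refine measure_mono_null (frontier_exists_lt_subset T y) ?_
      refine (Measure.map_apply_of_aemeasurable hdist.aemeasurable_limit hE').trans ?_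
      have hae : ∀ᵐ x ∂(stdNormal (Idx a d)), ∀ l, quad (A l) x ≠ y l :=
        ae_all_iff.2 fun l => ae_quad_ne (hA l) (h0 l) (y l)
      refine measure_mono_null ?_ (ae_iff.1 hae)
      rintro x ⟨l, -, hl⟩
      exact fun hall => hall l ((hDA l x).symm.trans hl))
  have e1 : ∀ t, (P.map (fun ω => g (scaledMean (n t) fun i k => eps i k ω, D t ω)))
      {z : Fin L → ℝ | ∃ l ∈ T, y l < z l} = P {ω | ∃ l ∈ T, y l < quad (of (D t ω l))
      (scaledMean (n t) fun i k => eps i k ω).ofLp} := fun t =>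
    Measure.map_apply_of_aemeasurable (hdist.forall_aemeasurable t) hE
  have e2 : ((stdNormal (Idx a d)).map fun x => g (WithLp.toLp 2 (psdSqrt (limitCov κ Sg) *ᵥ x), D₀))
      {z : Fin L → ℝ | ∃ l ∈ T, y l < z l} = stdNormal (Idx a d) {x | ∃ l ∈ T, y l < quad (A l) x} := by
    rw [Measure.map_apply_of_aemeasurable hdist.aemeasurable_limit hE]
    congr 1
    ext x
    simp only [Set.mem_preimage, Set.mem_ofPred_eq, hg, hDA]
  have hlim' : Tendsto (fun t => P {ω | ∃ l ∈ T, y l < quad (of (D t ω l))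
      (scaledMean (n t) fun i k => eps i k ω).ofLp}) atTop
      (𝓝 (stdNormal (Idx a d) {x | ∃ l ∈ T, y l < quad (A l) x})) := by
    rw [← e2]
    exact Tendsto.congr e1 hlim
  exact (ENNReal.tendsto_toReal (measure_ne_top _ _)).comp hlim'

end TestStatistics

/-! ### Measurability with respect to the data -/

section DataMeasurability

variable {X : Type*} [MeasurableSpace X] {a d : ℕ}

theorem measurable_groupMean {n : ℕ} {x : X → ℕ → Fin d → ℝ}
    (hx : ∀ k < n, ∀ j, Measurable fun ω => x ω k j) (j : Fin d) :
    Measurable fun ω => groupMean n (x ω) j :=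
  (Finset.measurable_fun_sum _ fun k hk => hx k (Finset.mem_range.1 hk) j).const_mul _

theorem measurable_groupCov {n : ℕ} {x : X → ℕ → Fin d → ℝ}
    (hx : ∀ k < n, ∀ j, Measurable fun ω => x ω k j) (j j' : Fin d) :
    Measurable fun ω => groupCov n (x ω) j j' :=
  (Finset.measurable_fun_sum _ fun k hk =>
    ((hx k (Finset.mem_range.1 hk) j).sub (measurable_groupMean hx j)).mul
      ((hx k (Finset.mem_range.1 hk) j').sub (measurable_groupMean hx j'))).const_mul _

theorem measurable_pooledMean {n : Fin a → ℕ} {x : X → Fin a → ℕ → Fin d → ℝ}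
    (hx : ∀ i, ∀ k < n i, ∀ j, Measurable fun ω => x ω i k j) :
    Measurable fun ω => pooledMean n (x ω) :=
  measurable_pi_lambda _ fun p => measurable_groupMean (hx p.1) p.2

theorem measurable_empCov {n : Fin a → ℕ} {x : X → Fin a → ℕ → Fin d → ℝ}
    (hx : ∀ i, ∀ k < n i, ∀ j, Measurable fun ω => x ω i k j) :
    Measurable fun ω => fun p q => empCov n (x ω) p q := by
  refine measurable_pi_lambda _ fun p => measurable_pi_lambda _ fun q => Measurable.const_mul ?_ _
  by_cases h : p.1 = q.1
  · simp only [directSum, of_apply, if_pos h]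
    exact (measurable_groupCov (hx p.1) p.2 q.2).const_mul _
  · simp only [directSum, of_apply, if_neg h]
    exact measurable_const

theorem measurable_dataMat {ι κ : Type*} [Fintype ι] [DecidableEq ι] [Fintype κ]
    (C : Matrix κ ι ℝ) {m : X → κ → κ → ℝ} {S : X → ι → ι → ℝ} (hm : Measurable m)
    (hS : Measurable S) :
    Measurable fun x => fun p q => dataMat C (of (m x)) (of (S x)) p q := by
  refine measurable_pi_lambda _ fun p => measurable_pi_lambda _ fun q => ?_
  have hv := measurable_formVar C hm hS
  obtain ⟨g, hg, e⟩ : ∃ g : (κ → κ → ℝ) → ℝ, Continuous g ∧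
      ∀ m, (Cᵀ * of m * C) p q = g m := by
    refine ⟨_, ?_, fun _ => rfl⟩
    have hc : Continuous fun m : Matrix κ κ ℝ => Cᵀ * m * C := by fun_prop
    exact (continuous_apply q).comp ((continuous_apply p).comp hc)
  have e' : ∀ x, dataMat C (of (m x)) (of (S x)) p q
      = if 0 < formVar C (of (m x)) (of (S x)) then
        (√(formVar C (of (m x)) (of (S x))))⁻¹ * g (m x) else 0 := by
    intro x
    rw [dataMat]
    split_ifs with h
    · rw [← e, Matrix.smul_apply, smul_eq_mul]
    · rfl
  simp_rw [e']
  exact Measurable.ite (measurableSet_lt measurable_const hv)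
    (hv.sqrt.inv.mul (hg.measurable.comp hm)) measurable_const

end DataMeasurability

section DataSigma

variable {Ω : Type*} {a d : ℕ} {n : Fin a → ℕ} {X : Fin a → ℕ → Ω → Fin d → ℝ}
  {S : Ω → Matrix (Idx a d) (Idx a d) ℝ}

theorem dataSigma_le [mΩ : MeasurableSpace Ω] (hX : ∀ i k, Measurable (X i k))
    (hS : ∀ p q, Measurable fun ω => S ω p q) : dataSigma n X S ≤ mΩ := by
  refine Measurable.comap_le (Measurable.prodMk ?_ ?_)
  · exact measurable_pi_lambda _ fun i => measurable_pi_lambda _ fun k => hX i k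
  · exact measurable_pi_lambda _ fun p => measurable_pi_lambda _ fun q => hS p q

theorem measurable_dataSigma_obs (i : Fin a) {k : ℕ} (hk : k < n i) (j : Fin d) :
    Measurable[dataSigma n X S] fun ω => X i k ω j := by
  have h : Measurable fun z : ((i : Fin a) → Fin (n i) → Fin d → ℝ) × (Idx a d → Idx a d → ℝ) =>
      z.1 i ⟨k, hk⟩ j :=
    (measurable_pi_apply j).comp ((measurable_pi_apply (⟨k, hk⟩ : Fin (n i))).comp
      ((measurable_pi_apply i).comp measurable_fst))
  exact h.comp (comap_measurable _)

end DataSigma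

section Test

variable {Ω : Type*} [MeasurableSpace Ω] {P : Measure Ω} {a d L : ℕ} {r : Fin L → ℕ}

theorem localNull_of_globalNull {C : Matrix (Rows r) (Idx a d) ℝ} {β : Rows r → ℝ}
    {mean : Fin a → Fin d → ℝ} (h : GlobalNull C β mean) (l : Fin L) : LocalNull C β mean l :=
  funext fun k => congrFun h ⟨l, k⟩

omit [MeasurableSpace Ω] in
-- Nonempty groups are needed because the mean of an empty group is zero by convention and does not
-- move with the expectation.
theorem sqrt_total_smul_pooledMean_sub {n : Fin a → ℕ} (hn : ∀ i, 0 < n i)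
    (mean : Fin a → Fin d → ℝ) (eps : Fin a → ℕ → Ω → Fin d → ℝ) (ω : Ω) :
    √(total n : ℝ) • (pooledMean n (fun i k => obs mean eps i k ω) - stack mean)
      = (scaledMean n fun i k => eps i k ω).ofLp := by
  ext p
  have h := groupMean_add (hn p.1) (mean p.1) (fun k => eps p.1 k ω) p.2
  have h' : pooledMean n (fun i k => obs mean eps i k ω) p
      = mean p.1 p.2 + groupMean (n p.1) (fun k => eps p.1 k ω) p.2 := h
  simp only [Pi.smul_apply, Pi.sub_apply, h', smul_eq_mul, scaledMean, stack, add_sub_cancel_left]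

end Test

end QFMCT

/-! ### The main theorem -/

theorem mainTheorem4
    {Ω : Type*} [MeasurableSpace Ω] (P : Measure Ω) [IsProbabilityMeasure P]
    -- dimensions: `a` groups, `d` components, `L` local hypotheses with `r l` rows each
    (a d L : ℕ) (ha : 2 ≤ a) (hL : 1 ≤ L) (r : Fin L → ℕ)
    -- expectation vectors and errors of the model `X_{ik} = μ_i + ε_{ik}`
    (mean : Fin a → Fin d → ℝ) (eps : Fin a → ℕ → Ω → Fin d → ℝ)
    (heps_meas : ∀ i k, Measurable (eps i k))
    (heps_indep : iIndepFun (fun (p : Fin a × ℕ) => eps p.1 p.2) P)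
    (heps_ident : ∀ i k k' j,
      IdentDistrib (fun ω => eps i k ω j) (fun ω => eps i k' ω j) P P)
    (heps_mean : ∀ i k j, ∫ ω, eps i k ω j ∂P = 0)
    (Sg : Fin a → Matrix (Fin d) (Fin d) ℝ)
    (heps_sq : ∀ i k j, MemLp (fun ω => eps i k ω j) 2 P)
    (heps_cov : ∀ i k j j',
      covariance (fun ω => eps i k ω j) (fun ω => eps i k ω j') P = Sg i j j')
    -- group sizes along the asymptotics
    (n : ℕ → Fin a → ℕ) (κ : Fin a → ℝ) (hκ : ∀ i, κ i ∈ Set.Ioc (0 : ℝ) 1)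
    (hN : Tendsto (fun t => QFMCT.total (n t)) atTop atTop)
    (hn : ∀ i, Tendsto (fun t => (n t i : ℝ) / (QFMCT.total (n t) : ℝ)) atTop (𝓝 (κ i)))
    -- hypothesis matrix and vector, partitioned into `L` blocks of rows
    (C : Matrix (QFMCT.Rows r) (QFMCT.Idx a d) ℝ) (β : QFMCT.Rows r → ℝ)
    -- the matrix-valued function defining the quadratic forms
    (M : QFMCT.WeightFn a d)
    (hM_meas : ∀ l u v, Measurable fun S : QFMCT.Idx a d → QFMCT.Idx a d → ℝ =>
      M (r l) (QFMCT.blockC C l) (Matrix.of S) u v)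
    (hM_psd : ∀ l S, S.PosSemidef → (M (r l) (QFMCT.blockC C l) S).PosSemidef)
    -- the consistent covariance estimator in the test statistics
    (St : ℕ → Ω → Matrix (QFMCT.Idx a d) (QFMCT.Idx a d) ℝ)
    (hSt_meas : ∀ t p q, Measurable fun ω => St t ω p q)
    (hSt : QFMCT.TendstoInProb P St (QFMCT.limitCov κ Sg))
    -- consistency of `M` at this estimator and at the empirical covariance matrix
    (hM_St : ∀ l, QFMCT.TendstoInProb P
      (fun t ω => M (r l) (QFMCT.blockC C l) (St t ω))
      (M (r l) (QFMCT.blockC C l) (QFMCT.limitCov κ Sg)))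
    (hM_emp : ∀ l, QFMCT.TendstoInProb P
      (fun t ω => M (r l) (QFMCT.blockC C l)
        (QFMCT.empCov (n t) (fun i k => QFMCT.obs mean eps i k ω)))
      (M (r l) (QFMCT.blockC C l) (QFMCT.limitCov κ Sg)))
    -- nondegeneracy: a nonzero eigenvalue of `C_lᵀ M(C_l, Σ) C_l Σ` for every `l`
    (h_eig : ∀ l, ∃ ev : ℝ, ev ≠ 0 ∧ Module.End.HasEigenvalue
      (Matrix.toLin' ((QFMCT.blockC C l)ᵀ *
        M (r l) (QFMCT.blockC C l) (QFMCT.limitCov κ Sg) *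
        QFMCT.blockC C l * QFMCT.limitCov κ Sg)) ev)
    -- Monte-Carlo draws: given the data, independent and normal with the empirical covariance matrix
    (B : ℕ → ℕ) (hB : Tendsto B atTop atTop)
    (Z : (t : ℕ) → Ω → Fin (B t) → EuclideanSpace ℝ (QFMCT.Idx a d))
    (hZ_meas : ∀ t, Measurable (Z t))
    (hZ : ∀ t, QFMCT.HasCondLawGiven P
      (QFMCT.dataSigma (n t) (QFMCT.obs mean eps) (St t)) (Z t)
      (fun ω => Measure.pi fun _ : Fin (B t) => multivariateGaussian 0
        (QFMCT.empCov (n t) (fun i k => QFMCT.obs mean eps i k ω))))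
    (α : ℝ) (hα : α ∈ Set.Ioo (0 : ℝ) 1) :
    -- asymptotic level `α` under the global hypothesis
    (QFMCT.GlobalNull C β mean →
      Tendsto (fun t => ∫ ω, QFMCT.mcTest M C β α (n t)
          (fun i k => QFMCT.obs mean eps i k ω) (St t ω) (Z t ω) Finset.univ ∂P)
        atTop (𝓝 α)) ∧
    -- asymptotic control of the family-wise error rate in the strong sense
    (∀ T : Finset (Fin L), (∀ l ∈ T, QFMCT.LocalNull C β mean l) →
      ∃ c ≤ α, Tendsto (fun t => ∫ ω, QFMCT.mcTest M C β α (n t)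
          (fun i k => QFMCT.obs mean eps i k ω) (St t ω) (Z t ω) T ∂P)
        atTop (𝓝 c)) := by
  classical
  have hmod : QFMCT.ErrorModel P eps Sg :=
    ⟨heps_meas, heps_indep, heps_ident, heps_mean, heps_sq, heps_cov⟩
  have hgrow : QFMCT.GrowingSizes n κ := ⟨fun i => (hκ i).1, hN, hn⟩
  have hS₀p := hmod.posSemidef_limitCov hgrow.pos
  set S₀ := QFMCT.limitCov κ Sg
  have hMp := fun l => hM_psd l S₀ hS₀p
  have hv := fun l => QFMCT.formVar_pos (hMp l) hS₀p (h_eig l)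
  set A := QFMCT.mcMats M C S₀ with hAdef
  have hA : ∀ l, (A l).PosSemidef := fun l => QFMCT.posSemidef_mcMat _ _ (hMp l)
  have h0 : ∀ l, A l ≠ 0 := fun l => QFMCT.mcMat_ne_zero (hMp l) hS₀p (h_eig l)
  have hobs : ∀ i k, Measurable (QFMCT.obs mean eps i k) := fun i k =>
    measurable_pi_lambda _ fun j => (hmod.measurable_coord i k j).const_add _
  have hobs' : ∀ i k j, Measurable fun ω => QFMCT.obs mean eps i k ω j := fun i k j =>
    (measurable_pi_apply j).comp (hobs i k)
  have hG : ∀ t, QFMCT.dataSigma (n t) (QFMCT.obs mean eps) (St t) ≤ ‹MeasurableSpace Ω› :=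
    fun t => QFMCT.dataSigma_le hobs (hSt_meas t)
  -- The covariance matrix of the conditional law must be measurable for the data σ-algebra itself,
  -- which contains only the observations with `k < n i`.
  have hemp : ∀ t, Measurable[QFMCT.dataSigma (n t) (QFMCT.obs mean eps) (St t)]
      fun ω => fun p q => QFMCT.empCov (n t) (fun i k => QFMCT.obs mean eps i k ω) p q := fun t =>
    @QFMCT.measurable_empCov Ω (QFMCT.dataSigma (n t) (QFMCT.obs mean eps) (St t)) a d (n t) _
      fun i k hk j => QFMCT.measurable_dataSigma_obs i hk j
  have hemp' : ∀ t, Measurable fun ω => fun p q =>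
      QFMCT.empCov (n t) (fun i k => QFMCT.obs mean eps i k ω) p q := fun t =>
    (hemp t).mono (hG t) le_rfl
  have hSt' : ∀ t, Measurable fun ω => fun p q => St t ω p q := fun t =>
    measurable_pi_lambda _ fun p => measurable_pi_lambda _ fun q => hSt_meas t p q
  -- critical values
  have hconv : QFMCT.ConvProb P (fun t ω => QFMCT.mcMats M C
      (QFMCT.empCov (n t) fun i k => QFMCT.obs mean eps i k ω)) A :=
    QFMCT.ConvProb.pi (E := fun _ => Matrix (QFMCT.Idx a d) (QFMCT.Idx a d) ℝ) fun l =>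
      ((hM_emp l).convProb.prodMk (hmod.convProb_empCov mean hgrow)).comp_continuousWithinAt
        (fun t ω => QFMCT.posSemidef_empCov _ _) (QFMCT.continuousWithinAt_mcMat hS₀p (hv l))
  set q : (t : ℕ) → Ω → Fin (B t) → Fin L → ℝ := fun t ω =>
    QFMCT.mcForms M C (QFMCT.empCov (n t) fun i k => QFMCT.obs mean eps i k ω) (Z t ω) with hq
  have hfreq : ∀ T y, QFMCT.ConvProb P (fun t ω => QFMCT.exceedFreq (q t ω) T y)
      (QFMCT.exceed A T y) := fun T y =>
    QFMCT.convProb_exceedFreq hM_meas hG hemp hB hZ_meas hZ hA h0 hconv T y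
  have hqm : ∀ t l, Measurable fun ω => QFMCT.critValue (q t ω) α l := fun t l =>
    (QFMCT.measurable_critValue α l).comp
      (QFMCT.measurable_mcForms hM_meas (hemp' t) (hZ_meas t))
  obtain ⟨x, hx⟩ := QFMCT.exists_isQuantileFn hA h0
  obtain ⟨u, hu, hxu⟩ := hx.exists_exceed_eq hA h0 hL hα
  -- test statistics
  have hQm : ∀ t l, Measurable fun ω => QFMCT.testStat M (QFMCT.blockC C l) (QFMCT.blockβ β l)
      (QFMCT.total (n t)) (QFMCT.pooledMean (n t) fun i k => QFMCT.obs mean eps i k ω) (St t ω) :=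
    fun t l => QFMCT.measurable_testStat (hM_meas l) _ _ (hSt' t)
      (QFMCT.measurable_pooledMean fun i k _ j => hobs' i k j)
  set D : ℕ → Ω → Fin L → QFMCT.Idx a d → QFMCT.Idx a d → ℝ := fun t ω l p p' =>
    QFMCT.dataMat (QFMCT.blockC C l) (M (r l) (QFMCT.blockC C l) (St t ω)) (St t ω) p p' with hD
  have hDm : ∀ t, Measurable (D t) := fun t => measurable_pi_lambda _ fun l =>
    QFMCT.measurable_dataMat _ (measurable_pi_lambda _ fun k => measurable_pi_lambda _ fun k' =>
      (hM_meas l k k').comp (hSt' t)) (hSt' t)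
  have hDc : QFMCT.ConvProb P D fun l => QFMCT.dataMat (QFMCT.blockC C l)
      (M (r l) (QFMCT.blockC C l) S₀) S₀ :=
    QFMCT.ConvProb.pi (E := fun _ => Matrix (QFMCT.Idx a d) (QFMCT.Idx a d) ℝ) fun l =>
      ((hM_St l).convProb.prodMk hSt.convProb).comp_continuousAt
        (QFMCT.continuousAt_dataMat (hv l))
  have hQ : ∀ T : Finset (Fin L), (∀ l ∈ T, QFMCT.LocalNull C β mean l) → ∀ y : Fin L → ℝ,
      Tendsto (fun t => P.real {ω | ∃ l ∈ T, y l < QFMCT.testStat M (QFMCT.blockC C l)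
        (QFMCT.blockβ β l) (QFMCT.total (n t))
        (QFMCT.pooledMean (n t) fun i k => QFMCT.obs mean eps i k ω) (St t ω)})
        atTop (𝓝 (QFMCT.exceed A T y)) := by
    intro T hT y
    refine (hmod.tendsto_measureReal_exists_lt_quad hgrow hDm hDc hA h0
      (fun l z => QFMCT.quad_dataMat_psdSqrt (hv l) z) T y).congr' ?_
    filter_upwards [eventually_all.2 fun i => (hgrow.tendsto_group i).eventually_gt_atTop 0]
      with t ht
    congr 1
    ext ω
    simp only [Set.mem_ofPred_eq]
    refine exists_congr fun l => and_congr_right fun hl => ?_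
    rw [QFMCT.testStat_eq_quad M (hT l hl), QFMCT.sqrt_total_smul_pooledMean_sub ht]
    rfl
  -- The same `u` serves every `T`: the limits of the critical values depend neither on `T` nor on
  -- which hypotheses are true.
  have hmain : ∀ T : Finset (Fin L), (∀ l ∈ T, QFMCT.LocalNull C β mean l) →
      Tendsto (fun t => ∫ ω, QFMCT.mcTest M C β α (n t)
        (fun i k => QFMCT.obs mean eps i k ω) (St t ω) (Z t ω) T ∂P)
        atTop (𝓝 (QFMCT.exceed A T (x u))) := fun T hT =>
    (QFMCT.tendsto_measureReal_exists_ratioExceedsOne hA h0 hx (hQ T hT) hu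
      fun v hv w hw => QFMCT.withHighProb_critValue_mem_Icc hL hA h0 hx hB hfreq hxu hu hv hw).congr
      fun t => (QFMCT.integral_maxReject P (hQm t) (hqm t) T).symm
  refine ⟨fun hnull => ?_, fun T hT => ⟨_, ?_, hmain T hT⟩⟩
  · have h := hmain Finset.univ fun l _ => QFMCT.localNull_of_globalNull hnull l
    rwa [hxu] at h
  · rw [← hxu]
    exact QFMCT.exceed_mono (Finset.subset_univ T) _
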